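/- Let $d\ge 1$ and $\mathbb T^d=\mathbb R^d/\mathbb Z^d$. A symplectic twist map is a $C^1$ diffeomorphism $f$ of $\mathbb T^d\times\mathbb R^d$ that has a lift $F(q,p)=(Q(q,p),P(q,p))$ to $\mathbb R^d\times\mathbb R^d$ such that $F(q+m,p)=F(q,p)+(m,0)$ for all $m\in\mathbb Z^d$, the map $(q,p)\mapsto(q,Q(q,p))$ is a $C^1$ diffeomorphism of $\mathbb R^d\times\mathbb R^d$, and there is a generating function $S:\mathbb R^d\times\mathbb R^d\to\mathbb R$ of $F$, i.e. $S(q+m,Q+m)=S(q,Q)$ for all $m\in\mathbb Z^d$ and $P\,dQ-p\,dq=dS(q,Q)$. It is strongly positive if it admits a $C^2$ generating function $S$ (that is, a generating function of one of its lifts) and $\alpha,\beta>0$ with $-\beta\|v\|^2\le\partial^2_{q,Q}S(q,Q)(v,v)\le-\alpha\|v\|^2$ for all $q,Q,v\in\mathbb R^d$; it has bounded rate if it admits a $C^2$ generating function $S$ for which $\partial^2_{q,q}S$ and $\partial^2_{Q,Q}S$ are bounded on $\mathbb R^d\times\mathbb R^d$. It has the analyticity property if there is a holomorphic diffeomorphism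 $\mathcal F=(Q,P)$ of $\mathbb C^d\times\mathbb C^d$ whose restriction to $\mathbb R^d\times\mathbb R^d$ is a lift of $f$, for which $(q,p)\mapsto(q,Q(q,p))$ is a diffeomorphism of $\mathbb C^d\times\mathbb C^d$, and which has a generating function $S:\mathbb C^d\times\mathbb C^d\to\mathbb C$, i.e. $S(q+m,Q+m)=S(q,Q)$ for all $m\in\mathbb Z^d$ and $P\,dQ-p\,dq=dS(q,Q)$. For $m\in\mathbb Z^d$ and an integer $n\ge1$ with $\gcd(m_1,\dots,m_d,n)=1$, a Lipschitz Lagrangian $(m,n)$-periodic graph of a lift $F$ is the graph of a Lipschitz, $\mathbb Z^d$-periodic function $\gamma:\mathbb R^d\to\mathbb R^d$ such that $\int_{\mathbb T}\gamma(\nu(t))\cdot\dot\nu(t)\,dt=0$ for every $C^1$ loop $\nu:\mathbb T\to\mathbb R^d$, and $F^n(q,\gamma(q))=(q+m,\gamma(q))$ for all $q\in\mathbb R^d$. **Theorem.** Let $f$ be a symplectic twist map of $\mathbb T^d\times\mathbb R^d$, $F$ a lift of $f$ and $S$ a generating function of $F$. Let $G\in C^2(\mathbb T^d)$ be real-valued,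 and let $(f_\varepsilon)_{\varepsilon\in\mathbb R}$ be the family of symplectic twist maps with generating functions $S_\varepsilon(q,Q)=S(q,Q)+\varepsilon G(q)$. Let $(F_\varepsilon)_{\varepsilon\in\mathbb R}$ be a continuous family of lifts of the $f_\varepsilon$. Assume that $f$ is strongly positive, that $f$ has the analyticity property, and that $G$ (as a function on $\mathbb R^d$) admits a holomorphic extension to $\mathbb C^d$. Then, for every $m\in\mathbb Z^d$ and $n\ge 1$ with $m$ and $n$ coprime, the set $$\{\varepsilon\in\mathbb R:\ F_\varepsilon \text{ has a Lipschitz Lagrangian } (m,n)\text{-periodic graph}\}$$ is either the whole of $\mathbb R$ or consists of isolated points (each of its points is isolated in it). If, in addition, $f$ has bounded rate and $G$ is non-constant, then this set is finite. -/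

import Mathlib

namespace TwistMap

/-- The configuration space `𝕜^d` with its Euclidean norm (`𝕜 = ℝ` or `ℂ`). -/
abbrev Vec (𝕜 : Type) (d : ℕ) : Type := EuclideanSpace 𝕜 (Fin d)

/-- The phase space `𝕜^d × 𝕜^d`, with points `(q, p)`. -/
abbrev Phase (𝕜 : Type) (d : ℕ) : Type := Vec 𝕜 d × Vec 𝕜 d

/-- The annulus `𝕋^d × ℝ^d`, where `𝕋^d = ℝ^d / ℤ^d`. -/
abbrev Annulus (d : ℕ) : Type := UnitAddTorus (Fin d) × Vec ℝ d

/-- The projection `ℝ^d → 𝕋^d`. -/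
def toTorus {d : ℕ} (q : Vec ℝ d) : UnitAddTorus (Fin d) := fun i => (q i : UnitAddCircle)

/-- The universal covering `ℝ^d × ℝ^d → 𝕋^d × ℝ^d`. -/
def toAnnulus {d : ℕ} (x : Phase ℝ d) : Annulus d := (toTorus x.1, x.2)

/-- The integer vector `m ∈ ℤ^d` as an element of `𝕜^d`. -/
noncomputable def intVec (𝕜 : Type) [RCLike 𝕜] {d : ℕ} (m : Fin d → ℤ) : Vec 𝕜 d :=
  WithLp.toLp 2 fun i => (m i : 𝕜)

/-- The inclusion `ℝ^d ⊆ ℂ^d`. -/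
noncomputable def complexify {d : ℕ} (q : Vec ℝ d) : Vec ℂ d :=
  WithLp.toLp 2 fun i => (q i : ℂ)

/-- `F` is a lift of the self-map `f` of the annulus to the universal cover. -/
def IsLift {d : ℕ} (F : Phase ℝ d → Phase ℝ d) (f : Annulus d → Annulus d) : Prop :=
  Continuous F ∧ ∀ x, toAnnulus (F x) = f (toAnnulus x)

/-- A self-map of the annulus is `C^1` when it has a `C^1` lift: the covering is a local
diffeomorphism, and every continuous self-map of the annulus has a lift. -/
def IsC1 {d : ℕ} (f : Annulus d → Annulus d) : Prop :=
  ∃ F : Phase ℝ d → Phase ℝ d, IsLift F f ∧ ContDiff ℝ 1 F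

/-- `C^1` diffeomorphisms of the annulus `𝕋^d × ℝ^d`. -/
def IsC1Diffeo {d : ℕ} (f : Annulus d → Annulus d) : Prop :=
  IsC1 f ∧ ∃ g : Annulus d → Annulus d,
    Function.LeftInverse g f ∧ Function.RightInverse g f ∧ IsC1 g

/-- `C^1` diffeomorphisms of a normed space over `𝕜`. For `𝕜 = ℂ` the derivatives are complex,
so these are the holomorphic diffeomorphisms. -/
def IsDiffeo (𝕜 : Type) [RCLike 𝕜] {X : Type} [NormedAddCommGroup X] [NormedSpace 𝕜 X]
    (F : X → X) : Prop :=
  ContDiff 𝕜 1 F ∧ ∃ H : X → X,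
    Function.LeftInverse H F ∧ Function.RightInverse H F ∧ ContDiff 𝕜 1 H

/-- The twist condition: `(q, p) ↦ (q, Q(q, p))` is a diffeomorphism, where `F = (Q, P)`. -/
def TwistCondition (𝕜 : Type) [RCLike 𝕜] {d : ℕ} (F : Phase 𝕜 d → Phase 𝕜 d) : Prop :=
  IsDiffeo 𝕜 fun x : Phase 𝕜 d => ((x.1, (F x).1) : Phase 𝕜 d)

/-- `S` is a generating function of `F(q, p) = (Q, P)`: it is invariant under the diagonal
translations by `ℤ^d`, and `P dQ - p dq = dS(q, Q)`. -/
def IsGeneratingFunction (𝕜 : Type) [RCLike 𝕜] {d : ℕ} (F : Phase 𝕜 d → Phase 𝕜 d)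
    (S : Phase 𝕜 d → 𝕜) : Prop :=
  (∀ (m : Fin d → ℤ) (q Q : Vec 𝕜 d), S (q + intVec 𝕜 m, Q + intVec 𝕜 m) = S (q, Q)) ∧
  ∀ q p : Vec 𝕜 d,
    DifferentiableAt 𝕜 S (q, (F (q, p)).1) ∧
    ∀ u v : Vec 𝕜 d, fderiv 𝕜 S (q, (F (q, p)).1) (u, v) =
      ∑ i, (F (q, p)).2 i * v i - ∑ i, p i * u i

/-- Symplectic twist maps of the annulus `𝕋^d × ℝ^d`. -/
def IsSymplecticTwistMap {d : ℕ} (f : Annulus d → Annulus d) : Prop :=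
  IsC1Diffeo f ∧ ∃ F : Phase ℝ d → Phase ℝ d,
    IsLift F f ∧
    (∀ (m : Fin d → ℤ) (q p : Vec ℝ d),
      F (q + intVec ℝ m, p) = F (q, p) + (intVec ℝ m, 0)) ∧
    TwistCondition ℝ F ∧
    ∃ S : Phase ℝ d → ℝ, IsGeneratingFunction ℝ F S

/-- `S` is a generating function of the self-map `f` of the annulus, that is, of a lift of `f`. -/
def Generates {d : ℕ} (S : Phase ℝ d → ℝ) (f : Annulus d → Annulus d) : Prop :=
  ∃ F : Phase ℝ d → Phase ℝ d, IsLift F f ∧ IsGeneratingFunction ℝ F S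

/-- The second derivative of `S` at the point `x`, as a bilinear form. -/
noncomputable def hess {d : ℕ} (S : Phase ℝ d → ℝ) (x ξ η : Phase ℝ d) : ℝ :=
  fderiv ℝ (fderiv ℝ S) x ξ η

/-- Strong positivity: `-β ‖v‖² ≤ ∂²_{q,Q} S(q, Q)(v, v) ≤ -α ‖v‖²` with `α, β > 0`, for some
`C^2` generating function `S`. -/
def IsStronglyPositive {d : ℕ} (f : Annulus d → Annulus d) : Prop :=
  ∃ S : Phase ℝ d → ℝ, Generates S f ∧ ContDiff ℝ 2 S ∧
    ∃ α β : ℝ, 0 < α ∧ 0 < β ∧ ∀ q Q v : Vec ℝ d,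
      -β * ‖v‖ ^ 2 ≤ hess S (q, Q) (v, 0) (0, v) ∧ hess S (q, Q) (v, 0) (0, v) ≤ -α * ‖v‖ ^ 2

/-- Bounded rate: `∂²_{q,q} S` and `∂²_{Q,Q} S` are bounded for some `C^2` generating
function `S`. -/
def HasBoundedRate {d : ℕ} (f : Annulus d → Annulus d) : Prop :=
  ∃ S : Phase ℝ d → ℝ, Generates S f ∧ ContDiff ℝ 2 S ∧
    ∃ C : ℝ, ∀ q Q u v : Vec ℝ d,
      |hess S (q, Q) (u, 0) (v, 0)| ≤ C * ‖u‖ * ‖v‖ ∧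
      |hess S (q, Q) (0, u) (0, v)| ≤ C * ‖u‖ * ‖v‖

/-- The analyticity property: some lift of `f` extends to a holomorphic diffeomorphism of
`ℂ^d × ℂ^d` that satisfies the twist condition and has a generating function. -/
def HasAnalyticityProperty {d : ℕ} (f : Annulus d → Annulus d) : Prop :=
  ∃ A : Phase ℂ d → Phase ℂ d,
    IsDiffeo ℂ A ∧
    (∃ F : Phase ℝ d → Phase ℝ d, IsLift F f ∧
      ∀ q p : Vec ℝ d, A (complexify q, complexify p) =
        (complexify (F (q, p)).1, complexify (F (q, p)).2)) ∧
    TwistCondition ℂ A ∧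
    ∃ S : Phase ℂ d → ℂ, IsGeneratingFunction ℂ A S

/-- A function on `𝕋^d` admits a holomorphic extension to `ℂ^d`. -/
def HasHolomorphicExtension {d : ℕ} (G : UnitAddTorus (Fin d) → ℝ) : Prop :=
  ∃ g : Vec ℂ d → ℂ, Differentiable ℂ g ∧ ∀ q : Vec ℝ d, g (complexify q) = (G (toTorus q) : ℂ)

/-- `m ∈ ℤ^d` and `n` are coprime: `gcd(m_1, …, m_d, n) = 1`. -/
def CoprimePair {d : ℕ} (m : Fin d → ℤ) (n : ℕ) : Prop :=
  ∀ k : ℕ, k ∣ n → (∀ i, (k : ℤ) ∣ m i) → k = 1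

/-- The graph of `γ : ℝ^d → ℝ^d` is Lagrangian: `∫_𝕋 γ(ν(t)) · ν'(t) dt = 0` for every `C^1` loop
`ν`, a loop being a `1`-periodic map on `ℝ`. -/
def IsLagrangianGraph {d : ℕ} (γ : Vec ℝ d → Vec ℝ d) : Prop :=
  ∀ ν : ℝ → Vec ℝ d, ContDiff ℝ 1 ν → (∀ t, ν (t + 1) = ν t) →
    ∫ t in (0 : ℝ)..1, inner ℝ (γ (ν t)) (deriv ν t) = 0

/-- `F` has a Lipschitz Lagrangian `(m, n)`-periodic graph. -/
def HasLagrangianPeriodicGraph {d : ℕ} (F : Phase ℝ d → Phase ℝ d) (m : Fin d → ℤ) (n : ℕ) :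
    Prop :=
  ∃ γ : Vec ℝ d → Vec ℝ d,
    (∃ K : NNReal, LipschitzWith K γ) ∧
    (∀ (k : Fin d → ℤ) (q : Vec ℝ d), γ (q + intVec ℝ k) = γ q) ∧
    IsLagrangianGraph γ ∧
    ∀ q : Vec ℝ d, F^[n] (q, γ q) = (q + intVec ℝ m, γ q)

/-- The parameters `ε` for which `F_ε` has a Lipschitz Lagrangian `(m, n)`-periodic graph. -/
def periodicGraphParameters {d : ℕ} (Fε : ℝ → Phase ℝ d → Phase ℝ d) (m : Fin d → ℤ) (n : ℕ) :
    Set ℝ :=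
  {ε | HasLagrangianPeriodicGraph (Fε ε) m n}

end TwistMap

/-! Write `F_ε^n(q, p) = (Q_n, P_n)` and call ε a parameter if `F_ε` has the required graph. Such a
graph is the gradient graph of a potential `w` with Lipschitz gradient γ; `w` itself need not be
periodic.

Minimization. Strong positivity makes `S_ε` grow quadratically in `Q - q`, so for each endpoint some
chain minimizes `w(y_0)` plus the action. It is an orbit starting on the graph, where the n-step
action is a constant `a`. Hence `w(y_n - m) + a ≤ w(y_0) + action(y)` for every chain `y`, with
equality along the graph (`exists_calibration`). This inequality has three consequences. The graph
is unique for each ε (`graph_unique`). Varying one end of an orbit bounds γ and its Lipschitz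
constant, locally uniformly in ε (`exists_uniform_bound`). The second variation excludes conjugate
points, so `∂Q_n/∂p` is invertible along the graph (`nondegenerate`).

Compactness. The uniform bounds make the set of parameters closed, and uniqueness makes γ depend
continuously on ε (`isClosed_parameters`, `eventually_graph_near`).

Analyticity. Near the graph at `ε₀` the implicit function theorem solves `Q_n(q, p) = q + m` by an
analytic `p(ε, q)`, on an interval of ε independent of `q` (`exists_continuation`). The map `p(ε,
·)` gives a graph of the required kind as soon as the momentum returns to itself and `D_q p` is
symmetric. For fixed `q` both conditions are analytic equations in ε, and they hold at parameters
close to `ε₀`. If parameters accumulate at `ε₀`, both hold on the whole interval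
(`parameters_mem_nhds`). Accumulation points are therefore interior, and connectedness of ℝ gives
the dichotomy.

Finiteness. Second differences of `w` are bounded from both sides by moving the first and the last
point of an orbit. The term `ε g` enters only one of these bounds, so with bounded rate `0 ≤ 2C‖δ‖²
+ ε (g(q+δ) + g(q-δ) - 2g(q))`. Evaluating at a maximum and a minimum of `g` bounds ε
(`exists_bound_parameters`), and a compact discrete set is finite. -/

namespace TwistMap

open scoped ContDiff Topology

/-! ### Entire functions of several complex variables are analytic. -/

section Osgood

variable {E F : Type} [NormedAddCommGroup E] [NormedSpace ℂ E]
  [NormedAddCommGroup F] [NormedSpace ℂ F]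

theorem deriv_comp_line {f : E → F} (hf : Differentiable ℂ f) (x v : E) (z : ℂ) :
    HasDerivAt (fun z : ℂ => f (x + z • v)) (fderiv ℂ f (x + z • v) v) z := by
  have h1 : HasDerivAt (fun z : ℂ => x + z • v) v z := by
    simpa using ((hasDerivAt_id z).smul_const v).const_add x
  exact (hf (x + z • v)).hasFDerivAt.comp_hasDerivAt z h1

/-- The one-variable Cauchy estimate on the complex line through `x` in direction `v`, with radius
`r / ‖v‖`. -/
theorem norm_fderiv_le_of_closedBall {f : E → F} (hf : Differentiable ℂ f) {x : E} {r C : ℝ}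
    (hr : 0 < r) (hC : ∀ y ∈ Metric.closedBall x r, ‖f y‖ ≤ C) : ‖fderiv ℂ f x‖ ≤ C / r := by
  have hC0 : 0 ≤ C := (norm_nonneg _).trans (hC x (Metric.mem_closedBall_self hr.le))
  refine ContinuousLinearMap.opNorm_le_bound _ (by positivity) fun v => ?_
  rcases eq_or_ne v 0 with rfl | hv
  · simp
  have hv' : 0 < ‖v‖ := norm_pos_iff.2 hv
  have hd := deriv_comp_line hf x v 0
  have := Complex.norm_deriv_le_of_forall_mem_sphere_norm_le (c := 0) (R := r / ‖v‖) (C := C)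
    (f := fun z : ℂ => f (x + z • v)) (by positivity)
    (Differentiable.diffContOnCl fun z => (deriv_comp_line hf x v z).differentiableAt) (by
      intro z hz
      apply hC
      simp only [mem_sphere_iff_norm, sub_zero] at hz
      simp [norm_smul, hz, hv'.ne'])
  rw [hd.deriv] at this
  simp only [zero_smul, add_zero] at this
  calc _ ≤ _ := this
    _ = _ := by field_simp

/-- The increment `f(· + h) - f` is at most `M‖h‖` near `x0` by the mean value inequality; the
Cauchy estimate applied to it bounds the increment of the derivative by `M‖h‖`. -/
theorem continuous_fderiv_of_differentiable [FiniteDimensional ℂ E] {f : E → F}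
    (hf : Differentiable ℂ f) : Continuous (fderiv ℂ f) := by
  have : ProperSpace E := FiniteDimensional.proper ℂ E
  rw [continuous_iff_continuousAt]
  intro x0
  obtain ⟨M, hM⟩ := (isCompact_closedBall x0 3).exists_bound_of_continuousOn hf.continuous.continuousOn
  have hM1 : ∀ y ∈ Metric.closedBall x0 2, ‖fderiv ℂ f y‖ ≤ M := by
    intro y hy
    have := norm_fderiv_le_of_closedBall hf (x := y) one_pos (C := M) (fun z hz => hM z (by
      have := dist_triangle z y x0
      simp only [Metric.mem_closedBall] at *
      linarith))
    simpa using this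
  have hlip : ∀ x ∈ Metric.closedBall x0 2, ∀ y ∈ Metric.closedBall x0 2,
      ‖f y - f x‖ ≤ M * ‖y - x‖ := fun x hx y hy =>
    letI : NormedSpace ℝ E := NormedSpace.restrictScalars ℝ ℂ E
    (convex_closedBall x0 2).norm_image_sub_le_of_norm_fderiv_le (𝕜 := ℂ) (fun z _ => hf z) hM1 hx hy
  have key : ∀ x ∈ Metric.ball x0 1, ‖fderiv ℂ f x - fderiv ℂ f x0‖ ≤ M * ‖x - x0‖ := by
    intro x hx
    have hd : HasFDerivAt (fun y => f (y + (x - x0)) - f y) (fderiv ℂ f x - fderiv ℂ f x0) x0 := by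
      have h1 : HasFDerivAt (fun y => f (y + (x - x0))) (fderiv ℂ f x) x0 := by
        rw [hasFDerivAt_comp_add_right]
        simpa using (hf x).hasFDerivAt
      exact h1.sub (hf x0).hasFDerivAt
    have := norm_fderiv_le_of_closedBall (f := fun y => f (y + (x - x0)) - f y)
      ((hf.comp (differentiable_id.add_const _)).sub hf) (x := x0) one_pos (C := M * ‖x - x0‖)
      (fun z hz => by
        have := hlip z (by simp only [Metric.mem_closedBall] at *; linarith) (z + (x - x0)) (by
          simp only [Metric.mem_closedBall, Metric.mem_ball, dist_eq_norm] at *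
          calc ‖z + (x - x0) - x0‖ = ‖(z - x0) + (x - x0)‖ := by congr 1; abel
            _ ≤ ‖z - x0‖ + ‖x - x0‖ := norm_add_le _ _
            _ ≤ 2 := by linarith)
        simpa using this)
    rw [hd.fderiv] at this
    simpa using this
  rw [ContinuousAt, tendsto_iff_norm_sub_tendsto_zero]
  have h0 : Filter.Tendsto (fun x => M * ‖x - x0‖) (𝓝 x0) (𝓝 0) := by
    have : Continuous fun x => M * ‖x - x0‖ := by fun_prop
    simpa using this.tendsto x0
  refine squeeze_zero' (Filter.Eventually.of_forall fun _ => norm_nonneg _) ?_ h0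
  filter_upwards [Metric.ball_mem_nhds x0 one_pos] with x hx using key x hx

/-- Cauchy's formula along direction `v` writes the directional derivative as an integral of values
of `f`, which is then differentiated under the integral sign. -/
theorem differentiable_fderiv_apply [FiniteDimensional ℂ E] [CompleteSpace F] {f : E → F}
    (hf : Differentiable ℂ f) (v : E) : Differentiable ℂ fun x => fderiv ℂ f x v := by
  have : ProperSpace E := FiniteDimensional.proper ℂ E
  have hcont := continuous_fderiv_of_differentiable hf
  set K : ℝ → ℂ := fun θ => deriv (circleMap 0 1) θ * ((circleMap 0 1 θ) ^ 2)⁻¹ with hK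
  have hKc : Continuous K := by
    simp only [hK, deriv_circleMap]
    refine Continuous.mul (by fun_prop) (Continuous.inv₀ (by fun_prop) fun θ => ?_)
    simp [circleMap]
  have hcm : Continuous (circleMap 0 1) := by fun_prop
  have hrep : (fun x => fderiv ℂ f x v) = fun x => (2 * Real.pi * Complex.I : ℂ)⁻¹ •
      ∫ θ in (0 : ℝ)..2 * Real.pi, K θ • f (x + circleMap 0 1 θ • v) := by
    funext x
    have h := Complex.two_pi_I_inv_smul_circleIntegral_sub_sq_inv_smul_of_differentiable
      (U := Set.univ) (c := 0) (R := 1) (w₀ := 0) isOpen_univ (Set.subset_univ _)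
      (f := fun z : ℂ => f (x + z • v))
      (fun z _ => (deriv_comp_line hf x v z).differentiableAt.differentiableWithinAt)
      (by simp)
    rw [(deriv_comp_line hf x v 0).deriv] at h
    simp only [zero_smul, add_zero] at h
    rw [← h, circleIntegral]
    congr 1
    refine intervalIntegral.integral_congr fun θ _ => ?_
    simp [hK, mul_smul]
  rw [hrep]
  refine Differentiable.const_smul (fun x0 => ?_) _
  obtain ⟨M, hM⟩ := (isCompact_closedBall x0 (1 + ‖v‖)).exists_bound_of_continuousOn
    hcont.continuousOn
  have hint := intervalIntegral.hasFDerivAt_integral_of_dominated_of_fderiv_le (𝕜 := ℂ)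
    (μ := MeasureTheory.volume) (a := (0 : ℝ)) (b := 2 * Real.pi) (x₀ := x0)
    (s := Metric.ball x0 1) (bound := fun θ => ‖K θ‖ * M)
    (F := fun x θ => K θ • f (x + circleMap 0 1 θ • v))
    (F' := fun x θ => K θ • fderiv ℂ f (x + circleMap 0 1 θ • v))
    (Metric.ball_mem_nhds x0 one_pos)
    (Filter.Eventually.of_forall fun x => by
      have : Continuous fun θ => K θ • f (x + circleMap 0 1 θ • v) :=
        hKc.smul (hf.continuous.comp (by fun_prop))
      exact this.aestronglyMeasurable)
    (by
      have : Continuous fun θ => K θ • f (x0 + circleMap 0 1 θ • v) :=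
        hKc.smul (hf.continuous.comp (by fun_prop))
      exact this.intervalIntegrable _ _)
    (by
      have : Continuous fun θ => K θ • fderiv ℂ f (x0 + circleMap 0 1 θ • v) :=
        hKc.smul (hcont.comp (by fun_prop))
      exact this.aestronglyMeasurable)
    (Filter.Eventually.of_forall fun θ _ x hx => by
      rw [norm_smul]
      refine mul_le_mul_of_nonneg_left (hM _ ?_) (norm_nonneg _)
      simp only [Metric.mem_closedBall, Metric.mem_ball, dist_eq_norm] at *
      calc ‖x + circleMap 0 1 θ • v - x0‖ = ‖(x - x0) + circleMap 0 1 θ • v‖ := by congr 1; abel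
        _ ≤ ‖x - x0‖ + ‖circleMap 0 1 θ • v‖ := norm_add_le _ _
        _ ≤ 1 + ‖v‖ := by
          rw [norm_smul]
          simp only [norm_circleMap_zero, abs_one, one_mul]
          linarith)
    ((hKc.norm.mul continuous_const).intervalIntegrable _ _)
    (Filter.Eventually.of_forall fun θ _ x _ => by
      refine HasFDerivAt.const_smul ?_ _
      rw [hasFDerivAt_comp_add_right]
      exact (hf _).hasFDerivAt)
  exact hint.differentiableAt

theorem differentiable_fderiv [FiniteDimensional ℂ E] [CompleteSpace F] {f : E → F}
    (hf : Differentiable ℂ f) : Differentiable ℂ (fderiv ℂ f) := by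
  have h := differentiable_fderiv_apply hf
  let b := Module.finBasis ℂ E
  have hrep : fderiv ℂ f = fun x => ∑ i, ContinuousLinearMap.smulRightL ℂ E F
      (LinearMap.toContinuousLinearMap (b.coord i)) (fderiv ℂ f x (b i)) := by
    funext x
    ext v
    conv_lhs => rw [← b.sum_repr v, map_sum]
    rw [_root_.sum_apply]
    exact Finset.sum_congr rfl fun i _ => by simp
  rw [hrep]
  exact Differentiable.fun_sum fun i _ => (ContinuousLinearMap.differentiable _).comp (h (b i))

theorem differentiable_iteratedFDeriv [FiniteDimensional ℂ E] (k : ℕ) :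
    ∀ {F : Type} [NormedAddCommGroup F] [NormedSpace ℂ F] [CompleteSpace F] {f : E → F},
    Differentiable ℂ f → Differentiable ℂ (iteratedFDeriv ℂ k f) := by
  induction k with
  | zero =>
    intro F _ _ _ f hf
    rw [iteratedFDeriv_zero_eq_comp]
    exact (LinearIsometryEquiv.differentiable _).comp hf
  | succ k ih =>
    intro F _ _ _ f hf
    rw [funext fun x => iteratedFDeriv_succ_eq_comp_right (𝕜 := ℂ) (f := f) (x := x) (n := k)]
    exact (LinearIsometryEquiv.differentiable _).comp (ih (differentiable_fderiv hf))

/-- One Cauchy estimate per derivative, each using up radius `r`. -/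
theorem norm_iteratedFDeriv_le_of_closedBall [FiniteDimensional ℂ E] {r : ℝ} (hr : 0 < r) (k : ℕ) :
    ∀ {F : Type} [NormedAddCommGroup F] [NormedSpace ℂ F] [CompleteSpace F] {f : E → F} {x : E}
    {C : ℝ}, Differentiable ℂ f → (∀ y ∈ Metric.closedBall x (k * r), ‖f y‖ ≤ C) →
    ‖iteratedFDeriv ℂ k f x‖ ≤ C / r ^ k := by
  induction k with
  | zero =>
    intro F _ _ _ f x C hf hC
    simpa using hC x (by simp)
  | succ k ih =>
    intro F _ _ _ f x C hf hC
    rw [← norm_iteratedFDeriv_fderiv, pow_succ', ← div_div]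
    refine ih (differentiable_fderiv hf) fun y hy => norm_fderiv_le_of_closedBall hf hr fun z hz => ?_
    apply hC
    have := dist_triangle z y x
    simp only [Metric.mem_closedBall] at *
    push_cast
    linarith

theorem iteratedDeriv_comp_line [FiniteDimensional ℂ E] [CompleteSpace F] {f : E → F}
    (hf : Differentiable ℂ f) (x v : E) (k : ℕ) :
    iteratedDeriv k (fun z : ℂ => f (x + z • v)) =
      fun z => iteratedFDeriv ℂ k f (x + z • v) fun _ => v := by
  induction k with
  | zero => funext z; simp
  | succ k ih =>
    rw [iteratedDeriv_succ, ih]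
    funext z
    have hd := (deriv_comp_line (differentiable_iteratedFDeriv k hf) x v z)
    have hd2 := ((ContinuousMultilinearMap.apply ℂ (fun _ : Fin k => E) F
      (fun _ => v)).hasFDerivAt).comp_hasDerivAt z hd
    rw [iteratedFDeriv_succ_apply_left]
    exact hd2.deriv

/-- Osgood's lemma: an entire function of several complex variables is analytic. -/
theorem analyticAt_of_differentiable [FiniteDimensional ℂ E] [CompleteSpace F] {f : E → F}
    (hf : Differentiable ℂ f) (x : E) : AnalyticAt ℂ f x := by
  have : ProperSpace E := FiniteDimensional.proper ℂ E
  obtain ⟨M, hM⟩ := (isCompact_closedBall x 1).exists_bound_of_continuousOn hf.continuous.continuousOn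
  have hM0 : 0 ≤ M := (norm_nonneg _).trans (hM x (by simp))
  let p : FormalMultilinearSeries ℂ E F := fun k => ((k.factorial : ℂ)⁻¹) • iteratedFDeriv ℂ k f x
  have hp : ∀ k, ‖p k‖ * ((Real.toNNReal (Real.exp (-1)) : NNReal) : ℝ) ^ k ≤ M := by
    intro k
    rw [Real.coe_toNNReal _ (Real.exp_pos _).le]
    rcases Nat.eq_zero_or_pos k with rfl | hk
    · simpa [p] using hM x (by simp)
    have hk' : (0 : ℝ) < k := by exact_mod_cast hk
    -- Radius `1 / k` for each of the `k` estimates stays in the unit ball and costs `k ^ k`;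
    -- dividing by `k!` leaves at most `e ^ k`, whence the radius `e⁻¹` of convergence.
    have h1 := norm_iteratedFDeriv_le_of_closedBall (r := 1 / k) (by positivity) k hf (x := x) (C := M)
      (fun y hy => hM y (by
        rwa [mul_one_div_cancel hk'.ne'] at hy))
    have h2 : (k : ℝ) ^ k / k.factorial ≤ Real.exp k := Real.pow_div_factorial_le_exp _ hk'.le k
    have h3 : ‖p k‖ ≤ M * Real.exp k := by
      simp only [p, norm_smul, norm_inv, RCLike.norm_natCast]
      calc (k.factorial : ℝ)⁻¹ * ‖iteratedFDeriv ℂ k f x‖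
          ≤ (k.factorial : ℝ)⁻¹ * (M / (1 / k) ^ k) := by gcongr
        _ = M * ((k : ℝ) ^ k / k.factorial) := by
          rw [one_div, inv_pow, div_inv_eq_mul]; ring
        _ ≤ _ := by gcongr
    calc ‖p k‖ * Real.exp (-1) ^ k ≤ (M * Real.exp k) * Real.exp (-1) ^ k := by gcongr
      _ = M := by
        rw [← Real.exp_nat_mul, mul_assoc, ← Real.exp_add]
        simp
  refine ⟨p, ENNReal.ofReal (Real.exp (-1)), ⟨?_, ?_, ?_⟩⟩
  · exact p.le_radius_of_bound M hp
  · exact ENNReal.ofReal_pos.2 (Real.exp_pos _)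
  · intro y _
    have := Complex.hasSum_taylorSeries_of_entire (f := fun z : ℂ => f (x + z • y))
      (fun z => (deriv_comp_line hf x y z).differentiableAt) 0 1
    simpa [iteratedDeriv_comp_line hf, p] using this

end Osgood

end TwistMap

namespace TwistMap

open scoped ContDiff Topology

/-! ### Potentials of Lagrangian graphs. -/

section Potential

/-- A `C^1` staircase function, with derivative `b`. -/
theorem exists_staircase : ∃ B b : ℝ → ℝ, Continuous b ∧ (∀ t, HasDerivAt B (b t) t) ∧
    (∀ t, B (t + 1) = B t + 1) ∧
    (∀ t ∈ Set.Icc (-5 / 6 : ℝ) (-1 / 6), B t = 0 ∧ b t = 0) ∧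
    (∀ t ∈ Set.Icc (1 / 6 : ℝ) (5 / 6), B t = 1 ∧ b t = 0) := by
  -- This bump is positive exactly for `|t| < 1/6` modulo 1; the staircase is its primitive,
  -- normalized to rise by 1 per period.
  set c : ℝ → ℝ := fun t => max (Real.cos (2 * Real.pi * t) - 1 / 2) 0 with hc
  have hcc : Continuous c := by fun_prop
  have hper : ∀ t, c (t + 1) = c t := fun t => by
    simp only [hc]
    rw [mul_add, mul_one, Real.cos_add_two_pi]
  have hflat : ∀ t ∈ Set.Icc (1 / 6 : ℝ) (5 / 6), c t = 0 := by
    intro t ht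
    simp only [hc]
    rw [max_eq_right]
    have hpi := Real.pi_pos
    have : Real.cos (2 * Real.pi * t) ≤ Real.cos (Real.pi / 3) := by
      rcases le_total t (1 / 2) with h | h
      · exact Real.cos_le_cos_of_nonneg_of_le_pi (by positivity) (by nlinarith) (by nlinarith [ht.1])
      · rw [← Real.cos_two_pi_sub (2 * Real.pi * t)]
        exact Real.cos_le_cos_of_nonneg_of_le_pi (by positivity) (by nlinarith) (by nlinarith [ht.2])
    rw [Real.cos_pi_div_three] at this
    linarith
  have hflat' : ∀ t ∈ Set.Icc (-5 / 6 : ℝ) (-1 / 6), c t = 0 := by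
    intro t ht
    rw [← hper]
    exact hflat _ ⟨by linarith [ht.1], by linarith [ht.2]⟩
  set I : ℝ := ∫ t in (-1 / 6 : ℝ)..(1 / 6), c t with hI
  have hIpos : 0 < I := by
    refine intervalIntegral.integral_pos (by norm_num) hcc.continuousOn
      (fun t _ => le_max_right _ _) ⟨0, by norm_num, ?_⟩
    simp only [hc]
    norm_num
  have hii : ∀ a b : ℝ, IntervalIntegrable c MeasureTheory.volume a b :=
    fun a b => hcc.intervalIntegrable a b
  have hfull : ∀ t : ℝ, ∫ s in t..(t + 1), c s = I := by
    intro t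
    have hp : Function.Periodic c 1 := hper
    rw [hp.intervalIntegral_add_eq t (-1 / 6),
      ← intervalIntegral.integral_add_adjacent_intervals (hii _ (1 / 6)) (hii _ _)]
    rw [intervalIntegral.integral_congr (g := fun _ => (0 : ℝ)) (a := 1 / 6) (b := -1 / 6 + 1)]
    · simp [hI]
    · intro s hs
      rw [Set.uIcc_of_le (by norm_num)] at hs
      exact hflat s ⟨hs.1, by linarith [hs.2]⟩
  refine ⟨fun t => (∫ s in (-1 / 6 : ℝ)..t, c s) / I, fun t => c t / I, by fun_prop, ?_, ?_, ?_, ?_⟩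
  · intro t
    exact (intervalIntegral.integral_hasDerivAt_right (hii _ _)
      (hcc.stronglyMeasurableAtFilter _ _) hcc.continuousAt).div_const I
  · intro t
    beta_reduce
    rw [← intervalIntegral.integral_add_adjacent_intervals (hii _ t) (hii _ _), hfull, add_div,
      div_self hIpos.ne']
  · intro t ht
    refine ⟨?_, by simp only [hflat' t ht, zero_div]⟩
    beta_reduce
    rw [intervalIntegral.integral_congr (g := fun _ => (0 : ℝ))]
    · simp
    · intro s hs
      rw [Set.uIcc_of_ge ht.2] at hs
      exact hflat' s ⟨ht.1.trans hs.1, hs.2⟩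
  · intro t ht
    refine ⟨?_, by simp only [hflat t ht, zero_div]⟩
    beta_reduce
    rw [← intervalIntegral.integral_add_adjacent_intervals (hii _ (1 / 6)) (hii _ _),
      intervalIntegral.integral_congr (g := fun _ => (0 : ℝ)) (a := 1 / 6) (b := t)]
    · simp only [intervalIntegral.integral_zero, add_zero]
      exact div_self hIpos.ne'
    · intro s hs
      rw [Set.uIcc_of_le ht.1] at hs
      exact hflat s ⟨hs.1, hs.2.trans ht.2⟩

variable {d : ℕ}

/-- The circulation of a Lagrangian graph along a triangle vanishes. -/
theorem IsLagrangianGraph.integral_triangle {γ : Vec ℝ d → Vec ℝ d} (hc : Continuous γ)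
    (hL : IsLagrangianGraph γ) (x y : Vec ℝ d) :
    (∫ t in (0 : ℝ)..1, inner ℝ (γ (t • x)) x) +
      (∫ t in (0 : ℝ)..1, inner ℝ (γ (x + t • (y - x))) (y - x)) =
      ∫ t in (0 : ℝ)..1, inner ℝ (γ (t • y)) y := by
  obtain ⟨B, b, hb, hB, hB1, hlo, hhi⟩ := exists_staircase
  have hBc : Continuous B := continuous_iff_continuousAt.2 fun t => (hB t).continuousAt
  -- The Lagrangian condition tests only `C^1` loops, so the triangle `0, x, y` is traversed with
  -- velocity zero at the vertices. The three edge vectors sum to zero, which makes the loop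
  -- periodic.
  set ν : ℝ → Vec ℝ d := fun t => B t • x + B (t - 1 / 3) • (y - x) + B (t - 2 / 3) • (-y) with hν
  have hνd : ∀ t, HasDerivAt ν (b t • x + b (t - 1 / 3) • (y - x) + b (t - 2 / 3) • (-y)) t := by
    intro t
    exact (((hB t).smul_const x).add (((hB _).comp_sub_const t _).smul_const (y - x))).add
      (((hB _).comp_sub_const t _).smul_const (-y))
  have hderiv : deriv ν = fun t => b t • x + b (t - 1 / 3) • (y - x) + b (t - 2 / 3) • (-y) :=
    funext fun t => (hνd t).deriv
  have hν1 : ContDiff ℝ 1 ν := by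
    rw [contDiff_one_iff_deriv]
    refine ⟨fun t => (hνd t).differentiableAt, ?_⟩
    rw [hderiv]
    fun_prop
  have hper : ∀ t, ν (t + 1) = ν t := by
    intro t
    simp only [hν]
    rw [show t + 1 - 1 / 3 = (t - 1 / 3) + 1 by ring, show t + 1 - 2 / 3 = (t - 2 / 3) + 1 by ring,
      hB1, hB1, hB1]
    module
  have h0 := hL ν hν1 hper
  have hνc : Continuous ν := hν1.continuous
  set φ : ℝ → ℝ := fun t => inner ℝ (γ (ν t)) (deriv ν t) with hφ
  have hφc : Continuous φ := by
    refine (hc.comp hνc).inner ?_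
    rw [hderiv]
    fun_prop
  have hφp : Function.Periodic φ 1 := by
    intro t
    simp only [hφ, hderiv, hper]
    have hbp : ∀ t, b (t + 1) = b t := fun t => by
      have h1 := (hB (t + 1)).comp_add_const t 1
      have h2 : HasDerivAt (fun t => B (t + 1)) (b t) t := by
        simp only [hB1]
        exact (hB t).add_const 1
      exact h1.unique h2
    rw [show t + 1 - 1 / 3 = (t - 1 / 3) + 1 by ring, show t + 1 - 2 / 3 = (t - 2 / 3) + 1 by ring,
      hbp, hbp, hbp]
  have hii : ∀ a b : ℝ, IntervalIntegrable φ MeasureTheory.volume a b :=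
    fun a b => hφc.intervalIntegrable a b
  have h1 : ∫ t in (-1 / 6 : ℝ)..(-1 / 6 + 1), φ t = 0 := by
    rw [hφp.intervalIntegral_add_eq (-1 / 6) 0, zero_add]
    exact h0
  rw [← intervalIntegral.integral_add_adjacent_intervals (hii _ (1 / 6)) (hii _ _),
    ← intervalIntegral.integral_add_adjacent_intervals (hii (1 / 6) (1 / 2)) (hii _ _)] at h1
  have hBl : B (-1 / 6) = 0 := (hlo _ (by norm_num)).1
  have hBr : B (1 / 6) = 1 := (hhi _ (by norm_num)).1
  have edge : ∀ p e : Vec ℝ d, ∀ τ a c : ℝ, a - τ = -1 / 6 → c - τ = 1 / 6 →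
      (∀ t ∈ Set.Icc a c, ν t = p + B (t - τ) • e ∧ deriv ν t = b (t - τ) • e) →
      ∫ t in a..c, φ t = ∫ t in (0 : ℝ)..1, inner ℝ (γ (p + t • e)) e := by
    intro p e τ a c ha hc' h
    have h2 := intervalIntegral.integral_comp_mul_deriv (a := a) (b := c) (f := fun t => B (t - τ))
      (f' := fun t => b (t - τ)) (g := fun s => inner ℝ (γ (p + s • e)) e)
      (fun t _ => (hB _).comp_sub_const t _) (by fun_prop) (by fun_prop)
    simp only [ha, hc', hBl, hBr] at h2
    rw [← h2]
    refine intervalIntegral.integral_congr fun t ht => ?_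
    rw [Set.uIcc_of_le (by linarith)] at ht
    simp only [hφ, (h t ht).1, (h t ht).2, inner_smul_right, Function.comp]
    ring
  have hν' : ∀ t, ν t = B t • x + B (t - 1 / 3) • (y - x) + B (t - 2 / 3) • (-y) := fun t => rfl
  have hderiv' : ∀ t, deriv ν t = b t • x + b (t - 1 / 3) • (y - x) + b (t - 2 / 3) • (-y) :=
    fun t => congrFun hderiv t
  have E1 := edge 0 x 0 (-1 / 6) (1 / 6) (by norm_num) (by norm_num) (fun t ht => by
    obtain ⟨ha, hb⟩ := ht
    obtain ⟨e1, e2⟩ := hlo (t - 1 / 3) ⟨by linarith, by linarith⟩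
    obtain ⟨e3, e4⟩ := hlo (t - 2 / 3) ⟨by linarith, by linarith⟩
    rw [hν', hderiv', e1, e2, e3, e4, sub_zero]
    constructor <;> module)
  have E2 := edge x (y - x) (1 / 3) (1 / 6) (1 / 2) (by norm_num) (by norm_num) (fun t ht => by
    obtain ⟨ha, hb⟩ := ht
    obtain ⟨e1, e2⟩ := hhi t ⟨by linarith, by linarith⟩
    obtain ⟨e3, e4⟩ := hlo (t - 2 / 3) ⟨by linarith, by linarith⟩
    rw [hν', hderiv', e1, e2, e3, e4]
    constructor <;> module)
  have E3 := edge y (-y) (2 / 3) (1 / 2) (-1 / 6 + 1) (by norm_num) (by norm_num) (fun t ht => by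
    obtain ⟨ha, hb⟩ := ht
    obtain ⟨e1, e2⟩ := hhi t ⟨by linarith, by linarith⟩
    obtain ⟨e3, e4⟩ := hhi (t - 1 / 3) ⟨by linarith, by linarith⟩
    rw [hν', hderiv', e1, e2, e3, e4]
    constructor <;> module)
  have h3 : ∫ t in (0 : ℝ)..1, inner ℝ (γ (y + t • (-y))) (-y) =
      -∫ t in (0 : ℝ)..1, inner ℝ (γ (t • y)) y := by
    have := intervalIntegral.integral_comp_sub_left (a := 0) (b := 1)
      (fun t => inner ℝ (γ (t • y)) (-y)) 1
    simp only [sub_self, sub_zero] at this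
    rw [← intervalIntegral.integral_neg]
    simp only [← inner_neg_right]
    rw [← this]
    refine intervalIntegral.integral_congr fun t _ => ?_
    have : y + t • (-y) = (1 - t) • y := by module
    simp only [this]
  rw [E1, E2, E3, h3] at h1
  simp only [zero_add] at h1
  linarith

/-- The potential is the integral of γ along rays from 0. By the triangle identity its increment
from `x` to `y` is the integral along the segment, and continuity of γ gives the derivative. -/
theorem IsLagrangianGraph.exists_potential {γ : Vec ℝ d → Vec ℝ d} (hc : Continuous γ)
    (hL : IsLagrangianGraph γ) : ∃ w : Vec ℝ d → ℝ, w 0 = 0 ∧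
      ∀ x, HasFDerivAt w (innerSL ℝ (γ x)) x := by
  refine ⟨fun x => ∫ t in (0 : ℝ)..1, inner ℝ (γ (t • x)) x, by simp, fun x => ?_⟩
  rw [hasFDerivAt_iff_isLittleO, Asymptotics.isLittleO_iff]
  intro ε hε
  obtain ⟨δ, hδ, hγ⟩ := Metric.continuousAt_iff.1 hc.continuousAt ε hε
  filter_upwards [Metric.ball_mem_nhds x hδ] with y hy
  have h1 := hL.integral_triangle hc x y
  rw [← h1, add_sub_cancel_left]
  have h2 : inner ℝ (γ x) (y - x) = ∫ t in (0 : ℝ)..1, inner ℝ (γ x) (y - x) := by simp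
  rw [innerSL_apply_apply, h2, ← intervalIntegral.integral_sub]
  · refine (intervalIntegral.norm_integral_le_of_norm_le_const (C := ε * ‖y - x‖) ?_).trans
      (by simp)
    intro t ht
    rw [Set.uIoc_of_le zero_le_one] at ht
    rw [← inner_sub_left]
    refine (norm_inner_le_norm _ _).trans ?_
    refine mul_le_mul_of_nonneg_right ?_ (norm_nonneg _)
    rw [← dist_eq_norm]
    refine (hγ ?_).le
    rw [dist_eq_norm, add_sub_cancel_left, norm_smul, Real.norm_eq_abs, abs_of_pos ht.1]
    rw [Metric.mem_ball, dist_eq_norm] at hy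
    exact (mul_le_of_le_one_left (norm_nonneg _) ht.2).trans_lt hy
  · exact Continuous.intervalIntegrable (by fun_prop) _ _
  · exact Continuous.intervalIntegrable (by fun_prop) _ _

theorem isLagrangianGraph_of_potential {γ : Vec ℝ d → Vec ℝ d} (hc : Continuous γ) {w : Vec ℝ d → ℝ}
    (hw : ∀ x, HasFDerivAt w (innerSL ℝ (γ x)) x) : IsLagrangianGraph γ := by
  intro ν hν hper
  have h := intervalIntegral.integral_eq_sub_of_hasDerivAt (a := 0) (b := 1) (f := fun t => w (ν t))
    (f' := fun t => inner ℝ (γ (ν t)) (deriv ν t)) (fun t _ =>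
      (hw (ν t)).comp_hasDerivAt t (hν.differentiable one_ne_zero t).hasDerivAt)
    (Continuous.intervalIntegrable ((hc.comp hν.continuous).inner
      (hν.continuous_deriv le_rfl)) _ _)
  rw [h]
  have := hper 0
  rw [zero_add] at this
  rw [this, sub_self]

/-- `w` is approximated to first order by `γ`, with a uniform quadratic error. -/
def HasQuadraticApprox (w : Vec ℝ d → ℝ) (γ : Vec ℝ d → Vec ℝ d) (C : ℝ) : Prop :=
  ∀ x y, |w y - w x - inner ℝ (γ x) (y - x)| ≤ C * ‖y - x‖ ^ 2

theorem HasQuadraticApprox.hasFDerivAt {w : Vec ℝ d → ℝ} {γ : Vec ℝ d → Vec ℝ d} {C : ℝ}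
    (h : HasQuadraticApprox w γ C) (x : Vec ℝ d) : HasFDerivAt w (innerSL ℝ (γ x)) x := by
  rw [hasFDerivAt_iff_isLittleO]
  have h1 : (fun y => w y - w x - innerSL ℝ (γ x) (y - x)) =O[𝓝 x] fun y => ‖y - x‖ ^ 2 :=
    Asymptotics.IsBigO.of_bound C (Filter.Eventually.of_forall fun y => by
      simpa using h x y)
  exact h1.trans_isLittleO (Asymptotics.isLittleO_pow_sub_sub x one_lt_two)

/-- Compare the expansions at `x` and `y` in the point `x + k`, where `k` has length `‖x - y‖` and
the direction of `γ x - γ y`. The three errors cost `4C`, `C` and `C`. -/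
theorem HasQuadraticApprox.lipschitzWith {w : Vec ℝ d → ℝ} {γ : Vec ℝ d → Vec ℝ d} {C : ℝ}
    (hC : 0 ≤ C) (h : HasQuadraticApprox w γ C) : LipschitzWith (Real.toNNReal (6 * C)) γ := by
  refine LipschitzWith.of_dist_le_mul fun x y => ?_
  rw [Real.coe_toNNReal _ (by positivity), dist_eq_norm, dist_eq_norm]
  rcases eq_or_ne (γ x) (γ y) with he | he
  · rw [he, sub_self, norm_zero]; positivity
  set g := γ x - γ y with hg
  have hg0 : 0 < ‖g‖ := norm_pos_iff.2 (sub_ne_zero.2 he)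
  set k := (‖x - y‖ / ‖g‖) • g with hk
  have hkn : ‖k‖ = ‖x - y‖ := by
    rw [hk, norm_smul, Real.norm_eq_abs, abs_of_nonneg (by positivity)]
    field_simp
  have h1 := abs_le.1 (h y (x + k))
  have h2 := abs_le.1 (h x (x + k))
  have h3 := abs_le.1 (h y x)
  rw [add_sub_cancel_left, hkn] at h2
  have h4 : ‖x + k - y‖ ^ 2 ≤ 4 * ‖x - y‖ ^ 2 := by
    have : ‖x + k - y‖ ≤ 2 * ‖x - y‖ := by
      calc ‖x + k - y‖ = ‖(x - y) + k‖ := by congr 1; abel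
        _ ≤ ‖x - y‖ + ‖k‖ := norm_add_le _ _
        _ = _ := by rw [hkn]; ring
    nlinarith [norm_nonneg (x + k - y)]
  have h5 : inner ℝ (γ y) (x + k - y) = inner ℝ (γ y) (x - y) + inner ℝ (γ y) k := by
    rw [← inner_add_right]; congr 1; abel
  have h6 : inner ℝ (γ x) k - inner ℝ (γ y) k = ‖x - y‖ * ‖g‖ := by
    rw [← inner_sub_left, ← hg, hk, inner_smul_right, real_inner_self_eq_norm_sq]
    field_simp
  have h7 : ‖x - y‖ * ‖g‖ ≤ 6 * C * ‖x - y‖ ^ 2 := by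
    nlinarith [mul_le_mul_of_nonneg_left h4 hC]
  rcases (norm_nonneg (x - y)).eq_or_lt with h0 | h0
  · have : x = y := sub_eq_zero.1 (norm_eq_zero.1 h0.symm)
    exact absurd (congrArg γ this) he
  · nlinarith

theorem hasQuadraticApprox_of_lipschitzWith {w : Vec ℝ d → ℝ} {γ : Vec ℝ d → Vec ℝ d} {K : NNReal}
    (hγ : LipschitzWith K γ) (hw : ∀ x, HasFDerivAt w (innerSL ℝ (γ x)) x) :
    HasQuadraticApprox w γ K := by
  intro x y
  have := (convex_closedBall x ‖y - x‖).norm_image_sub_le_of_norm_hasFDerivWithin_le'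
    (𝕜 := ℝ) (f := w) (φ := innerSL ℝ (γ x)) (C := K * ‖y - x‖) (x := x) (y := y)
    (fun z _ => (hw z).hasFDerivWithinAt) (fun z hz => by
      rw [← map_sub, innerSL_apply_norm]
      refine (hγ.norm_sub_le _ _).trans ?_
      rw [mem_closedBall_iff_norm] at hz
      gcongr) (by simp) (by simp [dist_eq_norm])
  rw [Real.norm_eq_abs, innerSL_apply_apply] at this
  calc _ ≤ _ := this
    _ = _ := by ring

end Potential

end TwistMap

namespace TwistMap

open scoped ContDiff Topology

variable {d : ℕ}

/-! ### A compact fundamental domain. -/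

section Cube

/-- The unit cube of `ℝ^d`, a fundamental domain of `ℤ^d`. -/
def cube (d : ℕ) : Set (Vec ℝ d) := {q | ∀ i, q i ∈ Set.Icc (0 : ℝ) 1}

theorem isCompact_cube : IsCompact (cube d) := by
  have h : IsCompact (Set.pi Set.univ fun _ : Fin d => Set.Icc (0 : ℝ) 1) :=
    isCompact_univ_pi fun _ => isCompact_Icc
  have h2 := h.image (PiLp.continuous_toLp 2 fun _ : Fin d => ℝ)
  convert h2 using 1
  ext q
  constructor
  · intro hq
    exact ⟨WithLp.ofLp q, fun i _ => hq i, rfl⟩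
  · rintro ⟨y, hy, rfl⟩ i
    exact hy i (Set.mem_univ i)

theorem exists_add_intVec_mem_cube (q : Vec ℝ d) : ∃ k : Fin d → ℤ, q + intVec ℝ k ∈ cube d := by
  refine ⟨fun i => -⌊q i⌋, fun i => ?_⟩
  have : (q + intVec ℝ fun i => -⌊q i⌋) i = Int.fract (q i) := by
    simp [intVec, Int.fract, sub_eq_add_neg]
  rw [this]
  exact ⟨Int.fract_nonneg _, (Int.fract_lt_one _).le⟩

theorem exists_bound_of_periodic {E : Type*} [NormedAddCommGroup E] {γ : Vec ℝ d → E}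
    (hc : Continuous γ) (hper : ∀ (k : Fin d → ℤ) q, γ (q + intVec ℝ k) = γ q) :
    ∃ B, 0 ≤ B ∧ ∀ q, ‖γ q‖ ≤ B := by
  obtain ⟨B, hB⟩ := isCompact_cube.exists_bound_of_continuousOn hc.continuousOn
  refine ⟨max B 0, le_max_right _ _, fun q => ?_⟩
  obtain ⟨k, hk⟩ := exists_add_intVec_mem_cube q
  rw [← hper k q]
  exact (hB _ hk).trans (le_max_left _ _)

end Cube

/-- The action of a finite chain. -/
noncomputable def action (S : Phase ℝ d → ℝ) (n : ℕ) (y : ℕ → Vec ℝ d) : ℝ :=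
  ∑ k ∈ Finset.range n, S (y k, y (k + 1))

/-- A `C^2` generating function `S` of superlinear growth, and its twist map `F`. -/
structure IsCoerciveTwist (S : Phase ℝ d → ℝ) (F : Phase ℝ d → Phase ℝ d) : Prop where
  contDiff_S : ContDiff ℝ 2 S
  contDiff_F : ContDiff ℝ 1 F
  fderiv_inj : ∀ x ξ, fderiv ℝ F x ξ = 0 → ξ = 0
  generates : ∀ q p u v, fderiv ℝ S (q, (F (q, p)).1) (u, v) =
    inner ℝ (F (q, p)).2 v - inner ℝ p u
  surj : ∀ q Q, ∃ p, (F (q, p)).1 = Q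
  coercive : ∃ c C : ℝ, 0 < c ∧ ∀ q Q, c * ‖Q - q‖ ^ 2 - C ≤ S (q, Q)

/-- A Lipschitz periodic `γ` with potential `w` whose graph consists of `(m, n)`-periodic points. -/
structure IsPeriodicPotential (F : Phase ℝ d → Phase ℝ d) (m : Fin d → ℤ) (n : ℕ)
    (γ : Vec ℝ d → Vec ℝ d) (w : Vec ℝ d → ℝ) : Prop where
  lipschitz : ∃ K : NNReal, LipschitzWith K γ
  periodic : ∀ (k : Fin d → ℤ) q, γ (q + intVec ℝ k) = γ q
  hasFDerivAt : ∀ q, HasFDerivAt w (innerSL ℝ (γ q)) q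
  iterate : ∀ q, F^[n] (q, γ q) = (q + intVec ℝ m, γ q)

/-! ### Minimizing chains, calibration and uniqueness of the graph. -/

section Chains

variable {S : Phase ℝ d → ℝ} {F : Phase ℝ d → Phase ℝ d} {m : Fin d → ℤ} {n : ℕ}
  {γ : Vec ℝ d → Vec ℝ d} {w : Vec ℝ d → ℝ}

theorem IsCoerciveTwist.hasFDerivAt_S (h : IsCoerciveTwist S F) (x : Phase ℝ d) :
    HasFDerivAt S (fderiv ℝ S x) x :=
  (h.contDiff_S.differentiable two_ne_zero x).hasFDerivAt

theorem IsPeriodicPotential.continuous_γ (hw : IsPeriodicPotential F m n γ w) : Continuous γ :=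
  let ⟨_, hK⟩ := hw.lipschitz
  hK.continuous

theorem IsPeriodicPotential.continuous_w (hw : IsPeriodicPotential F m n γ w) : Continuous w :=
  continuous_iff_continuousAt.2 fun q => (hw.hasFDerivAt q).continuousAt

theorem abs_sub_le_of_gradient_le {B : ℝ} (hw : ∀ q, HasFDerivAt w (innerSL ℝ (γ q)) q)
    (hB : ∀ q, ‖γ q‖ ≤ B) (x y : Vec ℝ d) : |w y - w x| ≤ B * ‖y - x‖ := by
  have := convex_univ.norm_image_sub_le_of_norm_hasFDerivWithin_le (𝕜 := ℝ) (f := w) (C := B)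
    (x := x) (y := y) (fun z _ => (hw z).hasFDerivWithinAt) (fun z _ => by
      rw [innerSL_apply_norm]; exact hB z) (Set.mem_univ _) (Set.mem_univ _)
  simpa using this

/-- The derivative of the action along an orbit telescopes. -/
theorem IsCoerciveTwist.sum_fderiv_orbit (h : IsCoerciveTwist S F) (x : Phase ℝ d)
    (ζ : ℕ → Vec ℝ d) (n : ℕ) :
    ∑ k ∈ Finset.range n, fderiv ℝ S ((F^[k] x).1, (F^[k + 1] x).1) (ζ k, ζ (k + 1)) =
      inner ℝ (F^[n] x).2 (ζ n) - inner ℝ x.2 (ζ 0) := by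
  have := Finset.sum_range_sub (fun k => inner ℝ (F^[k] x).2 (ζ k)) n
  simp only [Function.iterate_zero, id_eq] at this
  rw [← this]
  refine Finset.sum_congr rfl fun k _ => ?_
  rw [Function.iterate_succ_apply']
  exact h.generates (F^[k] x).1 (F^[k] x).2 _ _

theorem IsCoerciveTwist.contDiff_iterate (h : IsCoerciveTwist S F) (k : ℕ) :
    ContDiff ℝ 1 (F^[k]) := by
  induction k with
  | zero => exact contDiff_id
  | succ k ih => rw [Function.iterate_succ]; exact ih.comp h.contDiff_F

/-- The derivative of the action telescopes to boundary terms, which cancel because both ends move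
equally and carry the same momentum. Since γ is only Lipschitz, the chain rule is replaced by a
first-order expansion of `S` along Lipschitz curves. -/
theorem IsCoerciveTwist.action_graph_const (h : IsCoerciveTwist S F)
    (hw : IsPeriodicPotential F m n γ w) : ∃ a, ∀ q,
      action S n (fun k => (F^[k] (q, γ q)).1) = a := by
  suffices hd : ∀ q, HasFDerivAt (fun q => action S n (fun k => (F^[k] (q, γ q)).1))
      (0 : Vec ℝ d →L[ℝ] ℝ) q from
    ⟨action S n (fun k => (F^[k] (0, γ 0)).1), fun q => is_const_of_fderiv_eq_zero (𝕜 := ℝ)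
      (fun q => (hd q).differentiableAt) (fun q => (hd q).fderiv) q 0⟩
  intro q
  obtain ⟨K, hK⟩ := hw.lipschitz
  have hF : ∀ k, ContDiff ℝ 1 (F^[k]) := h.contDiff_iterate
  have hO : ∀ k, (fun q' => F^[k] (q', γ q') - F^[k] (q, γ q)) =O[𝓝 q] fun q' => q' - q := by
    intro k
    have h1 : Filter.Tendsto (fun q' => (q', γ q')) (𝓝 q) (𝓝 (q, γ q)) :=
      (continuous_id.prodMk hK.continuous).tendsto q
    have h2 := ((hF k).differentiable one_ne_zero (q, γ q)).hasFDerivAt.isBigO_sub.comp_tendsto h1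
    refine h2.trans (Asymptotics.IsBigO.of_bound (max 1 K) (Filter.Eventually.of_forall fun q' => ?_))
    simp only [Function.comp, Prod.mk_sub_mk, Prod.norm_mk]
    have := hK.norm_sub_le q' q
    refine max_le ?_ ?_
    · nlinarith [le_max_left (1 : ℝ) K, norm_nonneg (q' - q)]
    · nlinarith [le_max_right (1 : ℝ) K, norm_nonneg (q' - q)]
  set z : ℕ → Vec ℝ d → Phase ℝ d := fun k q' => ((F^[k] (q', γ q')).1, (F^[k + 1] (q', γ q')).1)
    with hz
  have hzO : ∀ k, (fun q' => z k q' - z k q) =O[𝓝 q] fun q' => q' - q := by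
    intro k
    have h1 := (hO k).prod_left (hO (k + 1))
    refine (Asymptotics.IsBigO.of_bound 1 (Filter.Eventually.of_forall fun q' => ?_)).trans h1
    simp only [hz, Prod.mk_sub_mk, Prod.norm_mk, one_mul]
    exact max_le_max (norm_fst_le (F^[k] (q', γ q') - F^[k] (q, γ q)))
      (norm_fst_le (F^[k + 1] (q', γ q') - F^[k + 1] (q, γ q)))
  have hzc : ∀ k, Filter.Tendsto (z k) (𝓝 q) (𝓝 (z k q)) := by
    intro k
    have h0 : Filter.Tendsto (fun q' => q' - q) (𝓝 q) (𝓝 0) := by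
      have h1 : Continuous fun q' => q' - q := by fun_prop
      simpa using h1.tendsto q
    exact tendsto_sub_nhds_zero_iff.1 ((hzO k).trans_tendsto h0)
  have hterm : ∀ k, (fun q' => S (z k q') - S (z k q) - fderiv ℝ S (z k q) (z k q' - z k q))
      =o[𝓝 q] fun q' => q' - q := fun k =>
    ((h.hasFDerivAt_S (z k q)).isLittleO.comp_tendsto (hzc k)).trans_isBigO (hzO k)
  rw [hasFDerivAt_iff_isLittleO]
  have hsum := Asymptotics.IsLittleO.fun_sum (s := Finset.range n) fun k _ => hterm k
  refine hsum.congr_left fun q' => ?_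
  rw [Finset.sum_sub_distrib, Finset.sum_sub_distrib]
  have hT := h.sum_fderiv_orbit (q, γ q)
    (fun k => (F^[k] (q', γ q')).1 - (F^[k] (q, γ q)).1) n
  rw [hw.iterate, hw.iterate] at hT
  simp only [Function.iterate_zero, id_eq, add_sub_add_right_eq_sub, sub_self] at hT
  have hT' : ∑ k ∈ Finset.range n, fderiv ℝ S (z k q) (z k q' - z k q) = 0 := hT
  rw [hT']
  simp [action, hz]

theorem norm_sub_le_sum (y : ℕ → Vec ℝ d) {j n : ℕ} (hj : j ≤ n) :
    ‖y j - y n‖ ≤ ∑ k ∈ Finset.range n, ‖y (k + 1) - y k‖ := by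
  have h1 := dist_le_Ico_sum_dist y hj
  rw [dist_eq_norm] at h1
  refine h1.trans ?_
  rw [Finset.range_eq_Ico]
  calc ∑ k ∈ Finset.Ico j n, dist (y k) (y (k + 1))
      ≤ ∑ k ∈ Finset.Ico 0 n, dist (y k) (y (k + 1)) :=
        Finset.sum_le_sum_of_subset_of_nonneg (Finset.Ico_subset_Ico_left (Nat.zero_le _))
          fun _ _ _ => dist_nonneg
    _ = _ := Finset.sum_congr rfl fun k _ => by rw [dist_comm, dist_eq_norm]

/-- The action grows quadratically in the steps, while `w` changes at most linearly because its
gradient is bounded; so the functional is coercive in the free points. -/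
theorem IsCoerciveTwist.exists_minimizer (h : IsCoerciveTwist S F)
    (hw : IsPeriodicPotential F m n γ w) (Q : Vec ℝ d) :
    ∃ x : ℕ → Vec ℝ d, x n = Q ∧ ∀ y : ℕ → Vec ℝ d, y n = Q →
      w (x 0) + action S n x ≤ w (y 0) + action S n y := by
  obtain ⟨c, C, hc, hS⟩ := h.coercive
  obtain ⟨B, hB0, hB⟩ := exists_bound_of_periodic hw.continuous_γ hw.periodic
  -- Only the first `n` points vary; every later index takes the fixed endpoint `Q`.
  set e : (Fin n → Vec ℝ d) → ℕ → Vec ℝ d := fun x k => if hk : k < n then x ⟨k, hk⟩ else Q with he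
  have hec : ∀ k, Continuous fun x => e x k := by
    intro k
    by_cases hk : k < n
    · simp only [he, hk, dif_pos]; fun_prop
    · simp only [he, hk, dif_neg, not_false_eq_true]; fun_prop
  set Φ : (Fin n → Vec ℝ d) → ℝ := fun x => w (e x 0) + action S n (e x) with hΦ
  have hΦc : Continuous Φ := by
    refine (hw.continuous_w.comp (hec 0)).add ?_
    exact continuous_finsetSum _ fun k _ =>
      h.contDiff_S.continuous.comp ((hec k).prodMk (hec (k + 1)))
  -- Completing the square gives `c s² - C ≥ (B + 1) s - C'`: slope `B` absorbs the variation of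
  -- `w`, and the remaining slope 1 controls the distance to `Q`.
  set C' := C + (B + 1) ^ 2 / (4 * c) with hC'
  have hlow : ∀ y : ℕ → Vec ℝ d, y n = Q → ∀ j ≤ n,
      w Q - n * C' + ‖y j - Q‖ ≤ w (y 0) + action S n y := by
    intro y hy j hj
    have h1 : action S n y ≥ ∑ k ∈ Finset.range n, ((B + 1) * ‖y (k + 1) - y k‖ - C') := by
      refine Finset.sum_le_sum fun k _ => le_trans ?_ (hS _ _)
      have : 0 ≤ c * (‖y (k + 1) - y k‖ - (B + 1) / (2 * c)) ^ 2 := by positivity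
      have h2 : c * (‖y (k + 1) - y k‖ - (B + 1) / (2 * c)) ^ 2 =
        c * ‖y (k + 1) - y k‖ ^ 2 - (B + 1) * ‖y (k + 1) - y k‖ + (B + 1) ^ 2 / (4 * c) := by
        field_simp; ring
      rw [hC']; linarith
    rw [Finset.sum_sub_distrib, ← Finset.mul_sum, Finset.sum_const, Finset.card_range,
      nsmul_eq_mul] at h1
    have h2 := norm_sub_le_sum y hj
    have h3 := norm_sub_le_sum y (Nat.zero_le n)
    rw [hy] at h2 h3
    have h4 := abs_le.1 (abs_sub_le_of_gradient_le hw.hasFDerivAt hB Q (y 0))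
    nlinarith [h4.1]
  have hcoer : Filter.Tendsto Φ (Filter.cocompact _) Filter.atTop := by
    have h1 : Filter.Tendsto (fun x : Fin n → Vec ℝ d => (w Q - n * C' - ‖Q‖) + ‖x‖)
        (Filter.cocompact _) Filter.atTop :=
      Filter.tendsto_atTop_add_const_left _ _ tendsto_norm_cocompact_atTop
    refine Filter.tendsto_atTop_mono (fun x => ?_) h1
    have hen : e x n = Q := by simp [he]
    have h2 : ‖x‖ ≤ ‖Q‖ + (Φ x - (w Q - n * C')) := by
      refine (pi_norm_le_iff_of_nonneg ?_).2 fun j => ?_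
      · have := hlow (e x) hen n le_rfl
        simp only [hen, sub_self, norm_zero, add_zero] at this
        have := norm_nonneg Q
        simp only [hΦ]; linarith
      · have := hlow (e x) hen j j.2.le
        have h5 : e x j = x j := by simp [he]
        rw [h5] at this
        have h6 : ‖x j‖ ≤ ‖x j - Q‖ + ‖Q‖ := by
          simpa using norm_add_le (x j - Q) Q
        simp only [hΦ]; linarith
    linarith
  obtain ⟨x, hx⟩ := hΦc.exists_forall_le hcoer
  refine ⟨e x, by simp [he], fun y hy => ?_⟩
  have h1 := hx fun j => y j
  have h2 : ∀ k ≤ n, e (fun j => y j) k = y k := by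
    intro k hk
    rcases hk.lt_or_eq with hk | rfl
    · simp [he, hk]
    · simp [he, hy]
  have h3 : action S n (e fun j => y j) = action S n y := by
    refine Finset.sum_congr rfl fun k hk => ?_
    have := Finset.mem_range.1 hk
    rw [h2 k this.le, h2 (k + 1) this]
  simpa only [hΦ, h2 0 (Nat.zero_le _), h3] using h1

theorem IsCoerciveTwist.hasDerivAt_action (h : IsCoerciveTwist S F) (x ζ : ℕ → Vec ℝ d) (t : ℝ) :
    HasDerivAt (fun t : ℝ => action S n fun k => x k + t • ζ k)
      (∑ k ∈ Finset.range n, fderiv ℝ S (x k + t • ζ k, x (k + 1) + t • ζ (k + 1))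
        (ζ k, ζ (k + 1))) t := by
  refine HasDerivAt.fun_sum fun k _ => ?_
  have hl : ∀ k, HasDerivAt (fun t : ℝ => x k + t • ζ k) (ζ k) t := fun k => by
    simpa using ((hasDerivAt_id t).smul_const (ζ k)).const_add (x k)
  exact (h.hasFDerivAt_S _).comp_hasDerivAt t ((hl k).prodMk (hl (k + 1)))

/-- Stationarity in the first point makes the initial momentum `γ (x 0)`; stationarity in each inner
point matches outgoing and incoming momenta. The variations used are supported at a single index. -/
theorem IsCoerciveTwist.orbit_of_minimizer (h : IsCoerciveTwist S F) (hn : 0 < n)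
    (hw : ∀ q, HasFDerivAt w (innerSL ℝ (γ q)) q) {x : ℕ → Vec ℝ d}
    (hx : ∀ y : ℕ → Vec ℝ d, y n = x n → w (x 0) + action S n x ≤ w (y 0) + action S n y) :
    ∀ k ≤ n, (F^[k] (x 0, γ (x 0))).1 = x k := by
  choose p hp using fun k => h.surj (x k) (x (k + 1))
  have hcrit : ∀ ζ : ℕ → Vec ℝ d, ζ n = 0 → inner ℝ (γ (x 0)) (ζ 0) +
      ∑ k ∈ Finset.range n, (inner ℝ (F (x k, p k)).2 (ζ (k + 1)) - inner ℝ (p k) (ζ k)) = 0 := by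
    intro ζ hζ
    have h1 := h.hasDerivAt_action (n := n) x ζ 0
    have h2 : HasDerivAt (fun t : ℝ => w (x 0 + t • ζ 0)) (inner ℝ (γ (x 0)) (ζ 0)) 0 := by
      have hl : HasDerivAt (fun t : ℝ => x 0 + t • ζ 0) (ζ 0) 0 := by
        simpa using ((hasDerivAt_id (0 : ℝ)).smul_const (ζ 0)).const_add (x 0)
      have := (hw (x 0 + (0 : ℝ) • ζ 0)).comp_hasDerivAt (0 : ℝ) hl
      rw [zero_smul, add_zero] at this
      exact this
    have hmin : IsLocalMin (fun t : ℝ => w (x 0 + t • ζ 0) + action S n fun k => x k + t • ζ k) 0 :=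
      Filter.Eventually.of_forall fun t => by
        simpa using hx (fun k => x k + t • ζ k) (by simp [hζ])
    have h3 := hmin.hasDerivAt_eq_zero (h2.add h1)
    simp only [zero_smul, add_zero] at h3
    rw [← h3]
    congr 1
    refine Finset.sum_congr rfl fun k _ => ?_
    have := h.generates (x k) (p k) (ζ k) (ζ (k + 1))
    rw [hp k] at this
    exact this.symm
  have h0 : γ (x 0) = p 0 := by
    refine ext_inner_right ℝ fun v => ?_
    have := hcrit (Pi.single 0 v) (by simp [hn.ne'])
    rw [Finset.sum_eq_single_of_mem 0 (Finset.mem_range.2 hn) (fun k _ hk => by simp [hk])] at this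
    simp at this
    linarith
  have hs : ∀ j, j + 1 < n → (F (x j, p j)).2 = p (j + 1) := by
    intro j hj
    refine ext_inner_right ℝ fun v => ?_
    have := hcrit (Pi.single (j + 1) v) (by simp [hj.ne'])
    rw [Finset.sum_sub_distrib,
      Finset.sum_eq_single_of_mem j (Finset.mem_range.2 (by omega)) (fun k _ hk => by simp [hk]),
      Finset.sum_eq_single_of_mem (j + 1) (Finset.mem_range.2 hj) (fun k _ hk => by
        simp [hk])] at this
    simp at this
    linarith
  have hind : ∀ k < n, F^[k] (x 0, γ (x 0)) = (x k, p k) := by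
    intro k
    induction k with
    | zero => intro _; simp [h0]
    | succ k ih =>
      intro hk
      rw [Function.iterate_succ_apply', ih (by omega)]
      exact Prod.ext (hp k) (hs k hk)
  intro k hk
  rcases k with _ | k
  · simp
  · rw [Function.iterate_succ_apply', hind k hk]
    exact hp k

/-- A periodic potential is a calibrated subsolution. -/
theorem IsCoerciveTwist.exists_calibration (h : IsCoerciveTwist S F) (hn : 0 < n)
    (hw : IsPeriodicPotential F m n γ w) : ∃ a,
      (∀ q, action S n (fun k => (F^[k] (q, γ q)).1) = a) ∧
      ∀ y : ℕ → Vec ℝ d, w (y n - intVec ℝ m) + a ≤ w (y 0) + action S n y := by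
  obtain ⟨a, ha⟩ := h.action_graph_const hw
  refine ⟨a, ha, fun y => ?_⟩
  obtain ⟨x, hxn, hx⟩ := h.exists_minimizer hw (y n)
  -- The minimizer starts on the graph, so periodicity forces its first point to be `y n - m` and
  -- its action to be `a`.
  have horb := h.orbit_of_minimizer hn hw.hasFDerivAt (x := x) fun y' hy' => hx y' (hy'.trans hxn)
  have h1 := horb n le_rfl
  rw [hw.iterate, hxn] at h1
  have h2 : action S n x = a := by
    rw [← ha (x 0)]
    refine Finset.sum_congr rfl fun k hk => ?_
    have := Finset.mem_range.1 hk
    beta_reduce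
    rw [horb k this.le, horb (k + 1) this]
  rw [← h2, ← h1, add_sub_cancel_right]
  exact hx y rfl

/-- The periodic graph is unique. -/
theorem IsCoerciveTwist.graph_unique (h : IsCoerciveTwist S F) (hn : 0 < n)
    {γ₁ γ₂ : Vec ℝ d → Vec ℝ d} {w₁ w₂ : Vec ℝ d → ℝ} (h₁ : IsPeriodicPotential F m n γ₁ w₁)
    (h₂ : IsPeriodicPotential F m n γ₂ w₂) : γ₁ = γ₂ := by
  obtain ⟨a₁, ha₁, hi₁⟩ := h.exists_calibration hn h₁
  obtain ⟨a₂, ha₂, hi₂⟩ := h.exists_calibration hn h₂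
  have key : ∀ (q : Vec ℝ d), a₂ ≤ a₁ ∧ a₁ ≤ a₂ := by
    intro q
    have e1 := hi₁ fun k => (F^[k] (q, γ₂ q)).1
    have e2 := hi₂ fun k => (F^[k] (q, γ₁ q)).1
    rw [ha₂, h₂.iterate] at e1
    rw [ha₁, h₁.iterate] at e2
    simp at e1 e2
    exact ⟨e2, e1⟩
  have ha : a₁ = a₂ := le_antisymm (key 0).2 (key 0).1
  funext q
  -- With equal constants, an orbit on the first graph also minimizes the problem for `w₂`, so it
  -- agrees with the orbit on the second graph. Equality of the first step determines the momentum.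
  have horb := h.orbit_of_minimizer hn h₂.hasFDerivAt (x := fun k => (F^[k] (q, γ₁ q)).1)
    (fun y hy => by
      have := hi₂ y
      rw [hy, h₁.iterate] at this
      simp only [add_sub_cancel_right] at this
      rw [ha₁, ha]
      simpa using this) 1 hn
  simp only [Function.iterate_one, Function.iterate_zero, id_eq] at horb
  refine ext_inner_right ℝ fun v => ?_
  have g1 := h.generates q (γ₁ q) v 0
  have g2 := h.generates q (γ₂ q) v 0
  rw [horb, g1] at g2
  simp at g2
  linarith

end Chains

end TwistMap

namespace TwistMap

open scoped ContDiff Topology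

variable {d : ℕ} {S : Phase ℝ d → ℝ} {F : Phase ℝ d → Phase ℝ d} {m : Fin d → ℤ} {n : ℕ}
  {γ : Vec ℝ d → Vec ℝ d} {w : Vec ℝ d → ℝ}

/-! ### Varying one end of an orbit: a priori bounds. -/

section OneStep

/-- Displacing only the last point of the orbit in the calibration inequality bounds `w` from above
near `q`. -/
theorem IsCoerciveTwist.potential_le_last (h : IsCoerciveTwist S F)
    (hw : IsPeriodicPotential F m (n + 1) γ w) (q δ : Vec ℝ d) :
    w (q + δ) ≤ w q + S ((F^[n] (q, γ q)).1, q + intVec ℝ m + δ) -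
      S ((F^[n] (q, γ q)).1, q + intVec ℝ m) := by
  obtain ⟨a, ha, hi⟩ := h.exists_calibration n.succ_pos hw
  have h1 := hi (Function.update (fun k => (F^[k] (q, γ q)).1) (n + 1) (q + intVec ℝ m + δ))
  have h2 := ha q
  rw [action, Finset.sum_range_succ] at h1 h2
  rw [Finset.sum_congr rfl (g := fun k => S ((F^[k] (q, γ q)).1, (F^[k + 1] (q, γ q)).1))
    (fun k hk => by
      have := Finset.mem_range.1 hk
      rw [Function.update_of_ne (by omega), Function.update_of_ne (by omega)])] at h1
  rw [Function.update_self, Function.update_of_ne (by omega), Function.update_of_ne (by omega)] at h1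
  rw [hw.iterate] at h2
  have h3 : q + intVec ℝ m + δ - intVec ℝ m = q + δ := by abel
  rw [h3] at h1
  simp only [Function.iterate_zero, id_eq] at h1
  linarith

/-- Displacing only the first point gives the opposite, lower bound for `w` near `q`. -/
theorem IsCoerciveTwist.potential_le_first (h : IsCoerciveTwist S F) (hn : 0 < n)
    (hw : IsPeriodicPotential F m n γ w) (q δ : Vec ℝ d) :
    w q ≤ w (q + δ) + S (q + δ, (F (q, γ q)).1) - S (q, (F (q, γ q)).1) := by
  obtain ⟨a, ha, hi⟩ := h.exists_calibration hn hw
  obtain ⟨n, rfl⟩ := Nat.exists_eq_succ_of_ne_zero hn.ne'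
  have h1 := hi (Function.update (fun k => (F^[k] (q, γ q)).1) 0 (q + δ))
  have h2 := ha q
  rw [action, Finset.sum_range_succ'] at h1 h2
  simp only [Function.update_self, ne_eq, Nat.add_eq_zero_iff, one_ne_zero, and_false,
    not_false_eq_true, Function.update_of_ne, zero_add, Nat.succ_eq_add_one, hw.iterate,
    Function.iterate_one, Function.iterate_zero, id_eq, add_sub_cancel_right] at h1 h2
  linarith

theorem IsCoerciveTwist.fderiv_first (h : IsCoerciveTwist S F) (q δ : Vec ℝ d) :
    fderiv ℝ S (q, (F (q, γ q)).1) (δ, 0) = -inner ℝ (γ q) δ := by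
  simpa using h.generates q (γ q) δ 0

theorem IsCoerciveTwist.fderiv_last (h : IsCoerciveTwist S F)
    (hw : IsPeriodicPotential F m (n + 1) γ w) (q δ : Vec ℝ d) :
    fderiv ℝ S ((F^[n] (q, γ q)).1, q + intVec ℝ m) (0, δ) = inner ℝ (γ q) δ := by
  have := h.generates (F^[n] (q, γ q)).1 (F^[n] (q, γ q)).2 0 δ
  rw [Prod.mk.eta, ← Function.iterate_succ_apply' F, hw.iterate] at this
  simpa using this

/-- The straight chain with steps `m / n` bounds the calibrated action by `n * M`; coercivity turns
this into a bound on each step. -/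
theorem IsCoerciveTwist.norm_step_le (h : IsCoerciveTwist S F) (hn : 0 < n)
    (hw : IsPeriodicPotential F m n γ w) {c C M : ℝ}
    (hc : 0 < c) (hS : ∀ q Q, c * ‖Q - q‖ ^ 2 - C ≤ S (q, Q))
    (hM : ∀ q, S (q, q + (n : ℝ)⁻¹ • intVec ℝ m) ≤ M) (q : Vec ℝ d) {k : ℕ} (hk : k < n) :
    c * ‖(F^[k + 1] (q, γ q)).1 - (F^[k] (q, γ q)).1‖ ^ 2 ≤ n * (M + C) := by
  obtain ⟨a, ha, hi⟩ := h.exists_calibration hn hw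
  have hn' : (n : ℝ) ≠ 0 := by exact_mod_cast hn.ne'
  have h1 := hi fun k => q + (k : ℝ) • (n : ℝ)⁻¹ • intVec ℝ m
  have h2 : action S n (fun k => q + (k : ℝ) • (n : ℝ)⁻¹ • intVec ℝ m) ≤ n * M := by
    calc _ ≤ ∑ _k ∈ Finset.range n, M := by
          refine Finset.sum_le_sum fun k _ => ?_
          have := hM (q + (k : ℝ) • (n : ℝ)⁻¹ • intVec ℝ m)
          have e : q + ((k + 1 : ℕ) : ℝ) • (n : ℝ)⁻¹ • intVec ℝ m =
              q + (k : ℝ) • (n : ℝ)⁻¹ • intVec ℝ m + (n : ℝ)⁻¹ • intVec ℝ m := by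
            push_cast
            module
          beta_reduce
          rw [e]
          exact this
      _ = n * M := by simp
  rw [smul_inv_smul₀ hn', add_sub_cancel_right] at h1
  simp only [Nat.cast_zero, zero_smul, add_zero] at h1
  have h3 : ∑ k ∈ Finset.range n, (c * ‖(F^[k + 1] (q, γ q)).1 - (F^[k] (q, γ q)).1‖ ^ 2 - C) ≤ a := by
    rw [← ha q]
    exact Finset.sum_le_sum fun k _ => hS _ _
  rw [Finset.sum_sub_distrib, Finset.sum_const, Finset.card_range, nsmul_eq_mul] at h3
  have h4 := Finset.single_le_sum (f := fun k =>
    c * ‖(F^[k + 1] (q, γ q)).1 - (F^[k] (q, γ q)).1‖ ^ 2) (fun k _ => by positivity)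
    (Finset.mem_range.2 hk)
  linarith

/-- The upper bound from the last point and the lower bound from the first point have the same
linear part `γ x`, so their Taylor remainders pinch `w`. The constants depend on `γ` and `w` only
through bounds on `S`. -/
theorem IsCoerciveTwist.hasQuadraticApprox (h : IsCoerciveTwist S F) (hn : 0 < n)
    (hw : IsPeriodicPotential F m n γ w) {c C M D L B : ℝ}
    (hc : 0 < c) (hS : ∀ q Q, c * ‖Q - q‖ ^ 2 - C ≤ S (q, Q))
    (hM : ∀ q, S (q, q + (n : ℝ)⁻¹ • intVec ℝ m) ≤ M) (hD : 0 ≤ D) (hDc : n * (M + C) ≤ c * D ^ 2)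
    (hL : 0 ≤ L)
    (hT : ∀ q Q, ‖Q - q‖ ≤ D → ∀ u v, ‖u‖ ≤ 1 → ‖v‖ ≤ 1 → (u = 0 ∨ v = 0) →
      S (q + u, Q + v) - S (q, Q) - fderiv ℝ S (q, Q) (u, v) ≤ L * ‖(u, v)‖ ^ 2)
    (hB0 : 0 ≤ B) (hB : ∀ q Q, ‖Q - q‖ ≤ D → ‖fderiv ℝ S (q, Q)‖ ≤ B) :
    (∀ q, ‖γ q‖ ≤ B) ∧ HasQuadraticApprox w γ (L + 2 * B) := by
  have hstep : ∀ q, ∀ k < n, ‖(F^[k + 1] (q, γ q)).1 - (F^[k] (q, γ q)).1‖ ≤ D := by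
    intro q k hk
    have h1 := (h.norm_step_le hn hw hc hS hM q hk).trans hDc
    exact abs_le_of_sq_le_sq' (le_of_mul_le_mul_left h1 hc) hD |>.2
  have hfirst : ∀ q, ‖(F (q, γ q)).1 - q‖ ≤ D := fun q => hstep q 0 hn
  have hγ : ∀ q, ‖γ q‖ ≤ B := by
    intro q
    have h1 := (fderiv ℝ S (q, (F (q, γ q)).1)).le_opNorm (γ q, 0)
    rw [h.fderiv_first, norm_neg, real_inner_self_eq_norm_sq, Prod.norm_mk, norm_zero,
      max_eq_left (norm_nonneg _), Real.norm_of_nonneg (by positivity)] at h1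
    have h2 := hB _ _ (hfirst q)
    by_contra hcon
    push Not at hcon
    have : 0 < ‖γ q‖ := hB0.trans_lt hcon
    nlinarith
  refine ⟨hγ, fun x y => ?_⟩
  obtain ⟨δ, rfl⟩ : ∃ δ, y = x + δ := ⟨y - x, by abel⟩
  rw [add_sub_cancel_left]
  rcases le_or_gt ‖δ‖ 1 with hδ | hδ
  · have hup : w (x + δ) - w x - inner ℝ (γ x) δ ≤ L * ‖δ‖ ^ 2 := by
      obtain ⟨n, rfl⟩ := Nat.exists_eq_succ_of_ne_zero hn.ne'
      have h1 := h.potential_le_last hw x δ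
      have hs := hstep x n n.lt_succ_self
      rw [hw.iterate] at hs
      have h2 := hT _ _ hs 0 δ (by simp) hδ (Or.inl rfl)
      rw [h.fderiv_last hw, add_zero, Prod.norm_mk, norm_zero, max_eq_right (norm_nonneg _)] at h2
      linarith
    have hlo : -(L * ‖δ‖ ^ 2) ≤ w (x + δ) - w x - inner ℝ (γ x) δ := by
      have h1 := h.potential_le_first hn hw x δ
      have h2 := hT _ _ (hfirst x) δ 0 hδ (by simp) (Or.inr rfl)
      rw [h.fderiv_first, add_zero, Prod.norm_mk, norm_zero, max_eq_left (norm_nonneg _)] at h2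
      linarith
    rw [abs_le]
    have : 0 ≤ 2 * B * ‖δ‖ ^ 2 := by positivity
    constructor <;> nlinarith
  -- For displacements longer than 1 the crude bound `2B‖δ‖` is already quadratic; this is the
  -- source of `2 * B`.
  · have h1 := abs_sub_le_of_gradient_le hw.hasFDerivAt hγ x (x + δ)
    rw [add_sub_cancel_left] at h1
    have h2 : |inner ℝ (γ x) δ| ≤ B * ‖δ‖ :=
      (abs_real_inner_le_norm _ _).trans (mul_le_mul_of_nonneg_right (hγ x) (norm_nonneg _))
    have h3 : B * ‖δ‖ ≤ B * ‖δ‖ ^ 2 := by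
      refine mul_le_mul_of_nonneg_left ?_ hB0
      nlinarith
    have h4 : 0 ≤ L * ‖δ‖ ^ 2 := by positivity
    calc _ ≤ |w (x + δ) - w x| + |inner ℝ (γ x) δ| := abs_sub _ _
      _ ≤ _ := by linarith

end OneStep

/-! ### The second variation and absence of conjugate points. -/

section Nondegenerate

/-- A negative second derivative would make the minimum a local maximum too, hence the function
locally constant. -/
theorem second_derivative_nonneg_of_min {φ φ' : ℝ → ℝ} {c : ℝ} (hφ : ∀ t, HasDerivAt φ (φ' t) t)
    (hφ' : HasDerivAt φ' c 0) (hmin : ∀ t, φ 0 ≤ φ t) : 0 ≤ c := by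
  by_contra hc
  push Not at hc
  have hd : deriv φ = φ' := funext fun t => (hφ t).deriv
  have hl : IsLocalMin φ 0 := Filter.Eventually.of_forall hmin
  have h0 : φ' 0 = 0 := hl.hasDerivAt_eq_zero (hφ 0)
  have hmax : IsLocalMax φ 0 := isLocalMax_of_deriv_deriv_neg (by rw [hd, hφ'.deriv]; exact hc)
    (by rw [hd, h0]) (hφ 0).continuousAt
  have heq : φ =ᶠ[𝓝 0] fun _ => φ 0 := hmax.mono fun t ht => le_antisymm ht (hmin t)
  have h1 : φ' =ᶠ[𝓝 0] fun _ => 0 := by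
    rw [← hd]
    simpa using heq.deriv
  have := (hφ'.congr_of_eventuallyEq h1.symm).unique (hasDerivAt_const (0 : ℝ) (0 : ℝ))
  exact hc.ne this

theorem eq_zero_of_quadratic_nonneg {A D : ℝ} (h : ∀ s : ℝ, 0 ≤ 2 * s * A + s ^ 2 * D) : A = 0 := by
  have h1 := h (-A / (|D| + 1))
  have hD : 0 < |D| + 1 := by positivity
  have h2 : 2 * (-A / (|D| + 1)) * A + (-A / (|D| + 1)) ^ 2 * D =
      (A ^ 2 * (D - 2 * (|D| + 1))) / (|D| + 1) ^ 2 := by field_simp; ring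
  rw [h2] at h1
  have h3 : 0 ≤ A ^ 2 * (D - 2 * (|D| + 1)) := by
    by_contra hc
    push Not at hc
    exact absurd h1 (not_le.2 (div_neg_of_neg_of_pos hc (by positivity)))
  have h4 := le_abs_self D
  nlinarith [sq_nonneg A, abs_nonneg D]

theorem IsCoerciveTwist.hasFDerivAt_fderiv (h : IsCoerciveTwist S F) (x : Phase ℝ d) :
    HasFDerivAt (fderiv ℝ S) (fderiv ℝ (fderiv ℝ S) x) x :=
  ((h.contDiff_S.fderiv_right (m := 1) (by norm_num)).differentiable one_ne_zero x).hasFDerivAt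

/-- The generating relation differentiated along ξ: the discrete Jacobi equation in Hamiltonian
form. -/
theorem IsCoerciveTwist.hess_generates (h : IsCoerciveTwist S F) (x ξ : Phase ℝ d) (u v : Vec ℝ d) :
    hess S (x.1, (F x).1) (ξ.1, (fderiv ℝ F x ξ).1) (u, v) =
      inner ℝ (fderiv ℝ F x ξ).2 v - inner ℝ ξ.2 u := by
  have hF : HasFDerivAt F (fderiv ℝ F x) x := (h.contDiff_F.differentiable one_ne_zero x).hasFDerivAt
  have h1 : HasFDerivAt (fun x : Phase ℝ d => ((x.1, (F x).1) : Phase ℝ d))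
      ((ContinuousLinearMap.fst ℝ _ _).prod ((ContinuousLinearMap.fst ℝ _ _).comp (fderiv ℝ F x))) x :=
    hasFDerivAt_fst.prodMk hF.fst
  have h2 := ((h.hasFDerivAt_fderiv (x.1, (F x).1)).comp x h1).clm_apply
    (hasFDerivAt_const ((u, v) : Phase ℝ d) x)
  have h3 : HasFDerivAt (fun x : Phase ℝ d => inner ℝ (F x).2 v - inner ℝ x.2 u) _ x :=
    (hF.snd.inner ℝ (hasFDerivAt_const v x)).sub
      (hasFDerivAt_snd.inner ℝ (hasFDerivAt_const u x))
  have h4 : (fun x : Phase ℝ d => inner ℝ (F x).2 v - inner ℝ x.2 u) =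
      fun x => (fderiv ℝ S ∘ fun x : Phase ℝ d => ((x.1, (F x).1) : Phase ℝ d)) x (u, v) := by
    funext x
    exact (h.generates x.1 x.2 u v).symm
  rw [h4] at h3
  have h5 := congrArg (fun L => L ξ) (h2.unique h3)
  simpa [hess] using h5

/-- Along a periodic graph there are no conjugate points. -/
theorem IsCoerciveTwist.nondegenerate (h : IsCoerciveTwist S F) (hn : 0 < n)
    (hw : IsPeriodicPotential F m n γ w) (q η : Vec ℝ d)
    (hη : (fderiv ℝ (F^[n]) (q, γ q) (0, η)).1 = 0) : η = 0 := by
  obtain ⟨K, hK⟩ := hw.lipschitz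
  have hqa := hasQuadraticApprox_of_lipschitzWith hK hw.hasFDerivAt
  obtain ⟨a, ha, hi⟩ := h.exists_calibration hn hw
  set x : Phase ℝ d := (q, γ q) with hx
  set z : ℕ → Phase ℝ d := fun k => ((F^[k] x).1, (F^[k + 1] x).1) with hz
  set ξ : ℕ → Phase ℝ d := fun k => fderiv ℝ (F^[k]) x (0, η) with hξ
  have hξ0 : ξ 0 = (0, η) := by simp [hξ, Function.iterate_zero]
  have hξs : ∀ k, ξ (k + 1) = fderiv ℝ F (F^[k] x) (ξ k) := by
    intro k
    simp only [hξ]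
    rw [Function.iterate_succ', fderiv_comp x (h.contDiff_F.differentiable one_ne_zero _)
      ((h.contDiff_iterate k).differentiable one_ne_zero _)]
    rfl
  set Q : (ℕ → Vec ℝ d) → (ℕ → Vec ℝ d) → ℝ := fun α β =>
    ∑ k ∈ Finset.range n, hess S (z k) (α k, α (k + 1)) (β k, β (k + 1)) with hQ
  have htel : ∀ β, Q (fun k => (ξ k).1) β = inner ℝ (ξ n).2 (β n) - inner ℝ η (β 0) := by
    intro β
    have h1 := Finset.sum_range_sub (fun k => inner ℝ (ξ k).2 (β k)) n
    rw [hξ0] at h1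
    rw [← h1]
    refine Finset.sum_congr rfl fun k _ => ?_
    have h2 := h.hess_generates (F^[k] x) (ξ k) (β k) (β (k + 1))
    rw [← hξs, ← Function.iterate_succ_apply' F] at h2
    exact h2
  -- The end point is left free: the lower quadratic bound on `w` replaces it in the calibration
  -- inequality by a linear term and the penalty `K‖ζ n‖² t²`.
  have hpos : ∀ ζ : ℕ → Vec ℝ d, ζ 0 = 0 → 0 ≤ Q ζ ζ + 2 * K * ‖ζ n‖ ^ 2 := by
    intro ζ hζ
    refine second_derivative_nonneg_of_min
      (φ := fun t => action S n (fun k => (F^[k] x).1 + t • ζ k) - t * inner ℝ (γ q) (ζ n) +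
        K * ‖ζ n‖ ^ 2 * t ^ 2)
      (φ' := fun t => ∑ k ∈ Finset.range n, fderiv ℝ S ((F^[k] x).1 + t • ζ k,
        (F^[k + 1] x).1 + t • ζ (k + 1)) (ζ k, ζ (k + 1)) - inner ℝ (γ q) (ζ n) +
        K * ‖ζ n‖ ^ 2 * (2 * t)) ?_ ?_ ?_
    · intro t
      refine ((h.hasDerivAt_action _ ζ t).sub ?_).add ?_
      · simpa using (hasDerivAt_id t).mul_const (inner ℝ (γ q) (ζ n))
      · simpa using (hasDerivAt_pow 2 t).const_mul (K * ‖ζ n‖ ^ 2)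
    · have hs : HasDerivAt (fun t : ℝ => ∑ k ∈ Finset.range n, fderiv ℝ S ((F^[k] x).1 + t • ζ k,
          (F^[k + 1] x).1 + t • ζ (k + 1)) (ζ k, ζ (k + 1))) (Q ζ ζ) 0 := by
        refine HasDerivAt.fun_sum fun k _ => ?_
        have hl : ∀ k, HasDerivAt (fun t : ℝ => (F^[k] x).1 + t • ζ k) (ζ k) 0 := fun k => by
          simpa using ((hasDerivAt_id (0 : ℝ)).smul_const (ζ k)).const_add (F^[k] x).1
        have h1 := (h.hasFDerivAt_fderiv ((F^[k] x).1 + (0 : ℝ) • ζ k,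
          (F^[k + 1] x).1 + (0 : ℝ) • ζ (k + 1))).comp_hasDerivAt (0 : ℝ) ((hl k).prodMk (hl (k + 1)))
        have h2 := h1.clm_apply (hasDerivAt_const (0 : ℝ) ((ζ k, ζ (k + 1)) : Phase ℝ d))
        simpa [hess, hz] using h2
      refine (hs.sub_const _).add ?_
      have e : 2 * K * ‖ζ n‖ ^ 2 = K * ‖ζ n‖ ^ 2 * (2 * 1) := by ring
      rw [e]
      exact ((hasDerivAt_id' (0 : ℝ)).const_mul 2).const_mul (K * ‖ζ n‖ ^ 2 : ℝ)
    · intro t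
      have h1 := hi fun k => (F^[k] x).1 + t • ζ k
      have h2 := (abs_le.1 (hqa q (q + t • ζ n))).1
      have h3 := ha q
      rw [hw.iterate] at h1
      rw [add_sub_cancel_left, inner_smul_right, norm_smul, mul_pow, Real.norm_eq_abs, sq_abs] at h2
      have h4 : q + intVec ℝ m + t • ζ n - intVec ℝ m = q + t • ζ n := by abel
      simp only [h4, hζ, smul_zero, add_zero, Function.iterate_zero, id_eq] at h1
      simp only [zero_smul, add_zero, zero_mul, sub_zero]
      have h5 : (action S n fun k => (F^[k] x).1) = a := h3
      have h6 : x.1 = q := rfl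
      rw [h6] at h1
      nlinarith
  have hsymm : ∀ α β, Q α β = Q β α := by
    intro α β
    refine Finset.sum_congr rfl fun k _ => ?_
    exact (h.contDiff_S.contDiffAt.isSymmSndFDerivAt (by simp)).eq _ _
  -- The Jacobi field has zero index form because it is horizontal-free at both ends. Adding `s`
  -- times a variation of the last point alone contributes `2s‖(ξ n).2‖²` at first order, so
  -- nonnegativity for all `s` forces the final momentum to vanish.
  have hlast : (ξ n).2 = 0 := by
    set κ : ℕ → Vec ℝ d := Pi.single n (ξ n).2 with hκ
    have hκ0 : κ 0 = 0 := by simp [hκ, hn.ne]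
    have hκn : κ n = (ξ n).2 := by simp [hκ]
    have hξn : (ξ n).1 = 0 := hη
    have := eq_zero_of_quadratic_nonneg (A := inner ℝ (ξ n).2 (ξ n).2)
      (D := Q κ κ + 2 * K * ‖(ξ n).2‖ ^ 2) fun s => by
        have h1 := hpos (fun k => (ξ k).1 + s • κ k) (by simp [hξ0, hκ0])
        have h2 : Q (fun k => (ξ k).1 + s • κ k) (fun k => (ξ k).1 + s • κ k) =
            Q (fun k => (ξ k).1) (fun k => (ξ k).1) + s * Q (fun k => (ξ k).1) κ +
              s * Q κ (fun k => (ξ k).1) + s ^ 2 * Q κ κ := by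
          simp only [hQ, Finset.mul_sum, ← Finset.sum_add_distrib]
          refine Finset.sum_congr rfl fun k _ => ?_
          have e : (((ξ k).1 + s • κ k, (ξ (k + 1)).1 + s • κ (k + 1)) : Phase ℝ d) =
            ((ξ k).1, (ξ (k + 1)).1) + s • (κ k, κ (k + 1)) := rfl
          rw [e]
          simp only [hess, map_add, map_smul, add_apply, smul_apply, smul_eq_mul]
          ring
        rw [h2, hsymm κ, htel, htel, hκn, hκ0, hξ0, hξn] at h1
        simp only [inner_zero_right, sub_zero, zero_add, norm_smul, mul_pow, Real.norm_eq_abs,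
          sq_abs] at h1
        linarith
    exact inner_self_eq_zero.1 this
  have hzero : ∀ k, ξ k = 0 → (0, η) = (0 : Phase ℝ d) := by
    intro k
    induction k with
    | zero => intro hk; rw [← hξ0, hk]
    | succ k ih => intro hk; exact ih (h.fderiv_inj _ _ (by rw [← hξs, hk]))
  exact congrArg Prod.snd (hzero n (Prod.ext hη hlast))

end Nondegenerate

end TwistMap

namespace TwistMap

open scoped ContDiff Topology

variable {d : ℕ} {m : Fin d → ℤ} {n : ℕ} {γ : Vec ℝ d → Vec ℝ d} {w : Vec ℝ d → ℝ}

/-! ### Uniform bounds from diagonal periodicity, and coercivity. -/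

section PeriodicBounds

variable {T : Phase ℝ d → ℝ}

theorem exists_bound_of_diag_periodic {E : Type*} [NormedAddCommGroup E] {T : Phase ℝ d → E}
    (hc : Continuous T)
    (hper : ∀ (k : Fin d → ℤ) x, T (x + (intVec ℝ k, intVec ℝ k)) = T x) (D : ℝ) :
    ∃ B, 0 ≤ B ∧ ∀ q Q, ‖Q - q‖ ≤ D → ‖T (q, Q)‖ ≤ B := by
  have hK : IsCompact ((fun x : Phase ℝ d => ((x.1, x.1 + x.2) : Phase ℝ d)) ''
      (cube d ×ˢ Metric.closedBall 0 D)) :=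
    (isCompact_cube.prod (isCompact_closedBall _ _)).image (by fun_prop)
  obtain ⟨B, hB⟩ := hK.exists_bound_of_continuousOn hc.continuousOn
  refine ⟨max B 0, le_max_right _ _, fun q Q hqQ => ?_⟩
  obtain ⟨k, hk⟩ := exists_add_intVec_mem_cube q
  rw [← hper k (q, Q)]
  refine (hB _ ⟨(q + intVec ℝ k, Q - q), ⟨hk, by simpa using hqQ⟩, ?_⟩).trans (le_max_left _ _)
  simp only [Prod.mk_add_mk, Prod.mk.injEq, true_and]
  abel

theorem fderiv_add_of_periodic {X E : Type*} [NormedAddCommGroup X] [NormedSpace ℝ X]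
    [NormedAddCommGroup E] [NormedSpace ℝ E] {T : X → E} {a : X}
    (hper : ∀ x, T (x + a) = T x) (x : X) : fderiv ℝ T (x + a) = fderiv ℝ T x := by
  rw [← fderiv_comp_add_right, funext hper]

theorem taylor_of_fderiv_fderiv_le {E : Type*} [NormedAddCommGroup E] [NormedSpace ℝ E]
    {T : E → ℝ} (hT : ContDiff ℝ 2 T) {s : Set E} (hs : Convex ℝ s) {L : ℝ} (hL : 0 ≤ L)
    (hb : ∀ x ∈ s, ‖fderiv ℝ (fderiv ℝ T) x‖ ≤ L) {x y : E} (hx : x ∈ s) (hy : y ∈ s) :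
    |T y - T x - fderiv ℝ T x (y - x)| ≤ L * ‖y - x‖ ^ 2 := by
  have hd : Differentiable ℝ T := hT.differentiable two_ne_zero
  have hd2 : Differentiable ℝ (fderiv ℝ T) :=
    (hT.fderiv_right (m := 1) (by norm_num)).differentiable one_ne_zero
  have := (hs.inter (convex_closedBall x ‖y - x‖)).norm_image_sub_le_of_norm_hasFDerivWithin_le'
    (𝕜 := ℝ) (f := T) (φ := fderiv ℝ T x) (C := L * ‖y - x‖) (x := x) (y := y)
    (fun z _ => (hd z).hasFDerivAt.hasFDerivWithinAt) (fun z hz => by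
      refine (hs.norm_image_sub_le_of_norm_fderiv_le (𝕜 := ℝ) (fun u _ => hd2 u) hb hx hz.1).trans ?_
      have := hz.2
      rw [mem_closedBall_iff_norm] at this
      gcongr) ⟨hx, by simp⟩ ⟨hy, by simp [dist_eq_norm]⟩
  rw [Real.norm_eq_abs] at this
  calc _ ≤ _ := this
    _ = _ := by ring

theorem exists_taylor_of_diag_periodic (hT : ContDiff ℝ 2 T)
    (hper : ∀ (k : Fin d → ℤ) x, T (x + (intVec ℝ k, intVec ℝ k)) = T x) (D : ℝ) :
    ∃ B L, 0 ≤ B ∧ 0 ≤ L ∧ (∀ q Q, ‖Q - q‖ ≤ D → |T (q, Q)| ≤ B) ∧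
      (∀ q Q, ‖Q - q‖ ≤ D → ‖fderiv ℝ T (q, Q)‖ ≤ B) ∧
      ∀ q Q u v, ‖Q - q‖ ≤ D → ‖(Q + v) - (q + u)‖ ≤ D →
        |T (q + u, Q + v) - T (q, Q) - fderiv ℝ T (q, Q) (u, v)| ≤ L * ‖(u, v)‖ ^ 2 := by
  have hT1 : ContDiff ℝ 1 (fderiv ℝ T) := hT.fderiv_right (by norm_num)
  have hp1 : ∀ (k : Fin d → ℤ) x, fderiv ℝ T (x + (intVec ℝ k, intVec ℝ k)) = fderiv ℝ T x :=
    fun k => fderiv_add_of_periodic (hper k)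
  obtain ⟨B0, hB00, hB0⟩ := exists_bound_of_diag_periodic hT.continuous hper D
  obtain ⟨B1, hB10, hB1⟩ := exists_bound_of_diag_periodic hT1.continuous hp1 D
  obtain ⟨L, hL0, hL⟩ := exists_bound_of_diag_periodic (hT1.continuous_fderiv one_ne_zero)
    (fun k => fderiv_add_of_periodic (hp1 k)) D
  refine ⟨max B0 B1, L, le_max_of_le_left hB00, hL0, fun q Q h => (hB0 q Q h).trans (le_max_left _ _),
    fun q Q h => (hB1 q Q h).trans (le_max_right _ _), fun q Q u v h h' => ?_⟩
  have hs : Convex ℝ {x : Phase ℝ d | ‖x.2 - x.1‖ ≤ D} := by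
    have := (convex_closedBall (0 : Vec ℝ d) D).linear_preimage
      (LinearMap.snd ℝ (Vec ℝ d) (Vec ℝ d) - LinearMap.fst ℝ (Vec ℝ d) (Vec ℝ d))
    have e : {x : Phase ℝ d | ‖x.2 - x.1‖ ≤ D} = (LinearMap.snd ℝ (Vec ℝ d) (Vec ℝ d) -
        LinearMap.fst ℝ (Vec ℝ d) (Vec ℝ d)) ⁻¹' Metric.closedBall 0 D := by
      ext x
      simp
    rwa [e]
  have := taylor_of_fderiv_fderiv_le hT hs hL0 (fun x hx => hL x.1 x.2 hx) (x := (q, Q))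
    (y := (q + u, Q + v)) h h'
  simpa using this

/-- Integrating the mixed derivative away from the diagonal, where everything is bounded by
periodicity, gives at least `α/2 ‖v‖² - B‖v‖ - B`; half of the quadratic term absorbs the linear
one. -/
theorem exists_coercive (hS : ContDiff ℝ 2 T)
    (hper : ∀ (k : Fin d → ℤ) x, T (x + (intVec ℝ k, intVec ℝ k)) = T x) {α : ℝ} (hα : 0 < α)
    (h : ∀ q Q v : Vec ℝ d, hess T (q, Q) (v, 0) (0, v) ≤ -α * ‖v‖ ^ 2) :
    ∃ c C : ℝ, 0 < c ∧ ∀ q Q, c * ‖Q - q‖ ^ 2 - C ≤ T (q, Q) := by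
  obtain ⟨B, L, hB0, -, hB, hB1, -⟩ := exists_taylor_of_diag_periodic hS hper 0
  have hd : ∀ x, HasFDerivAt T (fderiv ℝ T x) x := fun x =>
    (hS.differentiable two_ne_zero x).hasFDerivAt
  have hd2 : ∀ x, HasFDerivAt (fderiv ℝ T) (fderiv ℝ (fderiv ℝ T) x) x := fun x =>
    ((hS.fderiv_right (m := 1) (by norm_num)).differentiable one_ne_zero x).hasFDerivAt
  refine ⟨α / 4, B + B ^ 2 / α, by positivity, fun q Q => ?_⟩
  obtain ⟨v, rfl⟩ : ∃ v, Q = q + v := ⟨Q - q, by abel⟩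
  rw [add_sub_cancel_left]
  have hline : ∀ (x : Vec ℝ d) (t : ℝ), HasDerivAt (fun t : ℝ => x + t • v) v t := fun x t => by
    simpa using ((hasDerivAt_id t).smul_const v).const_add x
  -- Moving the first argument from `q + t • v` back to `q` gains `α t ‖v‖²` over the value on the
  -- diagonal.
  have h1 : ∀ t, 0 ≤ t → -(B * ‖v‖) + α * t * ‖v‖ ^ 2 ≤ fderiv ℝ T (q, q + t • v) (0, v) := by
    intro t ht
    set l : ℝ → ℝ := fun s => fderiv ℝ T (q + s • v, q + t • v) (0, v) with hl
    have hld : ∀ s, HasDerivAt l (hess T (q + s • v, q + t • v) (v, 0) (0, v)) s := by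
      intro s
      have e1 := (hd2 (q + s • v, q + t • v)).comp_hasDerivAt s
        ((hline q s).prodMk (hasDerivAt_const s (q + t • v)))
      simpa [hess] using e1.clm_apply (hasDerivAt_const s ((0, v) : Phase ℝ d))
    have h2 := (convex_univ (𝕜 := ℝ) (E := ℝ)).image_sub_le_mul_sub_of_deriv_le (f := l)
      (fun s _ => (hld s).continuousAt.continuousWithinAt)
      (fun s _ => (hld s).differentiableAt.differentiableWithinAt)
      (C := -α * ‖v‖ ^ 2) (fun s _ => by rw [(hld s).deriv]; exact h _ _ _) 0
      (Set.mem_univ _) t (Set.mem_univ _) ht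
    have h3 := (fderiv ℝ T (q + t • v, q + t • v)).le_opNorm (0, v)
    have h4 := hB1 (q + t • v) (q + t • v) (by simp)
    have h5 : ‖((0, v) : Phase ℝ d)‖ = ‖v‖ := by simp [Prod.norm_mk]
    rw [h5] at h3
    have h6 := (abs_le.1 (h3.trans (mul_le_mul_of_nonneg_right h4 (norm_nonneg v)))).1
    simp only [hl, zero_smul, add_zero] at h2
    nlinarith
  set k : ℝ → ℝ := fun t => T (q, q + t • v) + B * ‖v‖ * t - α * ‖v‖ ^ 2 / 2 * t ^ 2 with hk
  have hkd : ∀ t, HasDerivAt k (fderiv ℝ T (q, q + t • v) (0, v) + B * ‖v‖ * 1 -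
      α * ‖v‖ ^ 2 / 2 * (2 * t)) t := by
    intro t
    refine (((hd (q, q + t • v)).comp_hasDerivAt t
      ((hasDerivAt_const t q).prodMk (hline q t))).add ((hasDerivAt_id t).const_mul _)).sub ?_
    simpa using (hasDerivAt_pow 2 t).const_mul (α * ‖v‖ ^ 2 / 2)
  have hmono : MonotoneOn k (Set.Ici 0) := by
    refine monotoneOn_of_deriv_nonneg (convex_Ici 0)
      (fun t _ => (hkd t).continuousAt.continuousWithinAt)
      (fun t _ => (hkd t).differentiableAt.differentiableWithinAt) (fun t ht => ?_)
    rw [interior_Ici] at ht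
    rw [(hkd t).deriv]
    have := h1 t (le_of_lt ht)
    linarith
  have h2 := hmono (Set.mem_Ici.2 le_rfl) (Set.mem_Ici.2 zero_le_one) zero_le_one
  simp only [hk, zero_smul, add_zero, one_smul] at h2
  have h3 := (abs_le.1 (hB q q (by simp))).1
  have h4 : 0 ≤ α / 4 * (‖v‖ - 2 * B / α) ^ 2 := by positivity
  have h5 : α / 4 * (‖v‖ - 2 * B / α) ^ 2 = α / 4 * ‖v‖ ^ 2 - B * ‖v‖ + B ^ 2 / α := by
    field_simp; ring
  rw [h5] at h4
  norm_num at h2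
  linarith

end PeriodicBounds

/-- The map with generating function `S(q, Q) + ε g(q)`, when `F` has generating function `S`. -/
noncomputable def perturb (F : Phase ℝ d → Phase ℝ d) (g : Vec ℝ d → ℝ) (ε : ℝ) (x : Phase ℝ d) :
    Phase ℝ d :=
  F (x.1, x.2 + ε • gradient g x.1)

/-- An analytic twist map `F` with coercive generating function `S`, and an analytic periodic
potential `g`. -/
structure IsAnalyticTwist (S : Phase ℝ d → ℝ) (F : Phase ℝ d → Phase ℝ d) (g : Vec ℝ d → ℝ) :
    Prop where
  contDiff_S : ContDiff ℝ 2 S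
  S_periodic : ∀ (k : Fin d → ℤ) x, S (x + (intVec ℝ k, intVec ℝ k)) = S x
  contDiff_F : ContDiff ℝ ω F
  fderiv_inj : ∀ x ξ, fderiv ℝ F x ξ = 0 → ξ = 0
  F_periodic : ∀ (k : Fin d → ℤ) q p, F (q + intVec ℝ k, p) = F (q, p) + (intVec ℝ k, 0)
  generates : ∀ q p u v, fderiv ℝ S (q, (F (q, p)).1) (u, v) =
    inner ℝ (F (q, p)).2 v - inner ℝ p u
  surj : ∀ q Q, ∃ p, (F (q, p)).1 = Q
  coercive : ∃ c C : ℝ, 0 < c ∧ ∀ q Q, c * ‖Q - q‖ ^ 2 - C ≤ S (q, Q)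
  contDiff_g : ContDiff ℝ ω g
  g_periodic : ∀ (k : Fin d → ℤ) q, g (q + intVec ℝ k) = g q

/-! ### The perturbed family and bounds locally uniform in ε. -/

namespace IsAnalyticTwist

variable {S : Phase ℝ d → ℝ} {F : Phase ℝ d → Phase ℝ d} {g : Vec ℝ d → ℝ}

theorem contDiff_gradient (h : IsAnalyticTwist S F g) : ContDiff ℝ ω (gradient g) := by
  have h1 : ContDiff ℝ ω (fderiv ℝ g) := h.contDiff_g.fderiv_right le_top
  exact (InnerProductSpace.toDual ℝ (Vec ℝ d)).symm.toContinuousLinearEquiv.contDiff.comp h1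

theorem inner_gradient (q u : Vec ℝ d) : inner ℝ (gradient g q) u = fderiv ℝ g q u := by
  rw [gradient, InnerProductSpace.toDual_symm_apply]

theorem gradient_periodic (h : IsAnalyticTwist S F g) (k : Fin d → ℤ) (q : Vec ℝ d) :
    gradient g (q + intVec ℝ k) = gradient g q := by
  rw [gradient, gradient, fderiv_add_of_periodic (h.g_periodic k)]

theorem contDiff_perturb (h : IsAnalyticTwist S F g) :
    ContDiff ℝ ω fun y : ℝ × Phase ℝ d => perturb F g y.1 y.2 := by
  have := h.contDiff_gradient
  exact h.contDiff_F.comp (contDiff_snd.fst.prodMk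
    (contDiff_snd.snd.add (contDiff_fst.smul (this.comp contDiff_snd.fst))))

theorem perturb_periodic (h : IsAnalyticTwist S F g) (ε : ℝ) (k : Fin d → ℤ) (q p : Vec ℝ d) :
    perturb F g ε (q + intVec ℝ k, p) = perturb F g ε (q, p) + (intVec ℝ k, 0) := by
  simp only [perturb, h.gradient_periodic, h.F_periodic]

theorem perturb_iterate_periodic (h : IsAnalyticTwist S F g) (ε : ℝ) (k : Fin d → ℤ)
    (q p : Vec ℝ d) (n : ℕ) :
    (perturb F g ε)^[n] (q + intVec ℝ k, p) = (perturb F g ε)^[n] (q, p) + (intVec ℝ k, 0) := by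
  induction n with
  | zero => simp
  | succ n ih =>
    rw [Function.iterate_succ_apply', Function.iterate_succ_apply', ih]
    have := h.perturb_periodic ε k ((perturb F g ε)^[n] (q, p)).1 ((perturb F g ε)^[n] (q, p)).2
    rw [← this]
    congr 1
    ext <;> simp

theorem contDiff_g_fst (h : IsAnalyticTwist S F g) : ContDiff ℝ 2 fun x : Phase ℝ d => g x.1 :=
  (h.contDiff_g.of_le le_top).comp contDiff_fst

theorem g_fst_periodic (h : IsAnalyticTwist S F g) (k : Fin d → ℤ) (x : Phase ℝ d) :
    (fun x : Phase ℝ d => g x.1) (x + (intVec ℝ k, intVec ℝ k)) = g x.1 :=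
  h.g_periodic k x.1

theorem fderiv_perturbed (h : IsAnalyticTwist S F g) (ε : ℝ) (x : Phase ℝ d) :
    fderiv ℝ (fun x : Phase ℝ d => S x + ε * g x.1) x =
      fderiv ℝ S x + ε • fderiv ℝ (fun x : Phase ℝ d => g x.1) x := by
  have h1 := (h.contDiff_S.differentiable two_ne_zero x).hasFDerivAt
  have h2 := (h.contDiff_g_fst.differentiable two_ne_zero x).hasFDerivAt
  exact (h1.add (h2.const_mul ε)).fderiv

theorem fderiv_g_fst (h : IsAnalyticTwist S F g) (x : Phase ℝ d) (u v : Vec ℝ d) :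
    fderiv ℝ (fun x : Phase ℝ d => g x.1) x (u, v) = inner ℝ (gradient g x.1) u := by
  have h1 := (h.contDiff_g.differentiable (by simp) x.1).hasFDerivAt.comp x
    (hasFDerivAt_fst (𝕜 := ℝ) (p := x))
  rw [inner_gradient]
  exact congrArg (fun L => L (u, v)) h1.fderiv

theorem exists_bound_g (h : IsAnalyticTwist S F g) : ∃ b, 0 ≤ b ∧ ∀ q, |g q| ≤ b :=
  exists_bound_of_periodic h.contDiff_g.continuous h.g_periodic

theorem isCoerciveTwist (h : IsAnalyticTwist S F g) (ε : ℝ) :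
    IsCoerciveTwist (fun x => S x + ε * g x.1) (perturb F g ε) where
  contDiff_S := h.contDiff_S.add (contDiff_const.mul h.contDiff_g_fst)
  contDiff_F := (h.contDiff_perturb.of_le le_top).comp (contDiff_const.prodMk contDiff_id)
  fderiv_inj x ξ hξ := by
    have h1 := (h.contDiff_gradient.differentiable (by simp) x.1).hasFDerivAt.comp x
      (hasFDerivAt_fst (𝕜 := ℝ) (p := x))
    have h2 : HasFDerivAt (fun x : Phase ℝ d => ((x.1, x.2 + ε • gradient g x.1) : Phase ℝ d)) _ x :=
      hasFDerivAt_fst.prodMk (hasFDerivAt_snd.add (h1.const_smul ε))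
    have h3 := (h.contDiff_F.differentiable (by simp) _).hasFDerivAt.comp x h2
    have h4 : fderiv ℝ (perturb F g ε) x = _ := h3.fderiv
    rw [h4] at hξ
    have h5 := h.fderiv_inj _ _ hξ
    have h6 : ξ.1 = 0 := congrArg Prod.fst h5
    have h7 : ξ.2 + ε • fderiv ℝ (gradient g) x.1 ξ.1 = 0 := congrArg Prod.snd h5
    rw [h6, map_zero, smul_zero, add_zero] at h7
    exact Prod.ext h6 h7
  generates q p u v := by
    rw [h.fderiv_perturbed]
    simp only [add_apply, smul_apply, h.fderiv_g_fst, perturb, smul_eq_mul]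
    rw [h.generates, inner_add_left, inner_smul_left]
    simp only [conj_trivial]
    ring
  surj q Q := by
    obtain ⟨p, hp⟩ := h.surj q Q
    exact ⟨p - ε • gradient g q, by simpa [perturb] using hp⟩
  coercive := by
    obtain ⟨c, C, hc, hS⟩ := h.coercive
    obtain ⟨b, hb0, hb⟩ := h.exists_bound_g
    refine ⟨c, C + |ε| * b, hc, fun q Q => ?_⟩
    have h1 := hS q Q
    have h2 : -(|ε| * b) ≤ ε * g q := by
      have : |ε * g q| ≤ |ε| * b := by rw [abs_mul]; gcongr; exact hb q
      exact (abs_le.1 this).1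
    linarith

/-- A priori bounds for periodic graphs, locally uniform in the parameter. -/
theorem exists_uniform_bound (h : IsAnalyticTwist S F g) (hn : 0 < n) (m : Fin d → ℤ) (R : ℝ) :
    ∃ B L : ℝ, 0 ≤ B ∧ 0 ≤ L ∧ ∀ ε, |ε| ≤ R → ∀ γ w, IsPeriodicPotential (perturb F g ε) m n γ w →
      (∀ q, ‖γ q‖ ≤ B) ∧ HasQuadraticApprox w γ L := by
  rcases lt_or_ge R 0 with hR | hR
  · exact ⟨0, 0, le_rfl, le_rfl, fun ε hε => absurd (abs_nonneg ε) (by linarith)⟩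
  obtain ⟨c, C, hc, hS⟩ := h.coercive
  obtain ⟨b, hb0, hb⟩ := h.exists_bound_g
  obtain ⟨M, -, hM0, -, hM, -, -⟩ := exists_taylor_of_diag_periodic h.contDiff_S h.S_periodic
    ‖(n : ℝ)⁻¹ • intVec ℝ m‖
  -- The bound on the squared step length, with `S` shifted by at most `R * b` in both directions.
  set E := n * ((M + R * b) + (C + R * b)) / c with hE
  set D := Real.sqrt (max E 0) with hD
  have hD0 : 0 ≤ D := Real.sqrt_nonneg _
  have hDE : E ≤ D ^ 2 := by rw [hD, Real.sq_sqrt (le_max_right _ _)]; exact le_max_left _ _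
  -- The extra 1 leaves room to displace one argument by a vector of length at most 1.
  obtain ⟨B₁, L₁, hB₁0, hL₁0, -, hB₁, hL₁⟩ :=
    exists_taylor_of_diag_periodic h.contDiff_S h.S_periodic (D + 1)
  obtain ⟨B₂, L₂, hB₂0, hL₂0, -, hB₂, hL₂⟩ :=
    exists_taylor_of_diag_periodic h.contDiff_g_fst h.g_fst_periodic (D + 1)
  refine ⟨B₁ + R * B₂, (L₁ + R * L₂) + 2 * (B₁ + R * B₂), by positivity, by positivity,
    fun ε hε γ w hw => ?_⟩
  have heg : ∀ q, |ε * g q| ≤ R * b := fun q => by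
    rw [abs_mul]; exact mul_le_mul hε (hb q) (abs_nonneg _) hR
  refine (h.isCoerciveTwist ε).hasQuadraticApprox hn hw (c := c) (C := C + R * b) (M := M + R * b)
    (D := D) hc (fun q Q => ?_) (fun q => ?_) hD0 ?_ (by positivity) ?_ (by positivity) ?_
  · have h1 := hS q Q
    have h2 := (abs_le.1 (heg q)).1
    linarith
  · have h1 := (abs_le.1 (hM q (q + (n : ℝ)⁻¹ • intVec ℝ m) (by simp))).2
    have h2 := (abs_le.1 (heg q)).2
    linarith
  · rw [hE, div_le_iff₀ hc] at hDE
    linarith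
  · intro q Q hqQ u v hu hv huv
    have hD' : ‖Q + v - (q + u)‖ ≤ D + 1 := by
      have h1 : Q + v - (q + u) = (Q - q) + (v - u) := by abel
      rw [h1]
      refine (norm_add_le _ _).trans (add_le_add hqQ ?_)
      rcases huv with rfl | rfl <;> simpa
    have h1 := (abs_le.1 (hL₁ q Q u v (by linarith) hD')).2
    have h2 := hL₂ q Q u v (by linarith) hD'
    have h3 : ε * (g (q + u) - g q - fderiv ℝ (fun x : Phase ℝ d => g x.1) (q, Q) (u, v)) ≤
        R * (L₂ * ‖(u, v)‖ ^ 2) := by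
      refine (le_abs_self _).trans ?_
      rw [abs_mul]
      exact mul_le_mul hε h2 (abs_nonneg _) hR
    rw [h.fderiv_perturbed]
    simp only [add_apply, smul_apply, smul_eq_mul]
    linarith
  · intro q Q hqQ
    rw [h.fderiv_perturbed]
    refine (norm_add_le _ _).trans (add_le_add (hB₁ q Q (by linarith)) ?_)
    rw [norm_smul]
    exact mul_le_mul hε (hB₂ q Q (by linarith)) (norm_nonneg _) hR

end IsAnalyticTwist

end TwistMap

/-! ### Compactness and boundedness of the set of parameters. -/

namespace TwistMap

open scoped ContDiff Topology

variable {d : ℕ} {m : Fin d → ℤ} {n : ℕ}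
  {S : Phase ℝ d → ℝ} {F : Phase ℝ d → Phase ℝ d} {g : Vec ℝ d → ℝ}

theorem hasLagrangianPeriodicGraph_iff :
    HasLagrangianPeriodicGraph F m n ↔ ∃ γ w, w 0 = 0 ∧ IsPeriodicPotential F m n γ w := by
  constructor
  · rintro ⟨γ, ⟨K, hK⟩, hper, hL, hit⟩
    obtain ⟨w, hw0, hw⟩ := hL.exists_potential hK.continuous
    exact ⟨γ, w, hw0, ⟨K, hK⟩, hper, hw, hit⟩
  · rintro ⟨γ, w, -, hw⟩
    exact ⟨γ, hw.lipschitz, hw.periodic,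
      isLagrangianGraph_of_potential hw.continuous_γ hw.hasFDerivAt, hw.iterate⟩

theorem IsPeriodicPotential.sub_const {γ : Vec ℝ d → Vec ℝ d} {w : Vec ℝ d → ℝ}
    (hw : IsPeriodicPotential F m n γ w) (c : ℝ) :
    IsPeriodicPotential F m n γ fun q => w q - c :=
  ⟨hw.lipschitz, hw.periodic, fun q => (hw.hasFDerivAt q).sub_const c, hw.iterate⟩

namespace IsAnalyticTwist

/-- Normalized periodic potentials with parameter in `[-R, R]` and given bounds. -/
def potentialSet (F : Phase ℝ d → Phase ℝ d) (g : Vec ℝ d → ℝ) (m : Fin d → ℤ) (n : ℕ)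
    (R B L : ℝ) : Set (ℝ × (Vec ℝ d → ℝ) × (Vec ℝ d → Vec ℝ d)) :=
  {z | |z.1| ≤ R ∧ z.2.1 0 = 0 ∧ (∀ q, ‖z.2.2 q‖ ≤ B) ∧ HasQuadraticApprox z.2.1 z.2.2 L ∧
    (∀ (k : Fin d → ℤ) q, z.2.2 (q + intVec ℝ k) = z.2.2 q) ∧
    ∀ q, (perturb F g z.1)^[n] (q, z.2.2 q) = (q + intVec ℝ m, z.2.2 q)}

theorem isPeriodicPotential_of_mem {R B L : ℝ} (hL : 0 ≤ L)
    {z : ℝ × (Vec ℝ d → ℝ) × (Vec ℝ d → Vec ℝ d)} (hz : z ∈ potentialSet F g m n R B L) :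
    IsPeriodicPotential (perturb F g z.1) m n z.2.2 z.2.1 :=
  ⟨⟨_, hz.2.2.2.1.lipschitzWith hL⟩, hz.2.2.2.2.1, hz.2.2.2.1.hasFDerivAt, hz.2.2.2.2.2⟩

theorem contDiff_perturb_iterate (h : IsAnalyticTwist S F g) (n : ℕ) :
    ContDiff ℝ ω fun y : ℝ × Phase ℝ d => (perturb F g y.1)^[n] y.2 := by
  induction n with
  | zero => exact contDiff_snd
  | succ n ih =>
    simp only [Function.iterate_succ_apply']
    exact h.contDiff_perturb.comp (contDiff_fst.prodMk ih)

/-- Tychonoff for pointwise convergence: every condition is a closed one on finitely many values.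
The quadratic approximation encodes both the gradient relation and the Lipschitz bound in a form
stable under pointwise limits. -/
theorem isCompact_potentialSet (h : IsAnalyticTwist S F g) (R B L : ℝ) :
    IsCompact (potentialSet F g m n R B L) := by
  have hK : IsCompact (Metric.closedBall (0 : ℝ) R ×ˢ
      ((Set.pi Set.univ fun q : Vec ℝ d => Metric.closedBall (0 : ℝ) (B * ‖q‖ + L * ‖q‖ ^ 2)) ×ˢ
        (Set.pi Set.univ fun _ : Vec ℝ d => Metric.closedBall (0 : Vec ℝ d) B))) :=
    (isCompact_closedBall _ _).prod ((isCompact_univ_pi fun _ => isCompact_closedBall _ _).prod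
      (isCompact_univ_pi fun _ => isCompact_closedBall _ _))
  refine hK.of_isClosed_subset ?_ ?_
  · have hγ : ∀ q, Continuous fun z : ℝ × (Vec ℝ d → ℝ) × (Vec ℝ d → Vec ℝ d) => z.2.2 q :=
      fun q => (continuous_apply q).comp (continuous_snd.comp continuous_snd)
    have hw : ∀ q, Continuous fun z : ℝ × (Vec ℝ d → ℝ) × (Vec ℝ d → Vec ℝ d) => z.2.1 q :=
      fun q => (continuous_apply q).comp (continuous_fst.comp continuous_snd)
    have hit := (h.contDiff_perturb_iterate n).continuous
    simp only [potentialSet, HasQuadraticApprox, Set.ofPred_and, Set.ofPred_forall]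
    refine (isClosed_le continuous_fst.abs continuous_const).inter <|
      (isClosed_eq (hw 0) continuous_const).inter <|
      (isClosed_iInter fun q => isClosed_le (hγ q).norm continuous_const).inter <|
      (isClosed_iInter fun x => isClosed_iInter fun y => isClosed_le
        (((hw y).sub (hw x)).sub ((hγ x).inner continuous_const)).abs continuous_const).inter <|
      (isClosed_iInter fun k => isClosed_iInter fun q => isClosed_eq (hγ _) (hγ _)).inter <|
      (isClosed_iInter fun q => isClosed_eq
        (hit.comp (continuous_fst.prodMk (continuous_const.prodMk (hγ q))))
        (continuous_const.prodMk (hγ q)))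
  · rintro ⟨ε, w, γ⟩ ⟨hε, hw0, hB, hqa, -, -⟩
    refine ⟨by simpa using hε, fun q _ => ?_, fun q _ => by simpa using hB q⟩
    have h1 := hqa 0 q
    have hw0' : w 0 = 0 := hw0
    simp only [hw0', sub_zero] at h1 hB ⊢
    have h2 : |inner ℝ (γ 0) q| ≤ B * ‖q‖ :=
      (abs_real_inner_le_norm _ _).trans (mul_le_mul_of_nonneg_right (hB 0) (norm_nonneg _))
    rw [mem_closedBall_zero_iff, Real.norm_eq_abs]
    calc |w q| = |(w q - inner ℝ (γ 0) q) + inner ℝ (γ 0) q| := by ring_nf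
      _ ≤ |w q - inner ℝ (γ 0) q| + |inner ℝ (γ 0) q| := abs_add_le _ _
      _ ≤ _ := by linarith

/-- The parameters with a Lagrangian `(m, n)`-periodic graph. -/
def parameters (F : Phase ℝ d → Phase ℝ d) (g : Vec ℝ d → ℝ) (m : Fin d → ℤ) (n : ℕ) : Set ℝ :=
  {ε | HasLagrangianPeriodicGraph (perturb F g ε) m n}

theorem isCompact_parameters_inter (h : IsAnalyticTwist S F g) (hn : 0 < n) (R : ℝ) :
    IsCompact (parameters F g m n ∩ Metric.closedBall 0 R) := by
  obtain ⟨B, L, hB, hL, hb⟩ := h.exists_uniform_bound hn m R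
  have := (h.isCompact_potentialSet (m := m) (n := n) R B L).image continuous_fst
  convert this using 1
  ext ε
  constructor
  · rintro ⟨hε, hR⟩
    obtain ⟨γ, w, hw0, hw⟩ := hasLagrangianPeriodicGraph_iff.1 hε
    rw [mem_closedBall_zero_iff, Real.norm_eq_abs] at hR
    obtain ⟨h1, h2⟩ := hb ε hR γ w hw
    exact ⟨(ε, w, γ), ⟨hR, hw0, h1, h2, hw.periodic, hw.iterate⟩, rfl⟩
  · rintro ⟨z, hz, rfl⟩
    exact ⟨hasLagrangianPeriodicGraph_iff.2 ⟨_, _, hz.2.1, isPeriodicPotential_of_mem hL hz⟩,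
      by simpa using hz.1⟩

theorem isClosed_parameters (h : IsAnalyticTwist S F g) (hn : 0 < n) :
    IsClosed (parameters F g m n) := by
  refine isClosed_of_closure_subset fun ε hε => ?_
  have h1 : ε ∈ closure (parameters F g m n ∩ Metric.closedBall 0 (|ε| + 1)) := by
    rw [mem_closure_iff_nhds] at hε ⊢
    intro t ht
    obtain ⟨x, hx1, hx2⟩ := hε _ (Filter.inter_mem ht (Metric.ball_mem_nhds ε one_pos))
    refine ⟨x, hx1.1, hx2, ?_⟩
    have h2 := hx1.2
    rw [Metric.mem_ball, Real.dist_eq] at h2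
    rw [mem_closedBall_zero_iff, Real.norm_eq_abs]
    have := abs_sub_abs_le_abs_sub x ε
    linarith
  exact ((h.isCompact_parameters_inter hn _).isClosed.closure_subset h1).1

/-- The periodic graph depends continuously on the parameter. -/
theorem eventually_graph_near (h : IsAnalyticTwist S F g) (hn : 0 < n) {ε₀ : ℝ}
    {γ₀ : Vec ℝ d → Vec ℝ d} {w₀ : Vec ℝ d → ℝ}
    (h₀ : IsPeriodicPotential (perturb F g ε₀) m n γ₀ w₀) (q : Vec ℝ d) {ρ : ℝ} (hρ : 0 < ρ) :
    ∀ᶠ ε in 𝓝 ε₀, ∀ γ w, IsPeriodicPotential (perturb F g ε) m n γ w → ‖γ q - γ₀ q‖ < ρ := by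
  obtain ⟨B, L, hB, hL, hb⟩ := h.exists_uniform_bound hn m (|ε₀| + 1)
  have hγ : Continuous fun z : ℝ × (Vec ℝ d → ℝ) × (Vec ℝ d → Vec ℝ d) => z.2.2 q :=
    (continuous_apply q).comp (continuous_snd.comp continuous_snd)
  have hc : IsCompact (potentialSet F g m n (|ε₀| + 1) B L ∩ {z | ρ ≤ ‖z.2.2 q - γ₀ q‖}) :=
    (h.isCompact_potentialSet _ _ _).inter_right
      (isClosed_le continuous_const (hγ.sub continuous_const).norm)
  have hcl := (hc.image continuous_fst).isClosed
  -- Uniqueness of the graph at `ε₀` keeps `ε₀` out of this closed projection, so its complement is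
  -- the required neighbourhood.
  have hnot : ε₀ ∉ Prod.fst '' (potentialSet F g m n (|ε₀| + 1) B L ∩
      {z | ρ ≤ ‖z.2.2 q - γ₀ q‖}) := by
    rintro ⟨z, ⟨hz, hz2⟩, rfl⟩
    have := (h.isCoerciveTwist z.1).graph_unique hn (isPeriodicPotential_of_mem hL hz) h₀
    rw [Set.mem_ofPred_eq, this, sub_self, norm_zero] at hz2
    exact absurd hz2 (not_le.2 hρ)
  filter_upwards [hcl.isOpen_compl.mem_nhds hnot, Metric.ball_mem_nhds ε₀ one_pos]
    with ε hε hε1 γ w hw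
  by_contra hcon
  push Not at hcon
  apply hε
  have hR : |ε| ≤ |ε₀| + 1 := by
    rw [Metric.mem_ball, Real.dist_eq] at hε1
    have := abs_sub_abs_le_abs_sub ε ε₀
    linarith
  have hw' := hw.sub_const (w 0)
  obtain ⟨h1, h2⟩ := hb ε hR γ _ hw'
  exact ⟨(ε, _, γ), ⟨⟨hR, by simp, h1, h2, hw.periodic, hw.iterate⟩, hcon⟩, rfl⟩

/-- When the pure second differences of `S` are bounded and `g` is not constant, the parameters
are bounded. -/
theorem exists_bound_parameters (h : IsAnalyticTwist S F g) (hn : 0 < n) {C : ℝ}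
    (h₁ : ∀ q Q δ, S (q + δ, Q) + S (q - δ, Q) - 2 * S (q, Q) ≤ C * ‖δ‖ ^ 2)
    (h₂ : ∀ q Q δ, S (q, Q + δ) + S (q, Q - δ) - 2 * S (q, Q) ≤ C * ‖δ‖ ^ 2)
    (hg : ¬ ∃ c, ∀ q, g q = c) : ∃ R, parameters F g m n ⊆ Metric.closedBall 0 R := by
  -- Adding the inequalities for `δ` and `-δ` at both ends cancels `w`. Moving the last point does
  -- not touch the first argument of `S_ε`, so only one second difference of `g` survives.
  have key : ∀ ε ∈ parameters F g m n, ∀ q δ,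
      0 ≤ 2 * C * ‖δ‖ ^ 2 + ε * (g (q + δ) + g (q - δ) - 2 * g q) := by
    intro ε hε q δ
    obtain ⟨γ, w, -, hw⟩ := hasLagrangianPeriodicGraph_iff.1 hε
    have ht := h.isCoerciveTwist ε
    have a1 := ht.potential_le_first hn hw q δ
    have a2 := ht.potential_le_first hn hw q (-δ)
    obtain ⟨n, rfl⟩ := Nat.exists_eq_succ_of_ne_zero hn.ne'
    have b1 := ht.potential_le_last hw q δ
    have b2 := ht.potential_le_last hw q (-δ)
    simp only [← sub_eq_add_neg] at a2 b2
    have c1 := h₁ q (perturb F g ε (q, γ q)).1 δ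
    have c2 := h₂ ((perturb F g ε)^[n] (q, γ q)).1 (q + intVec ℝ m) δ
    linarith
  have hcube : (cube d).Nonempty := ⟨0, fun i => by simp⟩
  obtain ⟨qM, -, hM⟩ := isCompact_cube.exists_isMaxOn hcube h.contDiff_g.continuous.continuousOn
  obtain ⟨qm, -, hm⟩ := isCompact_cube.exists_isMinOn hcube h.contDiff_g.continuous.continuousOn
  have hM' : ∀ q, g q ≤ g qM := fun q => by
    obtain ⟨k, hk⟩ := exists_add_intVec_mem_cube q
    rw [← h.g_periodic k q]; exact hM hk
  have hm' : ∀ q, g qm ≤ g q := fun q => by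
    obtain ⟨k, hk⟩ := exists_add_intVec_mem_cube q
    rw [← h.g_periodic k q]; exact hm hk
  have hlt : g qm < g qM := by
    by_contra hcon
    push Not at hcon
    exact hg ⟨g qm, fun q => le_antisymm ((hM' q).trans hcon) (hm' q)⟩
  set Δ := g qM - g qm with hΔ
  have hΔ0 : 0 < Δ := sub_pos.2 hlt
  refine ⟨2 * |C| * ‖qM - qm‖ ^ 2 / Δ, fun ε hε => ?_⟩
  rw [mem_closedBall_zero_iff, Real.norm_eq_abs, le_div_iff₀ hΔ0]
  -- The displacement joins the two extrema: the second difference of `g` is at most `-Δ` at the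
  -- maximum and at least `Δ` at the minimum, which treats the two signs of ε.
  have k1 := key ε hε qM (qm - qM)
  have k2 := key ε hε qm (qM - qm)
  rw [add_sub_cancel, norm_sub_rev] at k1
  rw [add_sub_cancel] at k2
  have e1 := hM' (qM - (qm - qM))
  have e2 := hm' (qm - (qM - qm))
  have e3 : 2 * C * ‖qM - qm‖ ^ 2 ≤ 2 * |C| * ‖qM - qm‖ ^ 2 := by
    gcongr; exact le_abs_self C
  rcases le_total 0 ε with h0 | h0
  · rw [abs_of_nonneg h0]
    have : ε * (g qm + g (qM - (qm - qM)) - 2 * g qM) ≤ ε * (-Δ) :=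
      mul_le_mul_of_nonneg_left (by linarith) h0
    linarith
  · rw [abs_of_nonpos h0]
    have : ε * (g qM + g (qm - (qM - qm)) - 2 * g qm) ≤ ε * Δ :=
      mul_le_mul_of_nonpos_left (by linarith) h0
    linarith

end IsAnalyticTwist

end TwistMap

/-! ### Analytic continuation of the graph and the dichotomy. -/

namespace TwistMap

open scoped ContDiff Topology

variable {d : ℕ} {m : Fin d → ℤ} {n : ℕ}
  {S : Phase ℝ d → ℝ} {F : Phase ℝ d → Phase ℝ d} {g : Vec ℝ d → ℝ}

/-- The defect `Q_n(q, p) - q - m`, where `Q_n` is the first component of the `n`-th iterate. -/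
noncomputable def returnDefect (F : Phase ℝ d → Phase ℝ d) (g : Vec ℝ d → ℝ) (m : Fin d → ℤ)
    (n : ℕ) (y : (ℝ × Vec ℝ d) × Vec ℝ d) : Vec ℝ d :=
  ((perturb F g y.1.1)^[n] (y.1.2, y.2)).1 - y.1.2 - intVec ℝ m

namespace IsAnalyticTwist

theorem contDiff_returnDefect (h : IsAnalyticTwist S F g) (m : Fin d → ℤ) (n : ℕ) :
    ContDiff ℝ ω (returnDefect F g m n) :=
  (((h.contDiff_perturb_iterate n).comp (contDiff_fst.fst.prodMk
    (contDiff_fst.snd.prodMk contDiff_snd))).fst.sub contDiff_fst.snd).sub contDiff_const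

theorem returnDefect_periodic (h : IsAnalyticTwist S F g) (k : Fin d → ℤ) (ε : ℝ)
    (q p : Vec ℝ d) :
    returnDefect F g m n ((ε, q + intVec ℝ k), p) = returnDefect F g m n ((ε, q), p) := by
  simp only [returnDefect, h.perturb_iterate_periodic, Prod.fst_add]
  abel

/-- The partial derivative of the defect in the momentum. -/
noncomputable def defectDeriv (F : Phase ℝ d → Phase ℝ d) (g : Vec ℝ d → ℝ) (m : Fin d → ℤ)
    (n : ℕ) (y : (ℝ × Vec ℝ d) × Vec ℝ d) : Vec ℝ d →L[ℝ] Vec ℝ d :=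
  fderiv ℝ (returnDefect F g m n) y ∘L .inr ℝ (ℝ × Vec ℝ d) (Vec ℝ d)

theorem defectDeriv_periodic (h : IsAnalyticTwist S F g) (k : Fin d → ℤ) (ε : ℝ)
    (q p : Vec ℝ d) :
    defectDeriv F g m n ((ε, q + intVec ℝ k), p) = defectDeriv F g m n ((ε, q), p) := by
  have := fderiv_add_of_periodic (T := returnDefect F g m n) (a := ((0, intVec ℝ k), 0))
    (fun x => by
      have := h.returnDefect_periodic (m := m) (n := n) k x.1.1 x.1.2 x.2
      rw [← this]
      congr 1
      ext <;> simp) ((ε, q), p)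
  simp only [Prod.mk_add_mk, add_zero] at this
  rw [defectDeriv, this, defectDeriv]

theorem continuous_defectDeriv (h : IsAnalyticTwist S F g) (m : Fin d → ℤ) (n : ℕ) :
    Continuous (defectDeriv F g m n) :=
  ((h.contDiff_returnDefect m n).continuous_fderiv (by simp)).clm_comp continuous_const

variable {ε₀ : ℝ} {γ₀ : Vec ℝ d → Vec ℝ d} {w₀ : Vec ℝ d → ℝ}

theorem isInvertible_defectDeriv (h : IsAnalyticTwist S F g) (hn : 0 < n)
    (h₀ : IsPeriodicPotential (perturb F g ε₀) m n γ₀ w₀) (q : Vec ℝ d) :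
    (defectDeriv F g m n ((ε₀, q), γ₀ q)).IsInvertible := by
  have ht := h.isCoerciveTwist ε₀
  have hinj : Function.Injective (defectDeriv F g m n ((ε₀, q), γ₀ q)) := by
    refine (injective_iff_map_eq_zero _).2 fun η hη => ht.nondegenerate hn h₀ q η ?_
    have h1 : HasFDerivAt (fun p : Vec ℝ d => (((ε₀, q), p) : (ℝ × Vec ℝ d) × Vec ℝ d))
        (.inr ℝ (ℝ × Vec ℝ d) (Vec ℝ d)) (γ₀ q) := hasFDerivAt_prodMk_right _ _
    have h2 := ((h.contDiff_returnDefect m n).differentiable (by simp)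
      ((ε₀, q), γ₀ q)).hasFDerivAt.comp (γ₀ q) h1
    have h3 := ((((ht.contDiff_iterate n).differentiable one_ne_zero (q, γ₀ q)).hasFDerivAt.comp
      (γ₀ q) (hasFDerivAt_prodMk_right q (γ₀ q))).fst.sub_const q).sub_const (intVec ℝ m)
    have h4 := congrArg (fun L => L η) (h2.unique h3)
    have h5 : defectDeriv F g m n ((ε₀, q), γ₀ q) η =
      (fderiv ℝ (perturb F g ε₀)^[n] (q, γ₀ q) (0, η)).1 := h4
    rw [← h5, hη]
  exact ⟨(LinearEquiv.ofInjectiveEndo (defectDeriv F g m n ((ε₀, q), γ₀ q)).toLinearMap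
    hinj).toContinuousLinearEquiv, by ext; rfl⟩

/-- Compactness of the cube and periodicity make neighbourhoods uniform in `q`. -/
theorem eventually_forall_of_cube {X : Type*} [TopologicalSpace X] {x₀ : X} {P : X → Vec ℝ d → Prop}
    (hper : ∀ x (k : Fin d → ℤ) q, P x (q + intVec ℝ k) → P x q)
    (hP : ∀ q, ∀ᶠ z : X × Vec ℝ d in 𝓝 (x₀, q), P z.1 z.2) : ∀ᶠ x in 𝓝 x₀, ∀ q, P x q := by
  filter_upwards [isCompact_cube.eventually_forall_of_forall_eventually fun q _ => hP q] with x hx q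
  obtain ⟨k, hk⟩ := exists_add_intVec_mem_cube q
  exact hper x k q (hx _ hk)

theorem eventually_isInvertible (h : IsAnalyticTwist S F g) (hn : 0 < n)
    (h₀ : IsPeriodicPotential (perturb F g ε₀) m n γ₀ w₀) :
    ∀ᶠ x : ℝ × Vec ℝ d in 𝓝 (ε₀, 0), ∀ q,
      (defectDeriv F g m n ((x.1, q), γ₀ q + x.2)).IsInvertible := by
  refine eventually_forall_of_cube (fun x k q hq => ?_) fun q => ?_
  · rwa [h.defectDeriv_periodic, h₀.periodic] at hq
  · have hc : Continuous fun z : (ℝ × Vec ℝ d) × Vec ℝ d =>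
        defectDeriv F g m n ((z.1.1, z.2), γ₀ z.2 + z.1.2) := by
      have h1 := h₀.continuous_γ
      exact (h.continuous_defectDeriv m n).comp (by fun_prop)
    refine (hc.tendsto ((ε₀, 0), q)).eventually ?_
    obtain ⟨e, he⟩ := h.isInvertible_defectDeriv hn h₀ q
    simp only [add_zero]
    rw [← he]
    exact ContinuousLinearEquiv.nhds e

/-- Local uniqueness in the implicit function theorem, expressed through displacements from `γ₀ q`
so that one neighbourhood serves all `q`. -/
theorem eventually_unique (h : IsAnalyticTwist S F g) (hn : 0 < n)
    (h₀ : IsPeriodicPotential (perturb F g ε₀) m n γ₀ w₀) :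
    ∀ᶠ x : ℝ × Vec ℝ d × Vec ℝ d in 𝓝 (ε₀, 0, 0), ∀ q,
      returnDefect F g m n ((x.1, q), γ₀ q + x.2.1) = 0 →
      returnDefect F g m n ((x.1, q), γ₀ q + x.2.2) = 0 → x.2.1 = x.2.2 := by
  refine eventually_forall_of_cube (fun x k q hq => ?_) fun q => ?_
  · rwa [h.returnDefect_periodic, h.returnDefect_periodic, h₀.periodic] at hq
  · have h1 := h₀.continuous_γ
    have hu := (h.contDiff_returnDefect m n).contDiffAt.eventually_apply_eq_iff_implicitFunction
      (by simp) (h.isInvertible_defectDeriv hn h₀ q)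
    have hz : returnDefect F g m n ((ε₀, q), γ₀ q) = 0 := by
      simp [returnDefect, h₀.iterate]
    rw [hz] at hu
    have c1 : Continuous fun z : (ℝ × Vec ℝ d × Vec ℝ d) × Vec ℝ d =>
        (((z.1.1, z.2), γ₀ z.2 + z.1.2.1) : (ℝ × Vec ℝ d) × Vec ℝ d) := by fun_prop
    have c2 : Continuous fun z : (ℝ × Vec ℝ d × Vec ℝ d) × Vec ℝ d =>
        (((z.1.1, z.2), γ₀ z.2 + z.1.2.2) : (ℝ × Vec ℝ d) × Vec ℝ d) := by fun_prop
    have t1 := c1.tendsto ((ε₀, 0, 0), q)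
    have t2 := c2.tendsto ((ε₀, 0, 0), q)
    simp only [add_zero] at t1 t2
    filter_upwards [t1.eventually hu, t2.eventually hu] with z hz1 hz2 e1 e2
    exact add_left_cancel ((hz1.1 e1).symm.trans (hz2.1 e2))

theorem eventually_exists (h : IsAnalyticTwist S F g) (hn : 0 < n)
    (h₀ : IsPeriodicPotential (perturb F g ε₀) m n γ₀ w₀) {ρ : ℝ} (hρ : 0 < ρ) :
    ∀ᶠ ε in 𝓝 ε₀, ∀ q, ∃ p, ‖p - γ₀ q‖ < ρ ∧ returnDefect F g m n ((ε, q), p) = 0 := by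
  refine eventually_forall_of_cube (fun x k q hq => ?_) fun q => ?_
  · obtain ⟨p, hp1, hp2⟩ := hq
    rw [h₀.periodic] at hp1
    rw [h.returnDefect_periodic] at hp2
    exact ⟨p, hp1, hp2⟩
  · have h1 := h₀.continuous_γ
    have hz : returnDefect F g m n ((ε₀, q), γ₀ q) = 0 := by
      simp [returnDefect, h₀.iterate]
    have hc := (h.contDiff_returnDefect m n).contDiffAt (x := ((ε₀, q), γ₀ q))
    have hinv := h.isInvertible_defectDeriv hn h₀ q
    have hu := hc.eventually_apply_implicitFunction (by simp) hinv
    have hs : hc.implicitFunction (by simp) hinv (ε₀, q) = γ₀ q :=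
      hc.implicitFunction_apply_self (by simp) hinv
    have hcont := (hc.contDiffAt_implicitFunction (by simp) hinv).continuousAt
    rw [hz] at hu
    have hnear : ∀ᶠ x : ℝ × Vec ℝ d in 𝓝 (ε₀, q),
        ‖hc.implicitFunction (by simp) hinv x - γ₀ x.2‖ < ρ := by
      have hg : ContinuousAt (fun x : ℝ × Vec ℝ d => γ₀ x.2) (ε₀, q) :=
        (h1.comp continuous_snd).continuousAt
      have := (hcont.sub hg).norm
      refine this.eventually_lt continuousAt_const ?_
      simpa only [Pi.sub_apply, hs, sub_self, norm_zero] using hρ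
    filter_upwards [hu, hnear] with x hx1 hx2
    exact ⟨_, hx2, hx1⟩

/-- Analytic continuation in the parameter of the momentum of a periodic graph. -/
theorem exists_continuation (h : IsAnalyticTwist S F g) (hn : 0 < n)
    (h₀ : IsPeriodicPotential (perturb F g ε₀) m n γ₀ w₀) :
    ∃ δ > 0, ∃ ρ > 0, ∃ p : ℝ → Vec ℝ d → Vec ℝ d,
      ∀ ε ∈ Metric.ball ε₀ δ, ∀ q, returnDefect F g m n ((ε, q), p ε q) = 0 ∧
        (∀ p', ‖p' - γ₀ q‖ < ρ → returnDefect F g m n ((ε, q), p') = 0 → p' = p ε q) ∧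
        (∀ k : Fin d → ℤ, p ε (q + intVec ℝ k) = p ε q) ∧
        ContDiffAt ℝ ω (fun x : ℝ × Vec ℝ d => p x.1 x.2) (ε, q) := by
  obtain ⟨ρ₁, hρ₁, hinv⟩ := Metric.eventually_nhds_iff_ball.1 (h.eventually_isInvertible hn h₀)
  obtain ⟨ρ₂, hρ₂, huniq⟩ := Metric.eventually_nhds_iff_ball.1 (h.eventually_unique hn h₀)
  set ρ := min ρ₁ ρ₂ with hρdef
  have hρ : 0 < ρ := lt_min hρ₁ hρ₂
  obtain ⟨δ₁, hδ₁, hex⟩ := Metric.eventually_nhds_iff_ball.1 (h.eventually_exists hn h₀ hρ)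
  -- The product carries the sup norm, so `δ ≤ ρ` keeps pairs (parameter, displacement) inside the
  -- balls of radii `ρ₁` and `ρ₂`.
  set δ := min ρ δ₁ with hδdef
  have hδ : 0 < δ := lt_min hρ hδ₁
  have hex' : ∀ ε ∈ Metric.ball ε₀ δ, ∀ q, ∃ p, ‖p - γ₀ q‖ < ρ ∧
      returnDefect F g m n ((ε, q), p) = 0 := fun ε hε =>
    hex ε (Metric.ball_subset_ball (min_le_right _ _) hε)
  have hall : ∀ ε q, ∃ p, ε ∈ Metric.ball ε₀ δ → ‖p - γ₀ q‖ < ρ ∧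
      returnDefect F g m n ((ε, q), p) = 0 := by
    intro ε q
    by_cases hε : ε ∈ Metric.ball ε₀ δ
    · obtain ⟨p, hp⟩ := hex' ε hε q
      exact ⟨p, fun _ => hp⟩
    · exact ⟨0, fun h => absurd h hε⟩
  choose p hp using hall
  have hu : ∀ ε ∈ Metric.ball ε₀ δ, ∀ q p', ‖p' - γ₀ q‖ < ρ →
      returnDefect F g m n ((ε, q), p') = 0 → p' = p ε q := by
    intro ε hε q p' h1 h2
    obtain ⟨h3, h4⟩ := hp ε q hε
    rw [Metric.mem_ball, dist_eq_norm] at hε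
    have := huniq (ε, p' - γ₀ q, p ε q - γ₀ q) (by
      rw [Metric.mem_ball, dist_eq_norm]
      simp only [Prod.mk_sub_mk, sub_zero, Prod.norm_mk, max_lt_iff]
      exact ⟨hε.trans_le ((min_le_left _ _).trans (min_le_right _ _)),
        h1.trans_le (min_le_right _ _), h3.trans_le (min_le_right _ _)⟩) q
      (by simpa using h2) (by simpa using h4)
    exact sub_left_injective this
  refine ⟨δ, hδ, ρ, hρ, p, fun ε hε q => ⟨(hp ε q hε).2, hu ε hε q, fun k => ?_, ?_⟩⟩
  · obtain ⟨h3, h4⟩ := hp ε (q + intVec ℝ k) hε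
    rw [h₀.periodic] at h3
    rw [h.returnDefect_periodic] at h4
    exact hu ε hε q _ h3 h4
  · obtain ⟨h3, h4⟩ := hp ε q hε
    have hinv' : (defectDeriv F g m n ((ε, q), p ε q)).IsInvertible := by
      have := hinv (ε, p ε q - γ₀ q) (by
        rw [Metric.mem_ball, dist_eq_norm] at hε ⊢
        simp only [Prod.mk_sub_mk, sub_zero, Prod.norm_mk, max_lt_iff]
        exact ⟨hε.trans_le ((min_le_left _ _).trans (min_le_left _ _)),
          h3.trans_le (min_le_left _ _)⟩) q
      simpa using this
    have hc := (h.contDiff_returnDefect m n).contDiffAt (x := ((ε, q), p ε q))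
    have hsol := hc.eventually_apply_implicitFunction (by simp) hinv'
    have hs : hc.implicitFunction (by simp) hinv' (ε, q) = p ε q :=
      hc.implicitFunction_apply_self (by simp) hinv'
    have hcd := hc.contDiffAt_implicitFunction (by simp) hinv'
    rw [h4] at hsol
    refine hcd.congr_of_eventuallyEq ?_
    have hnear : ∀ᶠ x : ℝ × Vec ℝ d in 𝓝 (ε, q),
        ‖hc.implicitFunction (by simp) hinv' x - γ₀ x.2‖ < ρ := by
      have hg : ContinuousAt (fun x : ℝ × Vec ℝ d => γ₀ x.2) (ε, q) :=
        (h₀.continuous_γ.comp continuous_snd).continuousAt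
      refine (hcd.continuousAt.sub hg).norm.eventually_lt continuousAt_const ?_
      simpa only [Pi.sub_apply, hs] using h3
    have hball : ∀ᶠ x : ℝ × Vec ℝ d in 𝓝 (ε, q), x.1 ∈ Metric.ball ε₀ δ :=
      continuous_fst.continuousAt.eventually (Metric.isOpen_ball.mem_nhds hε)
    filter_upwards [hsol, hnear, hball] with x hx1 hx2 hx3
    exact (hu x.1 hx3 x.2 _ hx2 hx1).symm

/-- The identity theorem on an interval, for an analytic function vanishing at those points of `s`
that are close to `ε₀`. -/
theorem eq_zero_of_eventually_of_frequently {E : Type*} [NormedAddCommGroup E] [NormedSpace ℝ E]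
    {f : ℝ → E} {δ : ℝ} {s : Set ℝ} (hf : ∀ ε ∈ Metric.ball ε₀ δ, ContDiffAt ℝ ω f ε)
    (hev : ∀ᶠ ε in 𝓝 ε₀, ε ∈ s → f ε = 0) (hfr : ∃ᶠ ε in 𝓝[≠] ε₀, ε ∈ s) :
    ∀ ε ∈ Metric.ball ε₀ δ, f ε = 0 := by
  intro ε hε
  have hδ : 0 < δ := Metric.nonempty_ball.1 ⟨ε, hε⟩
  have han : AnalyticOnNhd ℝ f (Metric.ball ε₀ δ) := fun ε hε => (hf ε hε).analyticAt
  refine han.eqOn_zero_of_preconnected_of_frequently_eq_zero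
    (convex_ball ε₀ δ).isPreconnected (Metric.mem_ball_self hδ) ?_ hε
  exact (hfr.and_eventually (hev.filter_mono nhdsWithin_le_nhds)).mono fun x hx => hx.2 hx.1

theorem hasFDerivAt_slice {p : ℝ → Vec ℝ d → Vec ℝ d} {ε : ℝ} {q : Vec ℝ d}
    (hp : DifferentiableAt ℝ (fun x : ℝ × Vec ℝ d => p x.1 x.2) (ε, q)) :
    HasFDerivAt (p ε) (fderiv ℝ (fun x : ℝ × Vec ℝ d => p x.1 x.2) (ε, q) ∘L
      .inr ℝ ℝ (Vec ℝ d)) q :=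
  hp.hasFDerivAt.comp q (hasFDerivAt_prodMk_right ε q)

/-- Accumulation points of the set of parameters are interior. -/
theorem parameters_mem_nhds (h : IsAnalyticTwist S F g) (hn : 0 < n)
    (hmem : ε₀ ∈ parameters F g m n) (hacc : ∃ᶠ ε in 𝓝[≠] ε₀, ε ∈ parameters F g m n) :
    parameters F g m n ∈ 𝓝 ε₀ := by
  obtain ⟨γ₀, w₀, -, h₀⟩ := hasLagrangianPeriodicGraph_iff.1 hmem
  obtain ⟨δ, hδ, ρ, hρ, p, hp⟩ := h.exists_continuation hn h₀
  -- The neighbourhood of `ε₀` may shrink with `q`; this is harmless, since the identity theorem is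
  -- applied for each `q` separately on the same interval of radius `δ`.
  have hagree : ∀ q, ∀ᶠ ε in 𝓝 ε₀, ∀ γ w, IsPeriodicPotential (perturb F g ε) m n γ w →
      ∀ᶠ q' in 𝓝 q, p ε q' = γ q' := by
    intro q
    filter_upwards [h.eventually_graph_near hn h₀ q hρ, Metric.ball_mem_nhds ε₀ hδ]
      with ε hε hball γ w hw
    have hc : Continuous fun q' => ‖γ q' - γ₀ q'‖ :=
      (hw.continuous_γ.sub h₀.continuous_γ).norm
    filter_upwards [hc.continuousAt.eventually_lt continuousAt_const (hε γ w hw)] with q' hq'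
    refine ((hp ε hball q').2.1 _ hq' ?_).symm
    simp [returnDefect, hw.iterate]
  have hcd : ∀ ε ∈ Metric.ball ε₀ δ, ∀ q,
      ContDiffAt ℝ ω (fun x : ℝ × Vec ℝ d => p x.1 x.2) (ε, q) := fun ε hε q => (hp ε hε q).2.2.2
  have hcdε : ∀ ε ∈ Metric.ball ε₀ δ, ∀ q, ContDiffAt ℝ ω (fun ε => p ε q) ε := fun ε hε q =>
    (hcd ε hε q).comp ε (contDiffAt_id.prodMk contDiffAt_const)
  have hcdq : ∀ ε ∈ Metric.ball ε₀ δ, ContDiff ℝ ω (p ε) := fun ε hε =>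
    contDiff_iff_contDiffAt.2 fun q => (hcd ε hε q).comp q (contDiffAt_const.prodMk contDiffAt_id)
  have hret : ∀ q, ∀ ε ∈ Metric.ball ε₀ δ, ((perturb F g ε)^[n] (q, p ε q)).2 - p ε q = 0 := by
    intro q
    refine eq_zero_of_eventually_of_frequently (fun ε hε => ?_) ?_ hacc
    · have h1 := (h.contDiff_perturb_iterate n).contDiffAt.comp ε (f := fun ε =>
        ((ε, (q, p ε q)) : ℝ × Phase ℝ d)) (contDiffAt_id.prodMk (contDiffAt_const.prodMk (hcdε ε hε q)))
      exact h1.snd.sub (hcdε ε hε q)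
    · filter_upwards [hagree q] with ε hε hmem
      obtain ⟨γ, w, -, hw⟩ := hasLagrangianPeriodicGraph_iff.1 hmem
      rw [(hε γ w hw).self_of_nhds, hw.iterate, sub_self]
  -- At a parameter near `ε₀`, `p ε` coincides near `q` with the gradient of a potential, so its
  -- derivative is symmetric; analyticity in ε spreads this over the interval.
  have hsymm : ∀ q u v, ∀ ε ∈ Metric.ball ε₀ δ,
      inner ℝ (fderiv ℝ (fun x : ℝ × Vec ℝ d => p x.1 x.2) (ε, q) (0, u)) v -
        inner ℝ (fderiv ℝ (fun x : ℝ × Vec ℝ d => p x.1 x.2) (ε, q) (0, v)) u = 0 := by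
    intro q u v
    refine eq_zero_of_eventually_of_frequently (fun ε hε => ?_) ?_ hacc
    · have h1 : ContDiffAt ℝ ω (fun ε => fderiv ℝ (fun x : ℝ × Vec ℝ d => p x.1 x.2) (ε, q)) ε :=
        ((hcd ε hε q).fderiv_right (m := ω) le_top).comp ε (contDiffAt_id.prodMk contDiffAt_const)
      exact ((h1.clm_apply contDiffAt_const).inner ℝ contDiffAt_const).sub
        ((h1.clm_apply contDiffAt_const).inner ℝ contDiffAt_const)
    · filter_upwards [hagree q, Metric.ball_mem_nhds ε₀ hδ] with ε hε hball hmem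
      obtain ⟨γ, w, -, hw⟩ := hasLagrangianPeriodicGraph_iff.1 hmem
      have hd := hasFDerivAt_slice ((hcd ε hball q).differentiableAt (by simp))
      have hd' := hd.congr_of_eventuallyEq ((hε γ w hw).mono fun _ h => h.symm)
      have := second_derivative_symmetric (𝕜 := ℝ) (f := w) (f' := fun x => innerSL ℝ (γ x))
        (x := q) hw.hasFDerivAt ((innerSL ℝ).hasFDerivAt.comp q hd') u v
      rw [sub_eq_zero]
      exact this
  refine Filter.mem_of_superset (Metric.ball_mem_nhds ε₀ hδ) fun ε hε => ?_
  have hpc := hcdq ε hε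
  have hpd : Differentiable ℝ (p ε) := hpc.differentiable (by simp)
  have hΩ : DifferentiableOn ℝ (fun x => innerSL ℝ (p ε x)) Set.univ := fun x _ =>
    ((innerSL ℝ).differentiableAt.comp x (hpd x)).differentiableWithinAt
  obtain ⟨w, hw⟩ := convex_univ.exists_forall_hasFDerivAt_of_fderiv_symmetric isOpen_univ hΩ
    (fun q _ u v => by
      have hd := hasFDerivAt_slice ((hcd ε hε q).differentiableAt (by simp))
      have h1 := ((innerSL ℝ).hasFDerivAt.comp q hd).fderiv
      have h2 := hsymm q u v ε hε
      have h3 : fderiv ℝ (fun x => innerSL ℝ (p ε x)) q = _ := h1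
      rw [h3]
      exact sub_eq_zero.1 h2)
  obtain ⟨K, hK0, hK⟩ := exists_bound_of_periodic (hpc.continuous_fderiv (by simp))
    fun k => fderiv_add_of_periodic fun x => (hp ε hε x).2.2.1 k
  refine hasLagrangianPeriodicGraph_iff.2 ⟨p ε, fun q => w q - w 0, by simp,
    IsPeriodicPotential.sub_const ⟨⟨K.toNNReal, ?_⟩, fun k q => (hp ε hε q).2.2.1 k,
      fun q => hw q (Set.mem_univ q), fun q => ?_⟩ _⟩
  · refine lipschitzWith_of_nnnorm_fderiv_le hpd fun q => ?_
    rw [← NNReal.coe_le_coe, coe_nnnorm, Real.coe_toNNReal _ hK0]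
    exact hK q
  · refine Prod.ext ?_ (sub_eq_zero.1 (hret q ε hε))
    have := (hp ε hε q).1
    simp only [returnDefect] at this
    rw [sub_sub, sub_eq_zero] at this
    exact this

theorem parameters_eq_univ_or_isolated (h : IsAnalyticTwist S F g) (hn : 0 < n) :
    parameters F g m n = Set.univ ∨ ∀ ε ∈ parameters F g m n, ∃ δ : ℝ, 0 < δ ∧
      ∀ ε' ∈ parameters F g m n, |ε' - ε| < δ → ε' = ε := by
  by_cases hex : ∃ ε₀ ∈ parameters F g m n, ∃ᶠ ε in 𝓝[≠] ε₀, ε ∈ parameters F g m n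
  · left
    obtain ⟨ε₀, hmem, hacc⟩ := hex
    -- A limit of interior points is a parameter by closedness; were it not interior itself, the
    -- approximating points would differ from it and make it an accumulation point, hence interior.
    have hcl : IsClosed (interior (parameters F g m n)) := by
      refine isClosed_of_closure_subset fun ε hε => ?_
      have hε' : ε ∈ parameters F g m n :=
        (h.isClosed_parameters hn).closure_subset (closure_mono interior_subset hε)
      by_contra hcon
      refine hcon (mem_interior_iff_mem_nhds.2 (h.parameters_mem_nhds hn hε' ?_))
      have h1 := mem_closure_iff_frequently.1 hε
      refine Filter.frequently_iff.2 fun {U} hU => ?_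
      obtain ⟨x, hx, hx2⟩ := Filter.frequently_iff.1 h1 (mem_nhdsWithin_iff_eventually.1 hU)
      exact ⟨x, hx fun he => hcon (he ▸ hx2), interior_subset hx2⟩
    have huniv := IsClopen.eq_univ ⟨hcl, isOpen_interior⟩
      ⟨ε₀, mem_interior_iff_mem_nhds.2 (h.parameters_mem_nhds hn hmem hacc)⟩
    exact Set.eq_univ_of_univ_subset (huniv ▸ interior_subset)
  · right
    intro ε hε
    push Not at hex
    have h1 := hex ε hε
    rw [eventually_nhdsWithin_iff, Metric.eventually_nhds_iff] at h1
    obtain ⟨δ, hδ, h2⟩ := h1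
    exact ⟨δ, hδ, fun ε' hε' hd => by_contra fun hne => h2 hd hne hε'⟩

theorem finite_parameters (h : IsAnalyticTwist S F g) (hn : 0 < n) {C : ℝ}
    (h₁ : ∀ q Q δ, S (q + δ, Q) + S (q - δ, Q) - 2 * S (q, Q) ≤ C * ‖δ‖ ^ 2)
    (h₂ : ∀ q Q δ, S (q, Q + δ) + S (q, Q - δ) - 2 * S (q, Q) ≤ C * ‖δ‖ ^ 2)
    (hg : ¬ ∃ c, ∀ q, g q = c) : (parameters F g m n).Finite := by
  obtain ⟨R, hR⟩ := h.exists_bound_parameters (m := m) hn h₁ h₂ hg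
  have hc : IsCompact (parameters F g m n) := by
    have := h.isCompact_parameters_inter (m := m) hn R
    rwa [Set.inter_eq_left.2 hR] at this
  rcases h.parameters_eq_univ_or_isolated (m := m) hn with hu | hi
  · exact absurd (hu ▸ hc) (noncompact_univ ℝ)
  · refine hc.finite (isDiscrete_iff_forall_mem_exists_isOpen.2 fun ε hε => ?_)
    obtain ⟨δ, hδ, h1⟩ := hi ε hε
    refine ⟨Metric.ball ε δ, Metric.isOpen_ball, ?_⟩
    ext x
    constructor
    · rintro ⟨hx, hx2⟩
      exact h1 x hx2 (by rwa [Metric.mem_ball, Real.dist_eq] at hx)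
    · rintro rfl
      exact ⟨Metric.mem_ball_self hδ, hε⟩

end IsAnalyticTwist

end TwistMap

namespace TwistMap

open scoped ContDiff Topology

variable {d : ℕ}

/-! ### Lifts differ by integer translations. -/

section Lifts

/-- A continuous integer-valued function on a connected space is constant. -/
theorem exists_int_of_continuous {X : Type*} [TopologicalSpace X] [PreconnectedSpace X] [Nonempty X]
    {f : X → ℝ} (hf : Continuous f) (hint : ∀ x, ∃ k : ℤ, f x = k) : ∃ k : ℤ, ∀ x, f x = k := by
  choose κ hκ using hint
  have hc : Continuous κ := by
    rw [Int.isClosedEmbedding_coe_real.isInducing.continuous_iff]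
    exact hf.congr hκ
  obtain ⟨x₀⟩ := ‹Nonempty X›
  exact ⟨κ x₀, fun x => by rw [hκ, PreconnectedSpace.constant ‹_› hc]⟩

theorem exists_intVec_of_continuous {X : Type*} [TopologicalSpace X] [PreconnectedSpace X]
    [Nonempty X] {f : X → Vec ℝ d} (hf : Continuous f)
    (hint : ∀ x, ∃ k : Fin d → ℤ, f x = intVec ℝ k) : ∃ k : Fin d → ℤ, ∀ x, f x = intVec ℝ k := by
  have h : ∀ i, ∃ k : ℤ, ∀ x, f x i = k := fun i =>
    exists_int_of_continuous (by fun_prop) fun x => by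
      obtain ⟨k, hk⟩ := hint x
      exact ⟨k i, by rw [hk]; rfl⟩
  choose k hk using h
  exact ⟨k, fun x => by ext i; exact hk i x⟩

theorem exists_intVec_of_toTorus_eq {q q' : Vec ℝ d} (h : toTorus q = toTorus q') :
    ∃ k : Fin d → ℤ, q - q' = intVec ℝ k := by
  have h1 : ∀ i, ∃ k : ℤ, q i - q' i = k := by
    intro i
    have h2 : ((q i : ℝ) : UnitAddCircle) = (q' i : ℝ) := congrFun h i
    rw [← sub_eq_zero, ← AddCircle.coe_sub, AddCircle.coe_eq_zero_iff] at h2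
    obtain ⟨k, hk⟩ := h2
    exact ⟨k, by simpa using hk.symm⟩
  choose k hk using h1
  exact ⟨k, by ext i; exact hk i⟩

theorem toTorus_add_intVec (q : Vec ℝ d) (k : Fin d → ℤ) : toTorus (q + intVec ℝ k) = toTorus q := by
  funext i
  simp only [toTorus, intVec, PiLp.add_apply, AddCircle.coe_add]
  simp only [add_eq_left]
  exact AddCircle.coe_eq_zero_iff _ |>.2 ⟨k i, by simp⟩

/-- Two lifts of the same map differ by an integer translation. -/
theorem IsLift.exists_translation {f : Annulus d → Annulus d} {F F' : Phase ℝ d → Phase ℝ d}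
    (h : IsLift F f) (h' : IsLift F' f) :
    ∃ k : Fin d → ℤ, ∀ x, F' x = F x + (intVec ℝ k, 0) := by
  have heq : ∀ x, toAnnulus (F' x) = toAnnulus (F x) := fun x => (h'.2 x).trans (h.2 x).symm
  obtain ⟨k, hk⟩ := exists_intVec_of_continuous (f := fun x => (F' x).1 - (F x).1)
    (h'.1.fst.sub h.1.fst) fun x => exists_intVec_of_toTorus_eq (congrArg Prod.fst (heq x))
  refine ⟨k, fun x => Prod.ext ?_ ?_⟩
  · simp [← hk x]
  · rw [Prod.snd_add, add_zero]
    exact congrArg (fun y : Annulus d => y.2) (heq x)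

end Lifts

/-! ### Generating functions of different lifts; second differences. -/

section Generating

variable {F : Phase ℝ d → Phase ℝ d} {S : Phase ℝ d → ℝ}

theorem TwistCondition.surj (h : TwistCondition ℝ F) (q Q : Vec ℝ d) : ∃ p, (F (q, p)).1 = Q := by
  obtain ⟨-, H, -, hr, -⟩ := h
  have h1 := hr (q, Q)
  have h2 : (H (q, Q)).1 = q := congrArg Prod.fst h1
  have h3 : (F (H (q, Q))).1 = Q := congrArg Prod.snd h1
  have h4 : (q, (H (q, Q)).2) = H (q, Q) := Prod.ext h2.symm rfl
  exact ⟨(H (q, Q)).2, by rw [h4]; exact h3⟩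

theorem IsGeneratingFunction.fderiv_eq (h : IsGeneratingFunction ℝ F S) (q p u v : Vec ℝ d) :
    fderiv ℝ S (q, (F (q, p)).1) (u, v) = inner ℝ (F (q, p)).2 v - inner ℝ p u := by
  rw [(h.2 q p).2]
  simp [PiLp.inner_apply, mul_comm]

theorem IsGeneratingFunction.differentiable (h : IsGeneratingFunction ℝ F S)
    (hs : ∀ q Q, ∃ p, (F (q, p)).1 = Q) : Differentiable ℝ S := by
  rintro ⟨q, Q⟩
  obtain ⟨p, rfl⟩ := hs q Q
  exact (h.2 q p).1

/-- After translating `Q` the two functions have the same differential, since it is determined by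
the map. This lets bounded rate pass from one generating function to another. -/
theorem IsGeneratingFunction.apply_eq_add_const {F' : Phase ℝ d → Phase ℝ d} {S' : Phase ℝ d → ℝ}
    (h : IsGeneratingFunction ℝ F S) (h' : IsGeneratingFunction ℝ F' S')
    (hs : ∀ q Q, ∃ p, (F (q, p)).1 = Q) {a : Vec ℝ d} (ha : ∀ x, F' x = F x + (a, 0)) :
    ∃ c, ∀ x, S x = S' (x + (0, a)) + c := by
  have hs' : ∀ q Q, ∃ p, (F' (q, p)).1 = Q := fun q Q => by
    obtain ⟨p, hp⟩ := hs q (Q - a)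
    exact ⟨p, by simp [ha, hp]⟩
  have hd := h.differentiable hs
  have hd' := h'.differentiable hs'
  have hdc : Differentiable ℝ fun x => S' (x + (0, a)) :=
    hd'.comp (differentiable_id.add_const _)
  have hzero : ∀ x, fderiv ℝ (fun x => S x - S' (x + (0, a))) x = 0 := by
    rintro ⟨q, Q⟩
    obtain ⟨p, rfl⟩ := hs q Q
    rw [fderiv_fun_sub (hd _) (hdc _), fderiv_comp_add_right]
    ext1
    · ext u
      have e1 := h.fderiv_eq q p u 0
      have e2 := h'.fderiv_eq q p u 0
      rw [ha] at e2
      simp at e1 e2 ⊢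
      rw [e1, e2, sub_self]
    · ext u
      have e1 := h.fderiv_eq q p 0 u
      have e2 := h'.fderiv_eq q p 0 u
      rw [ha] at e2
      simp at e1 e2 ⊢
      rw [e1, e2, sub_self]
  refine ⟨S 0 - S' (0 + (0, a)), fun x => ?_⟩
  have := is_const_of_fderiv_eq_zero (𝕜 := ℝ) (hd.sub hdc) hzero x 0
  simp only [Pi.sub_apply] at this
  linarith

/-- With `l` the derivative along ξ, `l t - l (-t) ≤ 2Kt`, so `K t²` minus the symmetric sum is
monotone for `t ≥ 0`; compare `t = 0` with `t = 1`. -/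
theorem second_difference_le {T : Phase ℝ d → ℝ} (hT : ContDiff ℝ 2 T) {ξ : Phase ℝ d} {K : ℝ}
    (hK : ∀ x, hess T x ξ ξ ≤ K) (x : Phase ℝ d) : T (x + ξ) + T (x - ξ) - 2 * T x ≤ K := by
  have hd : ∀ x, HasFDerivAt T (fderiv ℝ T x) x := fun x =>
    (hT.differentiable two_ne_zero x).hasFDerivAt
  have hd2 : ∀ x, HasFDerivAt (fderiv ℝ T) (fderiv ℝ (fderiv ℝ T) x) x := fun x =>
    ((hT.fderiv_right (m := 1) (by norm_num)).differentiable one_ne_zero x).hasFDerivAt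
  have hline : ∀ (ζ : Phase ℝ d) (t : ℝ), HasDerivAt (fun t : ℝ => x + t • ζ) ζ t := fun ζ t => by
    simpa using ((hasDerivAt_id t).smul_const ζ).const_add x
  set l : ℝ → ℝ := fun s => fderiv ℝ T (x + s • ξ) ξ with hl
  have hld : ∀ s, HasDerivAt l (hess T (x + s • ξ) ξ ξ) s := fun s => by
    have e1 := (hd2 (x + s • ξ)).comp_hasDerivAt s (hline ξ s)
    have e2 := e1.clm_apply (hasDerivAt_const s ξ)
    rw [map_zero, add_zero] at e2
    exact e2
  have h1 : ∀ t, 0 ≤ t → l t - l (-t) ≤ K * (2 * t) := by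
    intro t ht
    have := (convex_univ (𝕜 := ℝ) (E := ℝ)).image_sub_le_mul_sub_of_deriv_le (f := l)
      (fun s _ => (hld s).continuousAt.continuousWithinAt)
      (fun s _ => (hld s).differentiableAt.differentiableWithinAt)
      (C := K) (fun s _ => by rw [(hld s).deriv]; exact hK _) (-t)
      (Set.mem_univ _) t (Set.mem_univ _) (by linarith)
    linarith
  set k : ℝ → ℝ := fun t => K * t ^ 2 - (T (x + t • ξ) + T (x + t • (-ξ))) with hk
  have hkd : ∀ t, HasDerivAt k (K * (2 * t) - (l t + fderiv ℝ T (x + t • (-ξ)) (-ξ))) t := by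
    intro t
    refine HasDerivAt.sub ?_ (((hd _).comp_hasDerivAt t (hline ξ t)).add
      ((hd _).comp_hasDerivAt t (hline (-ξ) t)))
    simpa using (hasDerivAt_pow 2 t).const_mul K
  have hmono : MonotoneOn k (Set.Ici 0) := by
    refine monotoneOn_of_deriv_nonneg (convex_Ici 0)
      (fun t _ => (hkd t).continuousAt.continuousWithinAt)
      (fun t _ => (hkd t).differentiableAt.differentiableWithinAt) (fun t ht => ?_)
    rw [interior_Ici] at ht
    rw [(hkd t).deriv]
    have h2 := h1 t (le_of_lt ht)
    have h3 : l (-t) = fderiv ℝ T (x + t • (-ξ)) ξ := by simp [hl]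
    rw [map_neg, ← h3]
    linarith
  have h2 := hmono (Set.mem_Ici.2 le_rfl) (Set.mem_Ici.2 zero_le_one) zero_le_one
  simp only [hk, zero_smul, add_zero, one_smul, ← sub_eq_add_neg] at h2
  norm_num at h2
  linarith

end Generating

/-! ### Real analyticity from holomorphic extensions. -/

section Complexification

/-- The inclusion `ℝ^d ⊆ ℂ^d` as a real-linear map. -/
noncomputable def complexifyCLM (d : ℕ) : Vec ℝ d →L[ℝ] Vec ℂ d :=
  LinearMap.toContinuousLinearMap
    { toFun := complexify
      map_add' := fun x y => by ext i; simp [complexify]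
      map_smul' := fun c x => by ext i; simp [complexify] }

/-- The coordinatewise real part `ℂ^d → ℝ^d`. -/
noncomputable def rePartCLM (d : ℕ) : Vec ℂ d →L[ℝ] Vec ℝ d :=
  LinearMap.toContinuousLinearMap
    { toFun := fun z => WithLp.toLp 2 fun i => (z i).re
      map_add' := fun x y => by ext i; simp
      map_smul' := fun c x => by ext i; simp }

theorem rePartCLM_complexify (q : Vec ℝ d) : rePartCLM d (complexify q) = q := by
  ext i
  simp [rePartCLM, complexify]

theorem contDiff_of_complex {X Y : Type} [NormedAddCommGroup X] [NormedSpace ℂ X]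
    [NormedSpace ℝ X] [IsScalarTower ℝ ℂ X]
    [FiniteDimensional ℂ X] [NormedAddCommGroup Y] [NormedSpace ℂ Y] [NormedSpace ℝ Y]
    [IsScalarTower ℝ ℂ Y] [CompleteSpace Y]
    {A : X → Y} (hA : Differentiable ℂ A) : ContDiff ℝ ω A :=
  ContDiff.restrict_scalars ℝ
    (contDiff_iff_contDiffAt.2 fun x => (analyticAt_of_differentiable hA x).contDiffAt)

theorem contDiff_of_holomorphic_extension {g : Vec ℝ d → ℝ} {gc : Vec ℂ d → ℂ}
    (hgc : Differentiable ℂ gc) (h : ∀ q, gc (complexify q) = (g q : ℂ)) : ContDiff ℝ ω g := by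
  have h1 : ContDiff ℝ ω gc := contDiff_of_complex hgc
  have h2 : g = fun q => Complex.reCLM (gc (complexifyCLM d q)) := by
    funext q
    have : complexifyCLM d q = complexify q := rfl
    rw [this, h]
    simp
  rw [h2]
  exact Complex.reCLM.contDiff.comp (h1.comp (complexifyCLM d).contDiff)

/-- The inclusion of the real phase space in the complex one. -/
noncomputable def complexifyPhase (d : ℕ) : Phase ℝ d →L[ℝ] Phase ℂ d :=
  (complexifyCLM d).prodMap (complexifyCLM d)

/-- `F` is the real part of the entire map `A` on real points, hence real-analytic. Differentiating
`H ∘ A = id` on real points gives the derivative of `F` a left inverse. -/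
theorem contDiff_and_fderiv_inj_of_holomorphic_extension {F : Phase ℝ d → Phase ℝ d}
    {A : Phase ℂ d → Phase ℂ d} (hA : IsDiffeo ℂ A)
    (h : ∀ q p : Vec ℝ d, A (complexify q, complexify p) =
      (complexify (F (q, p)).1, complexify (F (q, p)).2)) :
    ContDiff ℝ ω F ∧ ∀ x ξ, fderiv ℝ F x ξ = 0 → ξ = 0 := by
  obtain ⟨hA1, H, hl, -, hH1⟩ := hA
  have hAd : Differentiable ℂ A := hA1.differentiable one_ne_zero
  have hHd : Differentiable ℂ H := hH1.differentiable one_ne_zero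
  have hA2 : ContDiff ℝ ω A := contDiff_of_complex hAd
  have hH2 : ContDiff ℝ ω H := contDiff_of_complex hHd
  have hre : ∀ x, (rePartCLM d).prodMap (rePartCLM d) (complexifyPhase d x) = x := fun x =>
    Prod.ext (rePartCLM_complexify x.1) (rePartCLM_complexify x.2)
  have hcom : ∀ x, A (complexifyPhase d x) = complexifyPhase d (F x) := fun x => h x.1 x.2
  have hF : F = fun x => (rePartCLM d).prodMap (rePartCLM d) (A (complexifyPhase d x)) := by
    funext x
    rw [hcom, hre]
  have hFc : ContDiff ℝ ω F := by
    rw [hF]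
    exact ContinuousLinearMap.contDiff _ |>.comp (hA2.comp (complexifyPhase d).contDiff)
  refine ⟨hFc, fun x ξ hξ => ?_⟩
  have hHc : ∀ x, H (complexifyPhase d (F x)) = complexifyPhase d x := fun x => by
    rw [← hcom, hl]
  have h1 := ((hH2.differentiable (by simp) (complexifyPhase d (F x))).hasFDerivAt.comp x
    ((complexifyPhase d).hasFDerivAt.comp x (hFc.differentiable (by simp) x).hasFDerivAt))
  have h2 : HasFDerivAt (fun x => H (complexifyPhase d (F x))) (complexifyPhase d) x := by
    simp only [hHc]
    exact (complexifyPhase d).hasFDerivAt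
  have h3 := congrArg (fun L => L ξ) (h1.unique h2)
  simp only [ContinuousLinearMap.comp_apply, hξ, map_zero] at h3
  rw [← hre ξ, ← h3, map_zero]

end Complexification

/-! ### Reduction of the theorem to an analytic coercive twist. -/

section Reduction

theorem IsSymplecticTwistMap.lift_periodic_and_surj {f : Annulus d → Annulus d}
    (hf : IsSymplecticTwistMap f) {F : Phase ℝ d → Phase ℝ d} (hF : IsLift F f) :
    (∀ (k : Fin d → ℤ) q p, F (q + intVec ℝ k, p) = F (q, p) + (intVec ℝ k, 0)) ∧
      ∀ q Q, ∃ p, (F (q, p)).1 = Q := by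
  obtain ⟨-, F₁, hF₁, hper, htw, -⟩ := hf
  obtain ⟨a, ha⟩ := hF₁.exists_translation hF
  refine ⟨fun k q p => by rw [ha, ha, hper]; abel, fun q Q => ?_⟩
  obtain ⟨p, hp⟩ := htw.surj q (Q - intVec ℝ a)
  exact ⟨p, by simp [ha, hp]⟩

theorem IsLift.add_intVec {f : Annulus d → Annulus d} {F : Phase ℝ d → Phase ℝ d}
    (hF : IsLift F f) (k : Fin d → ℤ) : IsLift (fun x => F x + (intVec ℝ k, 0)) f := by
  refine ⟨hF.1.add continuous_const, fun x => ?_⟩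
  rw [← hF.2 x]
  exact Prod.ext (toTorus_add_intVec _ _) (add_zero _)

theorem IsGeneratingFunction.translate {F : Phase ℝ d → Phase ℝ d} {S : Phase ℝ d → ℝ}
    (h : IsGeneratingFunction ℝ F S) (a : Vec ℝ d) :
    IsGeneratingFunction ℝ (fun x => F x + (a, 0)) fun x => S (x + (0, -a)) := by
  have hx : ∀ q p : Vec ℝ d, ((q, (F (q, p) + (a, 0)).1) + (0, -a) : Phase ℝ d) =
      (q, (F (q, p)).1) := fun q p => by simp
  refine ⟨fun k q Q => ?_, fun q p => ⟨?_, fun u v => ?_⟩⟩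
  · simp only [Prod.mk_add_mk, add_zero]
    rw [add_right_comm, h.1]
  · rw [differentiableAt_comp_add_right, hx]
    exact (h.2 q p).1
  · rw [fderiv_comp_add_right, hx, (h.2 q p).2]
    simp

/-- Adding `ε g(q)` to the generating function precomposes the map with a vertical shear. -/
theorem IsGeneratingFunction.eq_perturb {F F' : Phase ℝ d → Phase ℝ d} {S : Phase ℝ d → ℝ}
    {g : Vec ℝ d → ℝ} {ε : ℝ} (h : IsGeneratingFunction ℝ F S)
    (hs : ∀ q Q, ∃ p, (F (q, p)).1 = Q) (hg : Differentiable ℝ g)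
    (h' : IsGeneratingFunction ℝ F' fun x => S x + ε * g x.1) : F' = perturb F g ε := by
  funext ⟨q, p⟩
  obtain ⟨p₀, hp₀⟩ := hs q (F' (q, p)).1
  have key : ∀ u v : Vec ℝ d, inner ℝ (F (q, p₀)).2 v - inner ℝ p₀ u +
      ε * inner ℝ (gradient g q) u = inner ℝ (F' (q, p)).2 v - inner ℝ p u := by
    intro u v
    rw [← h'.fderiv_eq q p u v, ← h.fderiv_eq q p₀ u v, IsAnalyticTwist.inner_gradient, hp₀]
    have e1 := (h.differentiable hs (q, (F' (q, p)).1)).hasFDerivAt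
    have e2 : HasFDerivAt (fun x : Phase ℝ d => g x.1) _ (q, (F' (q, p)).1) :=
      (hg q).hasFDerivAt.comp (q, (F' (q, p)).1) hasFDerivAt_fst
    have e3 : HasFDerivAt (fun x : Phase ℝ d => S x + ε * g x.1) _ (q, (F' (q, p)).1) :=
      e1.add (e2.const_mul ε)
    rw [e3.fderiv]
    simp
  have hp : p₀ = p + ε • gradient g q := by
    refine ext_inner_right ℝ fun u => ?_
    have := key u 0
    simp only [inner_zero_right] at this
    rw [inner_add_left, real_inner_smul_left]
    linarith
  have hP : (F (q, p₀)).2 = (F' (q, p)).2 := by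
    refine ext_inner_right ℝ fun v => ?_
    have := key 0 v
    simpa using this
  rw [perturb, ← hp]
  exact Prod.ext hp₀.symm hP.symm

/-- Strong positivity and analyticity may refer to different lifts; integer translations carry both
to the given lift without changing the relevant derivatives. -/
theorem exists_isAnalyticTwist {f : Annulus d → Annulus d} (hf : IsSymplecticTwistMap f)
    (hpos : IsStronglyPositive f) (hana : HasAnalyticityProperty f)
    {F : Phase ℝ d → Phase ℝ d} (hF : IsLift F f) {g : Vec ℝ d → ℝ} (hg : ContDiff ℝ ω g)
    (hgper : ∀ (k : Fin d → ℤ) q, g (q + intVec ℝ k) = g q) :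
    ∃ S, IsGeneratingFunction ℝ F S ∧ IsAnalyticTwist S F g := by
  obtain ⟨hper, hsurj⟩ := hf.lift_periodic_and_surj hF
  obtain ⟨S, ⟨F₁, hF₁, hgen⟩, hS, α, β, hα, -, hS'⟩ := hpos
  obtain ⟨a, ha⟩ := hF₁.exists_translation hF
  obtain ⟨A, hA, ⟨F₂, hF₂, hext⟩, -⟩ := hana
  obtain ⟨b, hb⟩ := hF₂.exists_translation hF
  obtain ⟨hω, hinj⟩ := contDiff_and_fderiv_inj_of_holomorphic_extension hA hext
  have hFa : F = fun x => F₁ x + (intVec ℝ a, 0) := funext ha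
  have hFb : F = fun x => F₂ x + (intVec ℝ b, 0) := funext hb
  have hgen' := hgen.translate (intVec ℝ a)
  rw [← hFa] at hgen'
  have hc : ContDiff ℝ 2 fun x => S (x + (0, -intVec ℝ a)) :=
    hS.comp (contDiff_id.add contDiff_const)
  have hSper : ∀ (k : Fin d → ℤ) (x : Phase ℝ d),
      S (x + (intVec ℝ k, intVec ℝ k) + (0, -intVec ℝ a)) = S (x + (0, -intVec ℝ a)) :=
    fun k x => hgen'.1 k x.1 x.2
  refine ⟨_, hgen', hc, hSper, ?_, ?_, hper, hgen'.fderiv_eq, hsurj,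
    exists_coercive hc hSper hα fun q Q v => ?_, hg, hgper⟩
  · rw [hFb]
    exact hω.add contDiff_const
  · intro x ξ h
    rw [hFb, fderiv_add_const] at h
    exact hinj x ξ h
  · have h1 : fderiv ℝ (fun x => S (x + (0, -intVec ℝ a))) =
        fun x => fderiv ℝ S (x + (0, -intVec ℝ a)) :=
      funext fun x => fderiv_comp_add_right _
    rw [hess, h1, fderiv_comp_add_right]
    exact (hS' _ _ _).2

theorem HasBoundedRate.second_difference_le {f : Annulus d → Annulus d} (h : HasBoundedRate f)
    {F : Phase ℝ d → Phase ℝ d} (hF : IsLift F f) {S : Phase ℝ d → ℝ}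
    (hS : IsGeneratingFunction ℝ F S) (hs : ∀ q Q, ∃ p, (F (q, p)).1 = Q) :
    ∃ C : ℝ, (∀ q Q δ, S (q + δ, Q) + S (q - δ, Q) - 2 * S (q, Q) ≤ C * ‖δ‖ ^ 2) ∧
      ∀ q Q δ, S (q, Q + δ) + S (q, Q - δ) - 2 * S (q, Q) ≤ C * ‖δ‖ ^ 2 := by
  obtain ⟨T, ⟨F₁, hF₁, hT⟩, hT2, C, hC⟩ := h
  obtain ⟨a, ha⟩ := hF.exists_translation hF₁
  obtain ⟨c, hc⟩ := hS.apply_eq_add_const hT hs ha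
  refine ⟨C, fun q Q δ => ?_, fun q Q δ => ?_⟩
  · have h1 := TwistMap.second_difference_le hT2 (ξ := (δ, 0)) (K := C * ‖δ‖ ^ 2)
      (fun x => by
        have := (le_abs_self _).trans (hC x.1 x.2 δ δ).1
        rwa [mul_assoc, ← sq] at this) (q, Q + intVec ℝ a)
    simp only [hc, Prod.mk_add_mk, Prod.mk_sub_mk, add_zero, sub_zero] at h1 ⊢
    linarith
  · have h1 := TwistMap.second_difference_le hT2 (ξ := (0, δ)) (K := C * ‖δ‖ ^ 2)
      (fun x => by
        have := (le_abs_self _).trans (hC x.1 x.2 δ δ).2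
        rwa [mul_assoc, ← sq] at this) (q, Q + intVec ℝ a)
    simp only [hc, Prod.mk_add_mk, Prod.mk_sub_mk, add_zero, sub_zero] at h1 ⊢
    rw [add_right_comm Q, ← sub_add_eq_add_sub Q] at h1
    linarith

theorem toTorus_surjective : Function.Surjective (toTorus (d := d)) := by
  intro x
  choose y hy using fun i => QuotientAddGroup.mk_surjective (x i)
  exact ⟨WithLp.toLp 2 y, funext hy⟩

end Reduction

end TwistMap

theorem theorem1 {d : ℕ} (hd : 1 ≤ d)
    (f : TwistMap.Annulus d → TwistMap.Annulus d) (hf : TwistMap.IsSymplecticTwistMap f)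
    (F : TwistMap.Phase ℝ d → TwistMap.Phase ℝ d) (hF : TwistMap.IsLift F f)
    (S : TwistMap.Phase ℝ d → ℝ) (hS : TwistMap.IsGeneratingFunction ℝ F S)
    (G : UnitAddTorus (Fin d) → ℝ)
    (hG : ContDiff ℝ 2 fun q : TwistMap.Vec ℝ d => G (TwistMap.toTorus q))
    (fε : ℝ → TwistMap.Annulus d → TwistMap.Annulus d)
    (hfε : ∀ ε, TwistMap.IsSymplecticTwistMap (fε ε))
    (hSε : ∀ ε, TwistMap.Generates (fun x => S x + ε * G (TwistMap.toTorus x.1)) (fε ε))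
    (Fε : ℝ → TwistMap.Phase ℝ d → TwistMap.Phase ℝ d)
    (hFε : ∀ ε, TwistMap.IsLift (Fε ε) (fε ε))
    (hFεcont : Continuous fun y : ℝ × TwistMap.Phase ℝ d => Fε y.1 y.2)
    (hpos : TwistMap.IsStronglyPositive f)
    (hana : TwistMap.HasAnalyticityProperty f)
    (hGhol : TwistMap.HasHolomorphicExtension G)
    (m : Fin d → ℤ) (n : ℕ) (hn : 0 < n) (hmn : TwistMap.CoprimePair m n) :
    (TwistMap.periodicGraphParameters Fε m n = Set.univ ∨
      ∀ ε ∈ TwistMap.periodicGraphParameters Fε m n, ∃ δ : ℝ, 0 < δ ∧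
        ∀ ε' ∈ TwistMap.periodicGraphParameters Fε m n, |ε' - ε| < δ → ε' = ε) ∧
    (TwistMap.HasBoundedRate f → (¬ ∃ c : ℝ, ∀ x, G x = c) →
      (TwistMap.periodicGraphParameters Fε m n).Finite) := by
  set g : TwistMap.Vec ℝ d → ℝ := fun q => G (TwistMap.toTorus q) with hg
  obtain ⟨gc, hgc, hgext⟩ := hGhol
  have hgω := TwistMap.contDiff_of_holomorphic_extension (g := g) hgc hgext
  have hgper : ∀ (k : Fin d → ℤ) q, g (q + TwistMap.intVec ℝ k) = g q := fun k q => by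
    rw [hg]
    exact congrArg G (TwistMap.toTorus_add_intVec q k)
  obtain ⟨-, hsurj⟩ := hf.lift_periodic_and_surj hF
  have hpert : ∀ ε, TwistMap.IsLift (TwistMap.perturb F g ε) (fε ε) := fun ε => by
    obtain ⟨F', hF', hS'⟩ := hSε ε
    rwa [← hS.eq_perturb hsurj (hgω.differentiable (by simp)) hS']
  choose k hk using fun ε => (hpert ε).exists_translation (hFε ε)
  -- Each `Fε ε` differs from the sheared lift by an integer vector; continuity in ε makes this
  -- vector independent of ε, so it can be absorbed into `F`.
  have hcont : Continuous fun ε => (Fε ε 0).1 - (TwistMap.perturb F g ε 0).1 :=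
    (hFεcont.comp (continuous_id.prodMk continuous_const)).fst.sub
      (hF.1.comp (continuous_const.prodMk
        (continuous_const.add (continuous_id.smul continuous_const)))).fst
  obtain ⟨l, hl⟩ := TwistMap.exists_intVec_of_continuous hcont fun ε =>
    ⟨k ε, by rw [hk ε 0]; simp⟩
  have hF' := hF.add_intVec l
  have hFeq : ∀ ε, Fε ε =
      TwistMap.perturb (fun x => F x + (TwistMap.intVec ℝ l, 0)) g ε := fun ε => by
    have h1 := hl ε
    rw [hk ε 0, Prod.fst_add, add_sub_cancel_left] at h1
    funext x
    rw [hk ε x]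
    exact congrArg (fun v => _ + (v, (0 : TwistMap.Vec ℝ d))) h1
  obtain ⟨-, hsurj'⟩ := hf.lift_periodic_and_surj hF'
  obtain ⟨T, hT, h⟩ := TwistMap.exists_isAnalyticTwist hf hpos hana hF' hgω hgper
  have hpar : TwistMap.periodicGraphParameters Fε m n = TwistMap.IsAnalyticTwist.parameters
      (fun x => F x + (TwistMap.intVec ℝ l, 0)) g m n := by
    ext ε
    exact iff_of_eq (congrArg (TwistMap.HasLagrangianPeriodicGraph · m n) (hFeq ε))
  rw [hpar]
  refine ⟨h.parameters_eq_univ_or_isolated hn, fun hbr hGc => ?_⟩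
  obtain ⟨C, h₁, h₂⟩ := hbr.second_difference_le hF' hT hsurj'
  refine h.finite_parameters hn h₁ h₂ fun ⟨c, hc⟩ => hGc ⟨c, fun x => ?_⟩
  obtain ⟨q, rfl⟩ := TwistMap.toTorus_surjective x
  exact hc q
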